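/- There is a universal constant $L\in(0,\infty)$ such that the following holds. Let $n\ge 0$ be an integer, let $A=(a_{ijk})_{1\le i,j,k\le n}$ be a real array, and let $Z_1,\dots,Z_n$ be independent integrable mean-zero real random variables. Write $B_q^n=\{x\in\mathbb R^n:\|x\|_q\le 1\}$ for the unit ball of $\ell_q^n$, $\|A\|_{HS}=(\sum_{ijk}a_{ijk}^2)^{1/2}$, and $\|Z\|_4=(\mathbb E Z^4)^{1/4}\in[0,\infty]$. Then for every real $p\ge 1$ there exist an integer $N\le \exp(Lp)$, points $(x_l,y_l)\in(B_2^n+\sqrt p\,B_1^n)^2$ and sets $T_l\subset\mathbb R^n\times\mathbb R^n$ $(1\le l\le N)$ such that $$(B_2^n+\sqrt p\,B_1^n)^2=\bigcup_{l\le N}\big((x_l,y_l)+T_l\big)$$ and, for every $l\le N$, $$\mathbb E\sup_{(x,y)\in T_l}\sum_{ijk}a_{ijk}x_iy_jZ_k\le\frac{L}{\sqrt p}\Big(\sum_{ijk}a_{ijk}^2\Big)^{1/4}\,\mathbb E\Big(\sum_{ijk}a_{ijk}^2Z_k^4\Big)^{1/4}\le\frac{L}{\sqrt p}\,\|A\|_{HS}\,\max_{k}\|Z_k\|_4,$$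 where the supremum is finite and integrable, the middle expectation is finite, and the right-hand side may be infinite (with $0\cdot\infty=0$; the supremum over an empty set and the maximum over an empty index set are read as $0$). -/

import Mathlib

open MeasureTheory ProbabilityTheory
open scoped ENNReal Pointwise

noncomputable section

/-- The unit ball `B_q^n` of `ℓ_q^n`, as a subset of `ℝⁿ`; used for `q = 1` and `q = 2`. -/
def lpUnitBall (q : ℝ≥0∞) (n : ℕ) : Set (Fin n → ℝ) :=
  {x | ‖WithLp.toLp q x‖ ≤ 1}

/-- The Minkowski sum `B_2^n + √p B_1^n`. -/
def mixedBall (p : ℝ) (n : ℕ) : Set (Fin n → ℝ) :=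
  lpUnitBall 2 n + Real.sqrt p • lpUnitBall 1 n

/-- The trilinear form `∑_{ijk} a_{ijk} x_i y_j z_k`. -/
def trilinForm {n : ℕ} (a : Fin n → Fin n → Fin n → ℝ) (x y z : Fin n → ℝ) : ℝ :=
  ∑ i, ∑ j, ∑ k, a i j k * x i * y j * z k

/-- The sum of squares `∑_{ijk} a_{ijk}²`. -/
def sumSq {n : ℕ} (a : Fin n → Fin n → Fin n → ℝ) : ℝ :=
  ∑ i, ∑ j, ∑ k, a i j k ^ 2

/-- The Hilbert-Schmidt norm `(∑_{ijk} a_{ijk}²)^{1/2}`. -/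
def hsNorm {n : ℕ} (a : Fin n → Fin n → Fin n → ℝ) : ℝ :=
  Real.sqrt (sumSq a)

/-- The weighted sum `∑_{ijk} a_{ijk}² z_k⁴`. -/
def weightedSumSq {n : ℕ} (a : Fin n → Fin n → Fin n → ℝ) (z : Fin n → ℝ) : ℝ :=
  ∑ i, ∑ j, ∑ k, a i j k ^ 2 * z k ^ 4

end

/-! Fix z and consider the Rademacher process ∑ ε_k z_k t_k with t_k = ∑_{ij} a_{ijk} x_i y_j. Put
S_k = ∑_{ij} a_{ijk}² and H = ∑ S_k. Weighted Cauchy-Schwarz gives ∑ z_k² t_k² ≤ (∑ S_k z_k⁴)^{1/2}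
(∑ t_k⁴ / S_k)^{1/2}. So z enters only through a scalar factor, and all entropy estimates live in a
quartic metric that does not see z. The partition can therefore be chosen before Z, and
symmetrization (`integral_supForm_le`) turns the conditional estimate into one for the Z_k.

Entropy. A vector of B_2 + √p B_1 is lifted to its pair of summands. Covers come from a volumetric
argument with a product law of density proportional to (1+s²)^{-3}: translating a symmetric set by h
multiplies its mass by at least exp(-3 ∑ log(1+h_i²)) (`heavyPi_translate`). This exponent is
dominated both by ∑ h_i² and by ∑ |h_i|, so one law serves the ℓ_2 and the ℓ_1 summand. Its fourth
moment is finite, so each quartic functional is small on a set of probability at least 1/2, and a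
maximal disjoint family of translates has only e^{O(r)} members (`exists_cover`).

Chaining. At scale r take a set of pairs whose rows and columns have quartic size at most H/r² and
whose tensors have quartic diameter at most H/r⁴. It splits into e^{O(r)} pieces around centres b
(`exists_partition`). With w = (x, y), the tensor of w is the sum of the tensor of b, the tensor of
w - b, and two terms linear in w - b. The tensors of w - b satisfy the same hypotheses at scale 4r.
The linear terms cost O(1/√r) (`radBound_side`). Passing to the union of the pieces costs √r times
the L² diameter O(1/r) (`radBound_biUnion`). The total is geometric and starts at r = 4p, hence
O(1/√p) (`radBound_tens`).

The union bound needs subgaussian deviations of suprema above their means. These come from Maurey's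
convex property (τ) on the cube (`signAvg_exp_quadInfConv_mul_le`). The comparison with max ‖Z_k‖_4
is monotonicity of L^q norms. -/

/-! ### Averages over sign vectors. -/

/-- The sign `±1` encoded by a Boolean. -/
def signVal (b : Bool) : ℝ := if b then 1 else -1

/-- The vertex of the cube `{-1,1}ⁿ` encoded by a Boolean vector. -/
def signVec {n : ℕ} (ε : Fin n → Bool) : Fin n → ℝ := fun k => signVal (ε k)

/-- The average over all sign vectors. -/
noncomputable def signAvg {n : ℕ} (f : (Fin n → Bool) → ℝ) : ℝ := (∑ ε, f ε) / 2 ^ n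

lemma signVec_cons {n : ℕ} (b : Bool) (ε : Fin n → Bool) :
    signVec (Fin.cons b ε : Fin (n + 1) → Bool) = Fin.cons (signVal b) (signVec ε) := by
  funext k
  refine Fin.cases ?_ (fun i => ?_) k <;> simp [signVec]

lemma signAvg_succ {n : ℕ} (f : (Fin (n + 1) → Bool) → ℝ) :
    signAvg f = (signAvg (fun ε => f (Fin.cons true ε)) +
      signAvg (fun ε => f (Fin.cons false ε))) / 2 := by
  unfold signAvg
  have h : ∑ ε, f ε = ∑ q : Bool × (Fin n → Bool), f (Fin.cons q.1 q.2) :=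
    (Fintype.sum_equiv (Fin.consEquiv (fun _ : Fin (n + 1) => Bool)) _ _ (fun q => rfl)).symm
  rw [h, Fintype.sum_prod_type]
  simp only [Fintype.sum_bool]
  rw [pow_succ]
  field_simp

lemma signAvg_mono {n : ℕ} {f g : (Fin n → Bool) → ℝ} (h : ∀ ε, f ε ≤ g ε) :
    signAvg f ≤ signAvg g := by
  unfold signAvg
  gcongr with ε
  exact h ε

lemma signAvg_add {n : ℕ} (f g : (Fin n → Bool) → ℝ) :
    signAvg (fun ε => f ε + g ε) = signAvg f + signAvg g := by
  simp [signAvg, Finset.sum_add_distrib, add_div]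

lemma signAvg_const_mul {n : ℕ} (c : ℝ) (f : (Fin n → Bool) → ℝ) :
    signAvg (fun ε => c * f ε) = c * signAvg f := by
  simp [signAvg, ← Finset.mul_sum, mul_div_assoc]

lemma signAvg_const {n : ℕ} (c : ℝ) : signAvg (fun _ : Fin n → Bool => c) = c := by
  simp [signAvg]

lemma signAvg_sum {n : ℕ} {ι : Type*} (s : Finset ι) (f : ι → (Fin n → Bool) → ℝ) :
    signAvg (fun ε => ∑ i ∈ s, f i ε) = ∑ i ∈ s, signAvg (f i) := by
  simp only [signAvg, Finset.sum_div]
  rw [Finset.sum_comm]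

lemma signAvg_pos {n : ℕ} {f : (Fin n → Bool) → ℝ} (h : ∀ ε, 0 < f ε) : 0 < signAvg f := by
  unfold signAvg
  have : 0 < ∑ ε, f ε := Finset.sum_pos (fun ε _ => h ε) Finset.univ_nonempty
  positivity

lemma signAvg_flip {n : ℕ} (f : (Fin n → Bool) → ℝ) (k : Fin n) :
    signAvg (fun ε => f (Function.update ε k (!ε k))) = signAvg f := by
  unfold signAvg
  congr 1
  refine Fintype.sum_equiv (Function.Involutive.toPerm
    (fun ε : Fin n → Bool => Function.update ε k (!ε k)) ?_) _ _ (fun ε => rfl)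
  intro ε
  simp

lemma signVal_not (b : Bool) : signVal (!b) = -signVal b := by
  cases b <;> simp [signVal]

lemma signVal_sq (b : Bool) : signVal b * signVal b = 1 := by
  cases b <;> simp [signVal]

lemma signAvg_signVal {n : ℕ} (k : Fin n) : signAvg (fun ε => signVal (ε k)) = 0 := by
  have h := signAvg_flip (fun ε : Fin n → Bool => signVal (ε k)) k
  simp only [Function.update_self, signVal_not] at h
  have h2 := signAvg_const_mul (-1) (fun ε : Fin n → Bool => signVal (ε k))
  simp only [neg_one_mul] at h2
  linarith

lemma signAvg_signVal_mul {n : ℕ} {k l : Fin n} (hkl : k ≠ l) :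
    signAvg (fun ε => signVal (ε k) * signVal (ε l)) = 0 := by
  have h := signAvg_flip (fun ε : Fin n → Bool => signVal (ε k) * signVal (ε l)) k
  simp only [Function.update_self, Function.update_of_ne hkl.symm, signVal_not] at h
  have h2 := signAvg_const_mul (-1) (fun ε : Fin n → Bool => signVal (ε k) * signVal (ε l))
  simp only [neg_one_mul] at h2
  simp only [neg_mul] at h
  linarith

/-- The Rademacher linear form `∑ ε_k t_k`. -/
def signForm {n : ℕ} (ε : Fin n → Bool) (t : Fin n → ℝ) : ℝ := ∑ k, signVal (ε k) * t k

lemma signForm_add {n : ℕ} (ε : Fin n → Bool) (s t : Fin n → ℝ) :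
    signForm ε (s + t) = signForm ε s + signForm ε t := by
  simp [signForm, mul_add, Finset.sum_add_distrib]

lemma signAvg_signForm {n : ℕ} (t : Fin n → ℝ) : signAvg (fun ε => signForm ε t) = 0 := by
  unfold signForm
  rw [signAvg_sum]
  refine Finset.sum_eq_zero fun k _ => ?_
  have := signAvg_const_mul (t k) (fun ε : Fin n → Bool => signVal (ε k))
  simp only [signAvg_signVal, mul_zero] at this
  simpa [mul_comm] using this

lemma signAvg_signForm_sq {n : ℕ} (t : Fin n → ℝ) :
    signAvg (fun ε => signForm ε t ^ 2) = ∑ k, t k ^ 2 := by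
  have h : ∀ ε : Fin n → Bool, signForm ε t ^ 2 =
      ∑ k, ∑ l, (t k * t l) * (signVal (ε k) * signVal (ε l)) := by
    intro ε
    rw [sq, signForm, Finset.sum_mul_sum]
    refine Finset.sum_congr rfl fun k _ => Finset.sum_congr rfl fun l _ => by ring
  simp only [h]
  rw [signAvg_sum]
  refine Finset.sum_congr rfl fun k _ => ?_
  rw [signAvg_sum, Finset.sum_eq_single k]
  · rw [signAvg_const_mul]
    simp only [signVal_sq, signAvg_const]
    ring
  · intro l _ hl
    rw [signAvg_const_mul, signAvg_signVal_mul hl.symm, mul_zero]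
  · simp

/-- `avg f ≤ √(avg f²)`. -/
lemma signAvg_le_sqrt {n : ℕ} (f : (Fin n → Bool) → ℝ) :
    signAvg f ≤ Real.sqrt (signAvg (fun ε => f ε ^ 2)) := by
  apply Real.le_sqrt_of_sq_le
  have h0 : 0 ≤ signAvg (fun ε => (f ε - signAvg f) ^ 2) := by
    have := signAvg_mono (n := n) (f := fun _ => 0) (g := fun ε => (f ε - signAvg f) ^ 2)
      (fun ε => sq_nonneg _)
    rwa [signAvg_const] at this
  have h1 : signAvg (fun ε => (f ε - signAvg f) ^ 2)
      = signAvg (fun ε => f ε ^ 2) + (-2 * signAvg f) * signAvg f + signAvg f ^ 2 := by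
    rw [← signAvg_const_mul, ← signAvg_add, ← signAvg_const (n := n) (signAvg f ^ 2), ← signAvg_add]
    congr 1
    funext ε
    ring
  nlinarith

/-- Jensen's inequality for the exponential. -/
lemma exp_signAvg_le {n : ℕ} (f : (Fin n → Bool) → ℝ) :
    Real.exp (signAvg f) ≤ signAvg (fun ε => Real.exp (f ε)) := by
  have h : ∀ ε, Real.exp (signAvg f) * (f ε + (1 - signAvg f)) ≤ Real.exp (f ε) := by
    intro ε
    have := Real.add_one_le_exp (f ε - signAvg f)
    calc Real.exp (signAvg f) * (f ε + (1 - signAvg f))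
        ≤ Real.exp (signAvg f) * Real.exp (f ε - signAvg f) := by gcongr; linarith
      _ = Real.exp (f ε) := by rw [← Real.exp_add]; ring_nf
  have h2 := signAvg_mono h
  rw [signAvg_const_mul, signAvg_add, signAvg_const] at h2
  simpa using h2

/-! ### Convex property (τ) on the discrete cube. -/

/-- The one-dimensional core of property (τ): d is the gap between the logarithmic exponential
averages of the two slices, θ the fraction of the way moved towards the other slice, and θ²/8 the
cost (2θ)²/32 of that move. -/
lemma two_point_exp_le {d : ℝ} (hd : 0 ≤ d) :
    ∃ θ : ℝ, 0 ≤ θ ∧ θ ≤ 1 ∧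
      (Real.exp ((1 - θ) * d + θ ^ 2 / 8) + 1) * (Real.exp (-d) + 1) ≤ 4 := by
  -- The exponent (1-θ)d + θ²/8 is minimal at θ = 4d, with value d - 2d²; beyond d = 1/4 the
  -- minimizer is cut off at θ = 1.
  rcases le_total d (1 / 4) with h | h
  · refine ⟨4 * d, by linarith, by linarith, ?_⟩
    have e1 : (1 - 4 * d) * d + (4 * d) ^ 2 / 8 = d - 2 * d ^ 2 := by ring
    rw [e1]
    have b : ∀ x : ℝ, |x| ≤ 1 → Real.exp x ≤ 1 + x + x ^ 2 := fun x hx => by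
      have := (abs_le.1 (Real.abs_exp_sub_one_sub_id_le hx)).2
      linarith
    have h1 := b (d - 2 * d ^ 2) (by rw [abs_le]; constructor <;> nlinarith)
    have h2 := b (-d) (by rw [abs_le]; constructor <;> linarith)
    have h3 := b (-(2 * d ^ 2)) (by rw [abs_le]; constructor <;> nlinarith)
    have e2 : Real.exp (d - 2 * d ^ 2) * Real.exp (-d) = Real.exp (-(2 * d ^ 2)) := by
      rw [← Real.exp_add]; ring_nf
    have e3 : (Real.exp (d - 2 * d ^ 2) + 1) * (Real.exp (-d) + 1)
        = Real.exp (-(2 * d ^ 2)) + Real.exp (d - 2 * d ^ 2) + Real.exp (-d) + 1 := by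
      rw [← e2]; ring
    rw [e3]
    nlinarith [sq_nonneg d, mul_nonneg hd hd, mul_nonneg (mul_nonneg hd hd) hd,
      mul_nonneg (mul_nonneg hd hd) (mul_nonneg hd hd), mul_nonneg (mul_nonneg hd hd)
        (sub_nonneg.2 h)]
  · refine ⟨1, by norm_num, le_refl _, ?_⟩
    have h1 : Real.exp ((1 - 1) * d + 1 ^ 2 / 8) ≤ 1 + 1 / 8 + (1 / 8) ^ 2 := by
      have := (abs_le.1 (Real.abs_exp_sub_one_sub_id_le (x := 1 / 8) (by norm_num [abs_le]))).2
      norm_num at this ⊢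
      linarith
    have h2 : Real.exp (-d) ≤ 13 / 16 := by
      have := (abs_le.1 (Real.abs_exp_sub_one_sub_id_le (x := -(1 / 4))
        (by norm_num [abs_le]))).2
      have h3 : Real.exp (-d) ≤ Real.exp (-(1 / 4)) := Real.exp_le_exp.2 (by linarith)
      norm_num at this ⊢
      linarith
    nlinarith [Real.exp_pos (-d), Real.exp_pos ((1 - 1) * d + 1 ^ 2 / 8)]

/-- The infimum convolution of `f` with the quadratic cost `|·|²/32`. -/
noncomputable def quadInfConv {n : ℕ} (f : (Fin n → ℝ) → ℝ) (x : Fin n → ℝ) : ℝ :=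
  ⨅ y, f y + (1 / 32) * ∑ i, (x i - y i) ^ 2

lemma quadInfConv_bddBelow {n : ℕ} {f : (Fin n → ℝ) → ℝ} (hb : ∃ m, ∀ y, m ≤ f y)
    (x : Fin n → ℝ) :
    BddBelow (Set.range fun y => f y + (1 / 32) * ∑ i, (x i - y i) ^ 2) := by
  obtain ⟨m, hm⟩ := hb
  refine ⟨m, ?_⟩
  rintro _ ⟨y, rfl⟩
  have : 0 ≤ ∑ i, (x i - y i) ^ 2 := Finset.sum_nonneg fun i _ => sq_nonneg _
  have := hm y
  dsimp only
  linarith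

lemma quadInfConv_le {n : ℕ} {f : (Fin n → ℝ) → ℝ} (hb : ∃ m, ∀ y, m ≤ f y)
    (x y : Fin n → ℝ) : quadInfConv f x ≤ f y + (1 / 32) * ∑ i, (x i - y i) ^ 2 :=
  ciInf_le (quadInfConv_bddBelow hb x) y

lemma exists_lt_quadInfConv {n : ℕ} (f : (Fin n → ℝ) → ℝ) (x : Fin n → ℝ) {δ : ℝ} (hδ : 0 < δ) :
    ∃ y, f y + (1 / 32) * ∑ i, (x i - y i) ^ 2 < quadInfConv f x + δ :=
  exists_lt_of_ciInf_lt (lt_add_of_pos_right _ hδ)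

lemma quadInfConv_cons_same {n : ℕ} {f : (Fin (n + 1) → ℝ) → ℝ} (hb : ∃ m, ∀ y, m ≤ f y)
    (s : ℝ) (x : Fin n → ℝ) :
    quadInfConv f (Fin.cons s x) ≤ quadInfConv (fun y => f (Fin.cons s y)) x := by
  refine le_ciInf fun y => ?_
  refine (quadInfConv_le hb _ (Fin.cons s y)).trans (le_of_eq ?_)
  simp [Fin.sum_univ_succ]

/-- The competitor is a convex combination of near-minimizers in the two slices. Convexity of f
controls its value, convexity of the square controls the cost in the remaining coordinates, and the
first coordinate moves by 2θ, costing 4θ²/32. -/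
lemma quadInfConv_cons_mix {n : ℕ} {f : (Fin (n + 1) → ℝ) → ℝ} (hf : ConvexOn ℝ Set.univ f)
    (hb : ∃ m, ∀ y, m ≤ f y) (s s' θ : ℝ) (h0 : 0 ≤ θ) (h1 : θ ≤ 1) (hs : (s - s') ^ 2 = 4)
    (x : Fin n → ℝ) :
    quadInfConv f (Fin.cons s x) ≤ (1 - θ) * quadInfConv (fun y => f (Fin.cons s y)) x
      + θ * quadInfConv (fun y => f (Fin.cons s' y)) x + θ ^ 2 / 8 := by
  refine le_of_forall_pos_le_add fun δ hδ => ?_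
  obtain ⟨y, hy⟩ := exists_lt_quadInfConv (fun y => f (Fin.cons s y)) x hδ
  obtain ⟨y', hy'⟩ := exists_lt_quadInfConv (fun y => f (Fin.cons s' y)) x hδ
  have h := quadInfConv_le hb (Fin.cons s x)
    ((1 - θ) • (Fin.cons s y : Fin (n + 1) → ℝ) + θ • (Fin.cons s' y' : Fin (n + 1) → ℝ))
  have hc := hf.2 (Set.mem_univ (Fin.cons s y : Fin (n + 1) → ℝ))
    (Set.mem_univ (Fin.cons s' y' : Fin (n + 1) → ℝ)) (sub_nonneg.2 h1) h0 (by ring)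
  simp only [smul_eq_mul] at hc
  have hq : ∑ i, ((Fin.cons s x : Fin (n + 1) → ℝ) i -
      ((1 - θ) • (Fin.cons s y : Fin (n + 1) → ℝ) + θ • (Fin.cons s' y' : Fin (n + 1) → ℝ)) i) ^ 2
      ≤ 4 * θ ^ 2 + ((1 - θ) * ∑ i, (x i - y i) ^ 2 + θ * ∑ i, (x i - y' i) ^ 2) := by
    rw [Fin.sum_univ_succ]
    simp only [Pi.add_apply, Pi.smul_apply, Fin.cons_zero, Fin.cons_succ, smul_eq_mul]
    have e0 : (s - ((1 - θ) * s + θ * s')) ^ 2 = 4 * θ ^ 2 := by rw [← hs]; ring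
    rw [e0, Finset.mul_sum, Finset.mul_sum, ← Finset.sum_add_distrib]
    gcongr with i
    have : (1 - θ) * (x i - y i) ^ 2 + θ * (x i - y' i) ^ 2
      - (x i - ((1 - θ) * y i + θ * y' i)) ^ 2 = θ * (1 - θ) * (y i - y' i) ^ 2 := by ring
    have : 0 ≤ θ * (1 - θ) * (y i - y' i) ^ 2 := by
      have := sub_nonneg.2 h1
      positivity
    linarith
  have e1 := mul_le_mul_of_nonneg_left hy.le (sub_nonneg.2 h1)
  have e2 := mul_le_mul_of_nonneg_left hy'.le h0
  nlinarith

/-- Hölder's inequality with exponents 1/(1-θ) and 1/θ. Subtracting from u and v their logarithmic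
averages reduces it to convexity of exp. -/
lemma signAvg_exp_mix_le {n : ℕ} (u v : (Fin n → Bool) → ℝ) {θ : ℝ} (h0 : 0 ≤ θ) (h1 : θ ≤ 1) :
    signAvg (fun ε => Real.exp ((1 - θ) * u ε + θ * v ε)) ≤
      Real.exp ((1 - θ) * Real.log (signAvg fun ε => Real.exp (u ε))
        + θ * Real.log (signAvg fun ε => Real.exp (v ε))) := by
  have pu : 0 < signAvg fun ε => Real.exp (u ε) := signAvg_pos fun ε => Real.exp_pos _
  have pv : 0 < signAvg fun ε => Real.exp (v ε) := signAvg_pos fun ε => Real.exp_pos _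
  set A := Real.log (signAvg fun ε => Real.exp (u ε)) with hA
  set B := Real.log (signAvg fun ε => Real.exp (v ε)) with hB
  have key : ∀ ε, Real.exp ((1 - θ) * u ε + θ * v ε) ≤ Real.exp ((1 - θ) * A + θ * B) *
      (((1 - θ) * Real.exp (-A)) * Real.exp (u ε) + (θ * Real.exp (-B)) * Real.exp (v ε)) := by
    intro ε
    have hc := convexOn_exp.2 (Set.mem_univ (u ε - A)) (Set.mem_univ (v ε - B))
      (sub_nonneg.2 h1) h0 (by ring)
    simp only [smul_eq_mul] at hc
    calc Real.exp ((1 - θ) * u ε + θ * v ε)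
        = Real.exp ((1 - θ) * A + θ * B) * Real.exp ((1 - θ) * (u ε - A) + θ * (v ε - B)) := by
          rw [← Real.exp_add]; ring_nf
      _ ≤ Real.exp ((1 - θ) * A + θ * B) *
          ((1 - θ) * Real.exp (u ε - A) + θ * Real.exp (v ε - B)) := by gcongr
      _ = _ := by
          rw [sub_eq_add_neg (u ε), sub_eq_add_neg (v ε), Real.exp_add (u ε), Real.exp_add (v ε)]
          ring
  refine (signAvg_mono key).trans (le_of_eq ?_)
  rw [signAvg_const_mul, signAvg_add, signAvg_const_mul, signAvg_const_mul]
  have ea : Real.exp (-A) * (signAvg fun ε => Real.exp (u ε)) = 1 := by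
    rw [Real.exp_neg, hA, Real.exp_log pu, inv_mul_cancel₀ pu.ne']
  have eb : Real.exp (-B) * (signAvg fun ε => Real.exp (v ε)) = 1 := by
    rw [Real.exp_neg, hB, Real.exp_log pv, inv_mul_cancel₀ pv.ne']
  rw [mul_assoc, mul_assoc, ea, eb]
  ring

/-- Maurey's convex property (τ) for the uniform measure on the discrete cube. -/
theorem signAvg_exp_quadInfConv_mul_le {n : ℕ} : ∀ (f : (Fin n → ℝ) → ℝ),
    ConvexOn ℝ Set.univ f → (∃ m, ∀ y, m ≤ f y) →
    signAvg (fun ε => Real.exp (quadInfConv f (signVec ε))) *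
      signAvg (fun ε => Real.exp (-f (signVec ε))) ≤ 1 := by
  induction n with
  | zero =>
    intro f _ hb
    have h : ∀ ε : Fin 0 → Bool, quadInfConv f (signVec ε) ≤ f (signVec default) := by
      intro ε
      have := quadInfConv_le hb (signVec ε) (signVec default)
      simpa using this
    have h1 := signAvg_mono (fun ε => Real.exp_le_exp.2 (h ε))
    rw [signAvg_const] at h1
    have h2 : signAvg (fun ε : Fin 0 → Bool => Real.exp (-f (signVec ε)))
        = Real.exp (-f (signVec default)) := by
      rw [← signAvg_const (n := 0) (Real.exp (-f (signVec default)))]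
      congr 1
      funext ε
      rw [Subsingleton.elim ε default]
    rw [h2]
    calc _ ≤ Real.exp (f (signVec default)) * Real.exp (-f (signVec default)) := by gcongr
      _ = 1 := by rw [← Real.exp_add]; simp
  | succ n ih =>
    intro f hf hb
    have hslice : ∀ s : ℝ, ConvexOn ℝ Set.univ (fun y : Fin n → ℝ => f (Fin.cons s y)) := by
      intro s
      refine ⟨convex_univ, fun y _ y' _ a b ha hb hab => ?_⟩
      have := hf.2 (Set.mem_univ (Fin.cons s y : Fin (n + 1) → ℝ))
        (Set.mem_univ (Fin.cons s y' : Fin (n + 1) → ℝ)) ha hb hab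
      refine le_trans (le_of_eq (congrArg f ?_)) this
      funext k
      refine Fin.cases ?_ (fun i => ?_) k
      · simp [← add_mul, hab]
      · simp
    have hbs : ∀ s : ℝ, ∃ m, ∀ y : Fin n → ℝ, m ≤ f (Fin.cons s y) := fun s =>
      hb.imp fun m hm y => hm _
    -- the two slices enter symmetrically
    have main : ∀ b b' : Bool, b' = !b →
        signAvg (fun ε : Fin n → Bool => Real.exp
          (quadInfConv (fun y => f (Fin.cons (signVal b') y)) (signVec ε))) ≤
        signAvg (fun ε : Fin n → Bool => Real.exp
          (quadInfConv (fun y => f (Fin.cons (signVal b) y)) (signVec ε))) →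
        (signAvg (fun ε : Fin n → Bool => Real.exp
          (quadInfConv f (Fin.cons (signVal b) (signVec ε)))) +
        signAvg (fun ε : Fin n → Bool => Real.exp
          (quadInfConv f (Fin.cons (signVal b') (signVec ε))))) *
        (signAvg (fun ε : Fin n → Bool => Real.exp (-f (Fin.cons (signVal b) (signVec ε)))) +
        signAvg (fun ε : Fin n → Bool => Real.exp (-f (Fin.cons (signVal b') (signVec ε))))) ≤ 4 := by
      intro b b' hbb hle
      set U := signAvg (fun ε : Fin n → Bool => Real.exp
          (quadInfConv (fun y => f (Fin.cons (signVal b) y)) (signVec ε))) with hU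
      set U' := signAvg (fun ε : Fin n → Bool => Real.exp
          (quadInfConv (fun y => f (Fin.cons (signVal b') y)) (signVec ε))) with hU'
      have pU : 0 < U := signAvg_pos fun ε => Real.exp_pos _
      have pU' : 0 < U' := signAvg_pos fun ε => Real.exp_pos _
      set A := Real.log U with hA
      set B := Real.log U' with hB
      have hAB : 0 ≤ A - B := sub_nonneg.2 (Real.log_le_log pU' hle)
      obtain ⟨θ, h0, h1, hθ⟩ := two_point_exp_le hAB
      have hs : (signVal b - signVal b') ^ 2 = 4 := by
        subst hbb
        rw [signVal_not]
        have := signVal_sq b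
        nlinarith
      -- The slice with the larger exponential average borrows competitors from the other one, while
      -- the smaller slice keeps its own. The induction hypothesis bounds the averages of e^{-f} by
      -- e^{-A} and e^{-B}, and after cancelling e^{±B} only the gap A - B remains.
      have i1 : signAvg (fun ε : Fin n → Bool => Real.exp
          (quadInfConv f (Fin.cons (signVal b) (signVec ε)))) ≤
          Real.exp ((1 - θ) * A + θ * B) * Real.exp (θ ^ 2 / 8) := by
        have := signAvg_exp_mix_le (n := n)
          (fun ε => quadInfConv (fun y => f (Fin.cons (signVal b) y)) (signVec ε))
          (fun ε => quadInfConv (fun y => f (Fin.cons (signVal b') y)) (signVec ε)) h0 h1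
        refine le_trans ?_ (mul_le_mul_of_nonneg_right this (Real.exp_pos _).le)
        rw [mul_comm, ← signAvg_const_mul]
        refine signAvg_mono fun ε => ?_
        rw [← Real.exp_add]
        refine Real.exp_le_exp.2 ?_
        have := quadInfConv_cons_mix hf hb (signVal b) (signVal b') θ h0 h1 hs (signVec ε)
        linarith
      have i2 : signAvg (fun ε : Fin n → Bool => Real.exp
          (quadInfConv f (Fin.cons (signVal b') (signVec ε)))) ≤ Real.exp B := by
        rw [hB, Real.exp_log pU']
        exact signAvg_mono fun ε => Real.exp_le_exp.2 (quadInfConv_cons_same hb _ _)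
      have i3 : signAvg (fun ε : Fin n → Bool => Real.exp
          (-f (Fin.cons (signVal b) (signVec ε)))) ≤ Real.exp (-A) := by
        have := ih _ (hslice (signVal b)) (hbs _)
        rw [← hU, mul_comm, ← le_div_iff₀ pU] at this
        rwa [Real.exp_neg, hA, Real.exp_log pU, ← one_div]
      have i4 : signAvg (fun ε : Fin n → Bool => Real.exp
          (-f (Fin.cons (signVal b') (signVec ε)))) ≤ Real.exp (-B) := by
        have := ih _ (hslice (signVal b')) (hbs _)
        rw [← hU', mul_comm, ← le_div_iff₀ pU'] at this
        rwa [Real.exp_neg, hB, Real.exp_log pU', ← one_div]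
      have p3 : 0 < signAvg (fun ε : Fin n → Bool => Real.exp
          (-f (Fin.cons (signVal b) (signVec ε)))) := signAvg_pos fun ε => Real.exp_pos _
      have p4 : 0 < signAvg (fun ε : Fin n → Bool => Real.exp
          (-f (Fin.cons (signVal b') (signVec ε)))) := signAvg_pos fun ε => Real.exp_pos _
      calc _ ≤ (Real.exp ((1 - θ) * A + θ * B) * Real.exp (θ ^ 2 / 8) + Real.exp B)
            * (Real.exp (-A) + Real.exp (-B)) := by gcongr
        _ = (Real.exp ((1 - θ) * (A - B) + θ ^ 2 / 8) + 1) * (Real.exp (-(A - B)) + 1) := by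
          have e1 : Real.exp ((1 - θ) * A + θ * B) * Real.exp (θ ^ 2 / 8)
            = Real.exp B * Real.exp ((1 - θ) * (A - B) + θ ^ 2 / 8) := by
            rw [← Real.exp_add, ← Real.exp_add]; ring_nf
          have e2 : Real.exp (-A) = Real.exp (-B) * Real.exp (-(A - B)) := by
            rw [← Real.exp_add]; ring_nf
          have e3 : Real.exp B * Real.exp (-B) = 1 := by rw [← Real.exp_add]; simp
          rw [e1, e2]
          linear_combination ((Real.exp ((1 - θ) * (A - B) + θ ^ 2 / 8) + 1)
            * (Real.exp (-(A - B)) + 1)) * e3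
        _ ≤ 4 := hθ
    rw [signAvg_succ, signAvg_succ]
    simp only [signVec_cons]
    rcases le_total (signAvg (fun ε : Fin n → Bool => Real.exp
          (quadInfConv (fun y => f (Fin.cons (signVal false) y)) (signVec ε))))
        (signAvg (fun ε : Fin n → Bool => Real.exp
          (quadInfConv (fun y => f (Fin.cons (signVal true) y)) (signVec ε)))) with h | h
    · have := main true false rfl h
      linarith
    · have := main false true rfl h
      linarith

/-- Exponential integrability of convex functions on the cube that satisfy a Lipschitz type
condition. -/
theorem signAvg_exp_sub_le {n : ℕ} {f : (Fin n → ℝ) → ℝ} (hf : ConvexOn ℝ Set.univ f)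
    (hb : ∃ m, ∀ y, m ≤ f y) {D : ℝ}
    (hD : ∀ x y, f x ≤ f y + D + (1 / 32) * ∑ i, (x i - y i) ^ 2) :
    signAvg (fun ε => Real.exp (f (signVec ε))) ≤
      Real.exp (D + signAvg (fun ε => f (signVec ε))) := by
  have h := signAvg_exp_quadInfConv_mul_le f hf hb
  -- The hypothesis on D says exactly that f - D lies below the infimum convolution of f; Jensen
  -- then disposes of the average of e^{-f}.
  have h1 : Real.exp (-D) * signAvg (fun ε => Real.exp (f (signVec ε))) ≤
      signAvg (fun ε => Real.exp (quadInfConv f (signVec ε))) := by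
    rw [← signAvg_const_mul]
    refine signAvg_mono fun ε => ?_
    rw [← Real.exp_add]
    refine Real.exp_le_exp.2 (le_ciInf fun y => ?_)
    have := hD (signVec ε) y
    linarith
  have h2 : Real.exp (-signAvg (fun ε => f (signVec ε))) ≤
      signAvg (fun ε => Real.exp (-f (signVec ε))) := by
    refine le_trans (le_of_eq ?_) (exp_signAvg_le _)
    congr 1
    have := signAvg_const_mul (-1) (fun ε : Fin n → Bool => f (signVec ε))
    simp only [neg_one_mul] at this
    exact this.symm
  have p1 : 0 < signAvg (fun ε => Real.exp (f (signVec ε))) := signAvg_pos fun ε => Real.exp_pos _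
  have h3 := (mul_le_mul h1 h2 (Real.exp_pos _).le
    (signAvg_pos fun ε => Real.exp_pos _).le).trans h
  have e : Real.exp (D + signAvg (fun ε => f (signVec ε))) *
      (Real.exp (-D) * Real.exp (-signAvg (fun ε => f (signVec ε)))) = 1 := by
    rw [← Real.exp_add, ← Real.exp_add, Real.exp_eq_one_iff]; ring
  have := mul_le_mul_of_nonneg_left h3
    (Real.exp_pos (D + signAvg (fun ε => f (signVec ε)))).le
  have e' : Real.exp (D + signAvg (fun ε => f (signVec ε))) *
      (Real.exp (-D) * signAvg (fun ε => Real.exp (f (signVec ε))) *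
        Real.exp (-signAvg (fun ε => f (signVec ε)))) =
      signAvg (fun ε => Real.exp (f (signVec ε))) := by
    linear_combination (signAvg (fun ε => Real.exp (f (signVec ε)))) * e
  rw [e', mul_one] at this
  exact this

/-! ### Rademacher suprema: unions and chaining. -/

/-- `RadBound T c`: the expected supremum of the Rademacher process indexed by `T` is at
most `c`. -/
def RadBound {n : ℕ} (T : Set (Fin n → ℝ)) (c : ℝ) : Prop :=
  ∃ g : (Fin n → Bool) → ℝ, (∀ ε, ∀ t ∈ T, signForm ε t ≤ g ε) ∧ signAvg g ≤ c

lemma RadBound.mono {n : ℕ} {T T' : Set (Fin n → ℝ)} {c c' : ℝ} (h : RadBound T c)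
    (hT : T' ⊆ T) (hc : c ≤ c') : RadBound T' c' := by
  obtain ⟨g, hg, hgc⟩ := h
  exact ⟨g, fun ε t ht => hg ε t (hT ht), hgc.trans hc⟩

lemma RadBound.add {n : ℕ} {T T' : Set (Fin n → ℝ)} {c c' : ℝ} (h : RadBound T c)
    (h' : RadBound T' c') : RadBound (T + T') (c + c') := by
  obtain ⟨g, hg, hgc⟩ := h
  obtain ⟨g', hg', hgc'⟩ := h'
  refine ⟨fun ε => g ε + g' ε, ?_, by rw [signAvg_add]; linarith⟩
  rintro ε _ ⟨t, ht, t', ht', rfl⟩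
  dsimp only
  rw [signForm_add]
  exact add_le_add (hg ε t ht) (hg' ε t' ht')

lemma radBound_singleton {n : ℕ} (t : Fin n → ℝ) : RadBound {t} 0 := by
  refine ⟨fun ε => signForm ε t, ?_, (signAvg_signForm t).le⟩
  rintro ε _ rfl
  exact le_rfl

lemma radBound_empty {n : ℕ} (c : ℝ) : RadBound (∅ : Set (Fin n → ℝ)) c :=
  ⟨fun _ => c, fun _ _ h => h.elim, (signAvg_const c).le⟩

lemma signForm_le_sqrt {n : ℕ} (ε : Fin n → Bool) (t : Fin n → ℝ) :
    signForm ε t ≤ Real.sqrt n * Real.sqrt (∑ k, t k ^ 2) := by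
  rw [← Real.sqrt_mul (Nat.cast_nonneg n)]
  apply Real.le_sqrt_of_sq_le
  have := Finset.sum_mul_sq_le_sq_mul_sq Finset.univ (fun k => signVal (ε k)) t
  refine this.trans (le_of_eq ?_)
  simp [sq, signVal_sq]

/-- A crude bound through the diameter. -/
lemma radBound_of_diam {n : ℕ} {T : Set (Fin n → ℝ)} {σ : ℝ} (hσ : 0 ≤ σ)
    (hT : ∀ t ∈ T, ∀ t' ∈ T, ∑ k, (t k - t' k) ^ 2 ≤ σ ^ 2) :
    RadBound T (Real.sqrt n * σ) := by
  rcases T.eq_empty_or_nonempty with rfl | ⟨t₀, h₀⟩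
  · exact radBound_empty _
  refine ⟨fun ε => signForm ε t₀ + Real.sqrt n * σ, fun ε t ht => ?_, ?_⟩
  · have e : t = t₀ + (t - t₀) := by abel
    dsimp only
    rw [e, signForm_add]
    refine add_le_add_right ((signForm_le_sqrt ε _).trans ?_) _
    gcongr
    rw [← Real.sqrt_sq hσ]
    exact Real.sqrt_le_sqrt (hT t ht t₀ h₀)
  · rw [signAvg_add, signAvg_signForm, signAvg_const, zero_add]

lemma signForm_eq {n : ℕ} (ε : Fin n → Bool) (t : Fin n → ℝ) :
    signForm ε t = ∑ k, signVec ε k * t k := rfl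

/-- Upgrades a bound on the mean to one on the exponential moment. The function y ↦ sup l⟨y,t⟩ is
convex, and l⟨x-y,t⟩ ≤ 8l²|t|² + |x-y|²/32, so `signAvg_exp_sub_le` applies with D = 8l²σ². -/
lemma RadBound.exists_exp_le {n : ℕ} {T : Set (Fin n → ℝ)} {c σ l : ℝ} (h : RadBound T c)
    (hne : T.Nonempty) (hσ : 0 ≤ σ) (hl : 0 < l) (hT : ∀ t ∈ T, ∑ k, t k ^ 2 ≤ σ ^ 2) :
    ∃ g : (Fin n → Bool) → ℝ, (∀ ε, ∀ t ∈ T, l * signForm ε t ≤ g ε) ∧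
      signAvg (fun ε => Real.exp (g ε)) ≤ Real.exp (8 * l ^ 2 * σ ^ 2 + l * c) := by
  have : Nonempty T := hne.to_subtype
  -- Property (τ) is applied to functions bounded below on all of ℝⁿ, so the linear forms are
  -- truncated at -M. At the vertices of the cube this changes nothing, by `hlow`.
  set M : ℝ := l * (Real.sqrt n * σ) with hM
  set F : (Fin n → ℝ) → ℝ := fun y => ⨆ t : T, max (l * ∑ k, y k * t.1 k) (-M) with hF
  have hlow : ∀ t ∈ T, ∀ ε, -M ≤ l * signForm ε t := by
    intro t ht ε
    have h1 := signForm_le_sqrt ε (-t)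
    have e : signForm ε (-t) = -signForm ε t := by simp [signForm]
    have h2 : Real.sqrt (∑ k, (-t) k ^ 2) ≤ σ := by
      rw [← Real.sqrt_sq hσ]
      refine Real.sqrt_le_sqrt ?_
      simpa using hT t ht
    rw [e] at h1
    have h3 : -signForm ε t ≤ Real.sqrt n * σ := h1.trans (by gcongr)
    have := mul_le_mul_of_nonneg_left h3 hl.le
    rw [hM]
    linarith
  have hbdd : ∀ y : Fin n → ℝ, BddAbove (Set.range fun t : T => max (l * ∑ k, y k * t.1 k) (-M)) := by
    intro y
    refine ⟨max (l * (Real.sqrt (∑ k, y k ^ 2) * σ)) (-M), ?_⟩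
    rintro _ ⟨t, rfl⟩
    refine max_le_max ?_ le_rfl
    gcongr
    refine (Real.sum_mul_le_sqrt_mul_sqrt _ _ _).trans ?_
    gcongr
    rw [← Real.sqrt_sq hσ]
    exact Real.sqrt_le_sqrt (hT t.1 t.2)
  have hle : ∀ (y : Fin n → ℝ) (t : T), max (l * ∑ k, y k * t.1 k) (-M) ≤ F y := fun y t => le_ciSup (hbdd y) t
  have hconv : ConvexOn ℝ Set.univ F := by
    refine ⟨convex_univ, fun y _ y' _ a b ha hb hab => ciSup_le fun t => ?_⟩
    have h1 := mul_le_mul_of_nonneg_left (hle y t) ha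
    have h2 := mul_le_mul_of_nonneg_left (hle y' t) hb
    have h3 := mul_le_mul_of_nonneg_left (le_max_left (l * ∑ k, y k * t.1 k) (-M)) ha
    have h4 := mul_le_mul_of_nonneg_left (le_max_left (l * ∑ k, y' k * t.1 k) (-M)) hb
    have h5 := mul_le_mul_of_nonneg_left (le_max_right (l * ∑ k, y k * t.1 k) (-M)) ha
    have h6 := mul_le_mul_of_nonneg_left (le_max_right (l * ∑ k, y' k * t.1 k) (-M)) hb
    simp only [smul_eq_mul]
    refine max_le ?_ ?_
    · have e : l * ∑ k, (a • y + b • y') k * t.1 k =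
          a * (l * ∑ k, y k * t.1 k) + b * (l * ∑ k, y' k * t.1 k) := by
        simp only [Finset.mul_sum, ← Finset.sum_add_distrib]
        refine Finset.sum_congr rfl fun k _ => ?_
        simp only [Pi.add_apply, Pi.smul_apply, smul_eq_mul]
        ring
      rw [e]
      linarith
    · have : -M = a * (-M) + b * (-M) := by rw [← add_mul, hab, one_mul]
      linarith
  have hlo : ∃ m, ∀ y, m ≤ F y :=
    ⟨-M, fun y => (le_max_right _ _).trans (hle y (Classical.arbitrary T))⟩
  have hLip : ∀ x y, F x ≤ F y + 8 * l ^ 2 * σ ^ 2 + (1 / 32) * ∑ i, (x i - y i) ^ 2 := by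
    intro x y
    refine ciSup_le fun t => ?_
    have hS : 0 ≤ ∑ i, (x i - y i) ^ 2 := Finset.sum_nonneg fun i _ => sq_nonneg _
    refine max_le ?_ ?_
    · have h1 := (le_max_left _ _).trans (hle y t)
      have h2 : l * ∑ k, x k * t.1 k ≤ l * ∑ k, y k * t.1 k + 8 * l ^ 2 * ∑ k, t.1 k ^ 2 +
          (1 / 32) * ∑ i, (x i - y i) ^ 2 := by
        rw [Finset.mul_sum, Finset.mul_sum, Finset.mul_sum, Finset.mul_sum,
          ← Finset.sum_add_distrib, ← Finset.sum_add_distrib]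
        refine Finset.sum_le_sum fun k _ => ?_
        nlinarith [sq_nonneg (16 * l * t.1 k - (x k - y k))]
      have h3 : 8 * l ^ 2 * ∑ k, t.1 k ^ 2 ≤ 8 * l ^ 2 * σ ^ 2 := by
        gcongr
        exact hT t.1 t.2
      linarith
    · have h1 := (le_max_right _ _).trans (hle y t)
      have : 0 ≤ 8 * l ^ 2 * σ ^ 2 := by positivity
      linarith
  refine ⟨fun ε => F (signVec ε), fun ε t ht => ?_, ?_⟩
  · exact (le_max_left _ _).trans (hle (signVec ε) ⟨t, ht⟩)
  · refine (signAvg_exp_sub_le hconv hlo hLip).trans (Real.exp_le_exp.2 ?_)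
    obtain ⟨g, hg, hgc⟩ := h
    have : signAvg (fun ε => F (signVec ε)) ≤ l * signAvg g := by
      rw [← signAvg_const_mul]
      refine signAvg_mono fun ε => ciSup_le fun t => ?_
      have := hlow t.1 t.2 ε
      rw [← signForm_eq, max_eq_left this]
      exact mul_le_mul_of_nonneg_left (hg ε t.1 t.2) hl.le
    have := mul_le_mul_of_nonneg_left hgc hl.le
    linarith

lemma radBound_translate {n : ℕ} {T : Set (Fin n → ℝ)} {c : ℝ} (h : RadBound T c)
    (v : Fin n → ℝ) : RadBound ((fun t => v + t) '' T) c := by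
  have := (radBound_singleton v).add h
  rw [zero_add] at this
  refine this.mono ?_ le_rfl
  rintro _ ⟨t, ht, rfl⟩
  exact ⟨v, rfl, t, ht, rfl⟩

/-- The supremum over a union of few pieces of a set of small diameter. -/
theorem radBound_biUnion {n : ℕ} {ι : Type*} (s : Finset ι) (T : ι → Set (Fin n → ℝ))
    {c σ l : ℝ} (hσ : 0 < σ) (hl : 0 < l) (hs : (s.card : ℝ) ≤ Real.exp l)
    (hc : ∀ m ∈ s, RadBound (T m) c)
    (hT : ∀ t ∈ ⋃ m ∈ s, T m, ∀ t' ∈ ⋃ m ∈ s, T m, ∑ k, (t k - t' k) ^ 2 ≤ σ ^ 2) :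
    RadBound (⋃ m ∈ s, T m) (c + 9 * Real.sqrt l * σ) := by
  classical
  rcases (⋃ m ∈ s, T m).eq_empty_or_nonempty with h | ⟨t₀, h₀⟩
  · rw [h]; exact radBound_empty _
  -- The inverse temperature balancing entropy against concentration: l/a = √l σ and 8aσ² = 8√l σ,
  -- together 9√l σ.
  set a : ℝ := Real.sqrt l / σ with ha
  have hsl : 0 < Real.sqrt l := Real.sqrt_pos.2 hl
  have hapos : 0 < a := div_pos hsl hσ
  set s' := s.filter (fun m => (T m).Nonempty) with hs'
  have hex : ∀ m ∈ s', ∃ g : (Fin n → Bool) → ℝ,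
      (∀ ε, ∀ t ∈ (fun t => -t₀ + t) '' T m, a * signForm ε t ≤ g ε) ∧
      signAvg (fun ε => Real.exp (g ε)) ≤ Real.exp (8 * a ^ 2 * σ ^ 2 + a * c) := by
    intro m hm
    obtain ⟨hm1, hm2⟩ := Finset.mem_filter.1 hm
    refine (radBound_translate (hc m hm1) (-t₀)).exists_exp_le (hm2.image _) hσ.le hapos ?_
    rintro _ ⟨t, ht, rfl⟩
    have := hT t (Set.mem_biUnion hm1 ht) t₀ h₀
    refine le_trans (le_of_eq (Finset.sum_congr rfl fun k _ => ?_)) this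
    simp only [Pi.add_apply, Pi.neg_apply]
    ring
  choose! g hg hgexp using hex
  have hs'ne : s'.Nonempty := by
    obtain ⟨m, hm, ht⟩ := Set.mem_iUnion₂.1 h₀
    exact ⟨m, Finset.mem_filter.2 ⟨hm, ⟨_, ht⟩⟩⟩
  have hpos : ∀ ε, 0 < ∑ m ∈ s', Real.exp (g m ε) := fun ε =>
    Finset.sum_pos (fun m _ => Real.exp_pos _) hs'ne
  -- The majorant is a soft maximum over the pieces recentred at t₀; the form at t₀ added back has
  -- mean zero. Empty pieces were discarded because the exponential bound needs a point.
  refine ⟨fun ε => a⁻¹ * Real.log (∑ m ∈ s', Real.exp (g m ε)) + signForm ε t₀,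
    fun ε t ht => ?_, ?_⟩
  · obtain ⟨m, hm, ht⟩ := Set.mem_iUnion₂.1 ht
    have hm' : m ∈ s' := Finset.mem_filter.2 ⟨hm, ⟨_, ht⟩⟩
    have h1 := hg m hm' ε _ ⟨t, ht, rfl⟩
    have h2 : g m ε ≤ Real.log (∑ m ∈ s', Real.exp (g m ε)) := by
      rw [Real.le_log_iff_exp_le (hpos ε)]
      exact Finset.single_le_sum (f := fun m => Real.exp (g m ε))
        (fun i _ => (Real.exp_pos _).le) hm'
    have e : t = (-t₀ + t) + t₀ := by abel
    have e2 : signForm ε t = signForm ε (-t₀ + t) + signForm ε t₀ := by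
      conv_lhs => rw [e]
      exact signForm_add _ _ _
    dsimp only
    rw [e2]
    refine add_le_add_left ?_ _
    rw [inv_mul_eq_div, le_div_iff₀ hapos, mul_comm]
    exact h1.trans h2
  · rw [signAvg_add, signAvg_signForm, signAvg_const_mul, add_zero, inv_mul_eq_div,
      div_le_iff₀ hapos]
    have h1 : signAvg (fun ε => Real.log (∑ m ∈ s', Real.exp (g m ε))) ≤
        l + (8 * a ^ 2 * σ ^ 2 + a * c) := by
      rw [← Real.exp_le_exp]
      refine (exp_signAvg_le _).trans ?_
      simp only [Real.exp_log (hpos _)]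
      rw [signAvg_sum, Real.exp_add]
      calc ∑ m ∈ s', signAvg (fun ε => Real.exp (g m ε))
          ≤ ∑ m ∈ s', Real.exp (8 * a ^ 2 * σ ^ 2 + a * c) :=
            Finset.sum_le_sum fun m hm => hgexp m hm
        _ = s'.card * Real.exp (8 * a ^ 2 * σ ^ 2 + a * c) := by simp
        _ ≤ Real.exp l * Real.exp (8 * a ^ 2 * σ ^ 2 + a * c) := by
            gcongr
            refine le_trans ?_ hs
            exact_mod_cast Finset.card_filter_le _ _
    refine h1.trans (le_of_eq ?_)
    have e1 : a * σ = Real.sqrt l := by rw [ha]; field_simp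
    have e2 : Real.sqrt l * Real.sqrt l = l := Real.mul_self_sqrt hl.le
    linear_combination (-1 : ℝ) * e2 + (8 * a * σ + 8 * Real.sqrt l - 9 * Real.sqrt l) * e1

/-- Iterated partitioning. -/
theorem radBound_of_chain {n : ℕ} (𝒞 : ℕ → Set (Set (Fin n → ℝ))) (e R : ℕ → ℝ)
    (hstep : ∀ m, ∀ T ∈ 𝒞 m, ∀ c, (∀ T' ∈ 𝒞 (m + 1), RadBound T' c) → RadBound T (c + e m))
    (hR : ∀ m, ∀ T ∈ 𝒞 m, RadBound T (R m)) (k : ℕ) :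
    ∀ m, ∀ T ∈ 𝒞 m, RadBound T (∑ i ∈ Finset.range k, e (m + i) + R (m + k)) := by
  induction k with
  | zero => intro m T hT; simpa using hR m T hT
  | succ k ih =>
    intro m T hT
    have := hstep m T hT _ (ih (m + 1))
    refine this.mono subset_rfl (le_of_eq ?_)
    rw [Finset.sum_range_succ']
    simp only [add_zero, add_assoc, add_comm 1]
    ring

/-- Iterated partitioning with geometrically decreasing errors. -/
theorem radBound_of_geometric_chain {n : ℕ} (𝒞 : ℕ → Set (Set (Fin n → ℝ))) {E R : ℝ}
    (hE : 0 < E)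
    (hstep : ∀ m, ∀ T ∈ 𝒞 m, ∀ c, (∀ T' ∈ 𝒞 (m + 1), RadBound T' c) →
      RadBound T (c + E * (1 / 2) ^ m))
    (hR : ∀ m, ∀ T ∈ 𝒞 m, RadBound T (R * (1 / 4) ^ m)) :
    ∀ T ∈ 𝒞 0, RadBound T (3 * E) := by
  intro T hT
  have hlim : Filter.Tendsto (fun k : ℕ => R * (1 / 4 : ℝ) ^ k) Filter.atTop (nhds (R * 0)) :=
    (tendsto_pow_atTop_nhds_zero_of_lt_one (by norm_num) (by norm_num)).const_mul R
  rw [mul_zero] at hlim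
  -- R may depend on n: the crude bound is used only at a depth k where it has dropped below E. It
  -- adds one E to the geometric sum 2E.
  obtain ⟨k, hk⟩ := (hlim.eventually (gt_mem_nhds hE)).exists
  refine (radBound_of_chain 𝒞 _ _ hstep hR k 0 T hT).mono subset_rfl ?_
  simp only [zero_add]
  rw [← Finset.mul_sum]
  have h2 : ∑ i ∈ Finset.range k, (1 / 2 : ℝ) ^ i ≤ 2 := by
    rw [geom_sum_eq (by norm_num)]
    have : (0 : ℝ) < (1 / 2) ^ k := by positivity
    rw [div_le_iff_of_neg (by norm_num)]
    linarith
  nlinarith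

/-! ### A heavy-tailed product law and its translates. -/

/-- A heavy tailed density on the line (not normalized). -/
noncomputable def heavyDensity (s : ℝ) : ℝ := ((1 + s ^ 2) ^ 3)⁻¹

lemma heavyDensity_pos (s : ℝ) : 0 < heavyDensity s := by
  unfold heavyDensity; positivity

lemma heavyDensity_neg (s : ℝ) : heavyDensity (-s) = heavyDensity s := by
  simp [heavyDensity]

lemma continuous_heavyDensity : Continuous heavyDensity := by
  unfold heavyDensity
  refine Continuous.inv₀ (by fun_prop) fun s => by positivity

lemma heavyDensity_le (s : ℝ) : heavyDensity s ≤ (1 + s ^ 2)⁻¹ := by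
  unfold heavyDensity
  have h : (1 : ℝ) ≤ 1 + s ^ 2 := by nlinarith [sq_nonneg s]
  gcongr
  exact le_self_pow₀ h (by norm_num)

lemma pow_four_mul_heavyDensity_le (s : ℝ) : s ^ 4 * heavyDensity s ≤ (1 + s ^ 2)⁻¹ := by
  unfold heavyDensity
  have h : (0 : ℝ) < 1 + s ^ 2 := by positivity
  rw [mul_inv_le_iff₀ (by positivity), inv_mul_eq_div, le_div_iff₀ h]
  nlinarith [sq_nonneg s, sq_nonneg (s ^ 2), mul_nonneg (sq_nonneg s) h.le]

lemma integrable_heavyDensity : Integrable heavyDensity := by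
  refine integrable_inv_one_add_sq.mono' continuous_heavyDensity.aestronglyMeasurable ?_
  refine Filter.Eventually.of_forall fun s => ?_
  rw [Real.norm_of_nonneg (heavyDensity_pos s).le]
  exact heavyDensity_le s

lemma integrable_pow_four_mul_heavyDensity : Integrable fun s => s ^ 4 * heavyDensity s := by
  refine integrable_inv_one_add_sq.mono'
    (by have := continuous_heavyDensity; fun_prop) ?_
  refine Filter.Eventually.of_forall fun s => ?_
  have := heavyDensity_pos s
  rw [Real.norm_of_nonneg (by positivity)]
  exact pow_four_mul_heavyDensity_le s

lemma integral_heavyDensity_pos : 0 < ∫ s, heavyDensity s := by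
  rw [integral_pos_iff_support_of_nonneg (fun s => (heavyDensity_pos s).le)
    integrable_heavyDensity]
  have : Function.support heavyDensity = Set.univ :=
    Set.eq_univ_of_forall fun s => (heavyDensity_pos s).ne'
  rw [this]
  simp

/-- The normalized density. -/
noncomputable def heavyPdf (s : ℝ) : ℝ := (∫ u, heavyDensity u)⁻¹ * heavyDensity s

lemma heavyPdf_pos (s : ℝ) : 0 < heavyPdf s :=
  mul_pos (inv_pos.2 integral_heavyDensity_pos) (heavyDensity_pos s)

lemma heavyPdf_neg (s : ℝ) : heavyPdf (-s) = heavyPdf s := by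
  simp [heavyPdf, heavyDensity_neg]

lemma continuous_heavyPdf : Continuous heavyPdf := by
  unfold heavyPdf
  exact continuous_const.mul continuous_heavyDensity

lemma integrable_heavyPdf : Integrable heavyPdf := integrable_heavyDensity.const_mul _

lemma integral_heavyPdf : ∫ s, heavyPdf s = 1 := by
  unfold heavyPdf
  rw [integral_const_mul, inv_mul_cancel₀ integral_heavyDensity_pos.ne']

/-- The heavy tailed probability law on the line. -/
noncomputable def heavyLaw : Measure ℝ :=
  volume.withDensity fun s => ENNReal.ofReal (heavyPdf s)

instance : IsProbabilityMeasure heavyLaw := by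
  constructor
  unfold heavyLaw
  rw [withDensity_apply _ MeasurableSet.univ, Measure.restrict_univ,
    ← ofReal_integral_eq_lintegral_ofReal integrable_heavyPdf
      (Filter.Eventually.of_forall fun s => (heavyPdf_pos s).le), integral_heavyPdf]
  simp

/-- The product of heavy tailed laws. -/
noncomputable def heavyPi (ι : Type*) [Fintype ι] : Measure (ι → ℝ) :=
  Measure.pi fun _ => heavyLaw

instance (ι : Type*) [Fintype ι] : IsProbabilityMeasure (heavyPi ι) := by
  unfold heavyPi; infer_instance

lemma heavyPi_eq_withDensity (ι : Type*) [Fintype ι] :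
    heavyPi ι = volume.withDensity fun s => ENNReal.ofReal (∏ i, heavyPdf (s i)) := by
  unfold heavyPi
  refine Measure.pi_eq fun s hs => ?_
  rw [withDensity_apply _ (MeasurableSet.univ_pi hs), volume_pi, Measure.restrict_pi_pi,
    ← ofReal_integral_eq_lintegral_ofReal, integral_fintype_prod_eq_prod,
    ENNReal.ofReal_prod_of_nonneg]
  · refine Finset.prod_congr rfl fun i _ => ?_
    rw [heavyLaw, withDensity_apply _ (hs i), ofReal_integral_eq_lintegral_ofReal]
    · exact integrable_heavyPdf.integrableOn
    · exact Filter.Eventually.of_forall fun s => (heavyPdf_pos s).le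
  · exact fun i _ => integral_nonneg fun s => (heavyPdf_pos s).le
  · exact Integrable.fintype_prod fun i => integrable_heavyPdf.integrableOn
  · exact Filter.Eventually.of_forall fun x => Finset.prod_nonneg fun i _ => (heavyPdf_pos _).le

/-- Here (1+(s+h)²)(1+(s-h)²) = (1+s²+h²)² - 4s²h², and 1+s²+h² ≤ (1+s²)(1+h²). It replaces the
Gaussian shift identity, with a loss polynomial in h instead of Gaussian. -/
lemma heavyDensity_shift (s h : ℝ) :
    (heavyDensity h * heavyDensity s) ^ 2 ≤ heavyDensity (s + h) * heavyDensity (s - h) := by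
  unfold heavyDensity
  rw [← mul_inv, ← mul_inv, ← mul_pow, ← mul_pow, inv_pow]
  gcongr
  rw [← pow_mul, mul_comm 3 2, pow_mul]
  gcongr
  have h1 : (1 + (s + h) ^ 2) * (1 + (s - h) ^ 2) ≤ (1 + s ^ 2 + h ^ 2) ^ 2 := by
    nlinarith [sq_nonneg (s * h)]
  refine h1.trans ?_
  have : 1 + s ^ 2 + h ^ 2 ≤ (1 + h ^ 2) * (1 + s ^ 2) := by nlinarith [sq_nonneg (s * h)]
  gcongr

lemma heavyPdf_shift (s h : ℝ) :
    (heavyDensity h * heavyPdf s) ^ 2 ≤ heavyPdf (s + h) * heavyPdf (s - h) := by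
  have := mul_le_mul_of_nonneg_left (heavyDensity_shift s h)
    (sq_nonneg (∫ u, heavyDensity u)⁻¹)
  unfold heavyPdf
  nlinarith

/-- Translates of symmetric sets. -/
theorem heavyPi_translate {ι : Type*} [Fintype ι] {G : Set (ι → ℝ)} (hG : MeasurableSet G)
    (hsymm : ∀ s ∈ G, -s ∈ G) (h : ι → ℝ) :
    ENNReal.ofReal (∏ i, heavyDensity (h i)) * heavyPi ι G ≤ heavyPi ι {s | s - h ∈ G} := by
  set f : (ι → ℝ) → ℝ := fun s => ∏ i, heavyPdf (s i) with hf
  have hfpos : ∀ s, 0 < f s := fun s => Finset.prod_pos fun i _ => heavyPdf_pos _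
  have hfc : Continuous f :=
    continuous_finsetProd _ fun i _ => continuous_heavyPdf.comp (continuous_apply i)
  set c : ℝ := ∏ i, heavyDensity (h i) with hc
  have hcpos : 0 < c := Finset.prod_pos fun i _ => heavyDensity_pos _
  -- The arithmetic mean of the densities shifted by h and -h dominates their geometric mean, hence
  -- the unshifted density up to the factor c.
  have hpt : ∀ s, 2 * (c * f s) ≤ f (s + h) + f (s - h) := by
    intro s
    have h1 : (c * f s) ^ 2 ≤ f (s + h) * f (s - h) := by
      rw [hc, hf]
      dsimp only
      rw [← Finset.prod_mul_distrib, ← Finset.prod_mul_distrib, ← Finset.prod_pow]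
      refine Finset.prod_le_prod (fun i _ => sq_nonneg _) fun i _ => ?_
      exact heavyPdf_shift (s i) (h i)
    have h2 := mul_pos hcpos (hfpos s)
    have h3 : (2 * (c * f s)) ^ 2 ≤ (f (s + h) + f (s - h)) ^ 2 := by
      nlinarith [sq_nonneg (f (s + h) - f (s - h))]
    exact (abs_le_of_sq_le_sq' h3 (add_pos (hfpos _) (hfpos _)).le).2
  have hfneg : ∀ s, f (-s) = f s := fun s =>
    Finset.prod_congr rfl fun i _ => by simp [heavyPdf_neg]
  have hmeas : Measurable fun s : ι → ℝ => ENNReal.ofReal (f s) := hfc.measurable.ennreal_ofReal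
  have hGh : MeasurableSet {s : ι → ℝ | s - h ∈ G} := (measurable_id.sub_const h) hG
  have eG : heavyPi ι G = ∫⁻ s, G.indicator (fun s => ENNReal.ofReal (f s)) s := by
    rw [heavyPi_eq_withDensity, withDensity_apply _ hG, lintegral_indicator hG]
  have e1 : heavyPi ι {s | s - h ∈ G} =
      ∫⁻ s, G.indicator (fun s => ENNReal.ofReal (f (s + h))) s := by
    rw [heavyPi_eq_withDensity, withDensity_apply _ hGh, ← lintegral_indicator hGh,
      ← lintegral_add_right_eq_self _ h]
    refine lintegral_congr fun s => ?_
    by_cases hs : s ∈ G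
    · rw [Set.indicator_of_mem hs, Set.indicator_of_mem (by simpa using hs)]
    · rw [Set.indicator_of_notMem hs, Set.indicator_of_notMem (by simpa using hs)]
  -- By reflection, using that G is symmetric and f even, the shifts by h and by -h give the same
  -- mass; this is what allows averaging the two.
  have e2 : heavyPi ι {s | s - h ∈ G} =
      ∫⁻ s, G.indicator (fun s => ENNReal.ofReal (f (s - h))) s := by
    rw [e1, ← lintegral_neg_eq_self]
    refine lintegral_congr fun s => ?_
    have hiff : -s ∈ G ↔ s ∈ G := ⟨fun hs => by simpa using hsymm _ hs, hsymm s⟩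
    by_cases hs : s ∈ G
    · rw [Set.indicator_of_mem hs, Set.indicator_of_mem (hiff.2 hs), ← hfneg]
      congr 2
      abel
    · rw [Set.indicator_of_notMem hs, Set.indicator_of_notMem (fun h => hs (hiff.1 h))]
  have e3 : 2 * heavyPi ι {s | s - h ∈ G} = ∫⁻ s,
      (G.indicator (fun s => ENNReal.ofReal (f (s + h))) s +
      G.indicator (fun s => ENNReal.ofReal (f (s - h))) s) := by
    rw [lintegral_add_left, ← e1, ← e2, two_mul]
    exact ((hfc.comp (continuous_add_const h)).measurable.ennreal_ofReal).indicator hG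
  have e4 : 2 * (ENNReal.ofReal c * heavyPi ι G) ≤ 2 * heavyPi ι {s | s - h ∈ G} := by
    rw [e3, eG, ← lintegral_const_mul _ (hmeas.indicator hG),
      ← lintegral_const_mul _ ((hmeas.indicator hG).const_mul _)]
    refine lintegral_mono fun s => ?_
    by_cases hs : s ∈ G
    · simp only [Set.indicator_of_mem hs]
      rw [← ENNReal.ofReal_mul hcpos.le, ← ENNReal.ofReal_add (hfpos _).le (hfpos _).le,
        show (2 : ℝ≥0∞) = ENNReal.ofReal 2 by simp, ← ENNReal.ofReal_mul (by norm_num)]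
      exact ENNReal.ofReal_le_ofReal (hpt s)
    · simp [Set.indicator_of_notMem hs]
  exact (ENNReal.mul_le_mul_iff_right (by norm_num) (by norm_num)).1 e4

lemma exp_neg_le_prod_heavyDensity {ι : Type*} [Fintype ι] {h : ι → ℝ} {c : ℝ}
    (hc : ∑ i, Real.log (1 + h i ^ 2) ≤ c) :
    Real.exp (-(3 * c)) ≤ ∏ i, heavyDensity (h i) := by
  have : ∏ i, heavyDensity (h i) = Real.exp (-(3 * ∑ i, Real.log (1 + h i ^ 2))) := by
    rw [Finset.mul_sum, ← Finset.sum_neg_distrib, Real.exp_sum]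
    refine Finset.prod_congr rfl fun i _ => ?_
    have hp : 0 < 1 + h i ^ 2 := by positivity
    rw [Real.exp_neg, mul_comm, Real.exp_mul, Real.exp_log hp, heavyDensity]
    norm_cast
  rw [this]
  refine Real.exp_le_exp.2 ?_
  linarith

/-- This bound pays for translations in the ℓ_2 ball; the linear bound on the same logarithm, in the
next lemma, pays for those in the ℓ_1 ball. -/
lemma log_one_add_sq_le_sq (h : ℝ) : Real.log (1 + h ^ 2) ≤ h ^ 2 := by
  have := Real.log_le_sub_one_of_pos (show 0 < 1 + h ^ 2 by positivity)
  linarith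

lemma log_one_add_sq_le_abs (h : ℝ) : Real.log (1 + h ^ 2) ≤ 2 * |h| := by
  have h0 := abs_nonneg h
  have h1 : Real.log (1 + h ^ 2) ≤ Real.log ((1 + |h|) ^ 2) := by
    refine Real.log_le_log (by positivity) ?_
    nlinarith [sq_abs h]
  rw [Real.log_pow] at h1
  have := Real.log_le_sub_one_of_pos (show 0 < 1 + |h| by positivity)
  push_cast at h1
  linarith

/-! ### Fourth moments of linear and bilinear forms under the product law. -/

/-- The fourth moment of the heavy tailed law. -/
noncomputable def heavyMoment : ℝ := ∫ s, s ^ 4 ∂heavyLaw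

lemma integrable_pow_four_heavyLaw : Integrable (fun s => s ^ 4) heavyLaw := by
  unfold heavyLaw
  rw [integrable_withDensity_iff_integrable_smul' continuous_heavyPdf.measurable.ennreal_ofReal
    (Filter.Eventually.of_forall fun s => ENNReal.ofReal_lt_top)]
  refine (integrable_pow_four_mul_heavyDensity.const_mul (∫ u, heavyDensity u)⁻¹).congr ?_
  refine Filter.Eventually.of_forall fun s => ?_
  dsimp only
  rw [ENNReal.toReal_ofReal (heavyPdf_pos s).le, heavyPdf, smul_eq_mul]
  ring

lemma heavyMoment_nonneg : 0 ≤ heavyMoment :=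
  integral_nonneg fun s => by positivity

lemma memLp_id_heavyLaw : MemLp id 4 heavyLaw := by
  rw [← integrable_norm_rpow_iff (by fun_prop) (by norm_num) (by norm_num)]
  refine integrable_pow_four_heavyLaw.congr (Filter.Eventually.of_forall fun s => ?_)
  have : (4 : ℝ≥0∞).toReal = ((4 : ℕ) : ℝ) := by norm_num
  simp only [this, Real.rpow_natCast, id, Real.norm_eq_abs]
  exact ((by decide : Even 4).pow_abs s).symm

section Moments

variable {ι : Type*} [Fintype ι] {E : Type*} [NormedAddCommGroup E] [InnerProductSpace ℝ E]

lemma memLp_eval_heavyPi (i : ι) : MemLp (fun s : ι → ℝ => s i) 4 (heavyPi ι) :=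
  memLp_id_heavyLaw.comp_measurePreserving (measurePreserving_eval (fun _ => heavyLaw) i)

lemma integral_eval_pow_four (i : ι) : ∫ s : ι → ℝ, s i ^ 4 ∂heavyPi ι = heavyMoment := by
  exact integral_comp_eval (μ := fun _ : ι => heavyLaw) (f := fun x : ℝ => x ^ 4)
    (by fun_prop)

lemma integrable_eval_pow_four (i : ι) : Integrable (fun s : ι → ℝ => s i ^ 4) (heavyPi ι) :=
  (measurePreserving_eval (fun _ : ι => heavyLaw) i).integrable_comp_of_integrable
    integrable_pow_four_heavyLaw

lemma memLp_heavySum (S : Finset ι) (b : ι → E) :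
    MemLp (fun s : ι → ℝ => ∑ i ∈ S, s i • b i) 4 (heavyPi ι) := by
  refine memLp_finsetSum _ fun i _ => ?_
  exact (ContinuousLinearMap.toSpanSingleton ℝ (b i)).comp_memLp' (memLp_eval_heavyPi i)

lemma integrable_heavySum_pow (S : Finset ι) (b : ι → E) :
    Integrable (fun s : ι → ℝ => ‖∑ i ∈ S, s i • b i‖ ^ 4) (heavyPi ι) :=
  MemLp.integrable_norm_pow (p := 4) (memLp_heavySum S b) (by norm_num)

lemma norm_add_pow_four_add_le (x v : E) :
    ‖x + v‖ ^ 4 + ‖x - v‖ ^ 4 ≤ 2 * (‖x‖ ^ 4 + 6 * (‖x‖ ^ 2 * ‖v‖ ^ 2) + ‖v‖ ^ 4) := by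
  have h1 := norm_add_sq_real x v
  have h2 := norm_sub_sq_real x v
  have h3 : (inner ℝ x v) ^ 2 ≤ ‖x‖ ^ 2 * ‖v‖ ^ 2 := by
    rw [← mul_pow, ← sq_abs]
    exact pow_le_pow_left₀ (abs_nonneg _) (abs_real_inner_le_norm x v) 2
  have e1 : ‖x + v‖ ^ 4 = (‖x‖ ^ 2 + 2 * inner ℝ x v + ‖v‖ ^ 2) ^ 2 := by rw [← h1]; ring
  have e2 : ‖x - v‖ ^ 4 = (‖x‖ ^ 2 - 2 * inner ℝ x v + ‖v‖ ^ 2) ^ 2 := by rw [← h2]; ring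
  rw [e1, e2]
  nlinarith

lemma measurePreserving_flip [DecidableEq ι] (i : ι) :
    MeasurePreserving (fun (s : ι → ℝ) j => if j = i then -s j else s j)
      (heavyPi ι) (heavyPi ι) := by
  have hneg : MeasurePreserving (fun s : ℝ => -s) heavyLaw heavyLaw := by
    refine ⟨measurable_neg, ?_⟩
    ext A hA
    rw [Measure.map_apply measurable_neg hA, heavyLaw, withDensity_apply _ hA,
      withDensity_apply _ (measurable_neg hA), ← lintegral_indicator hA,
      ← lintegral_indicator (measurable_neg hA), ← lintegral_neg_eq_self]
    refine lintegral_congr fun s => ?_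
    by_cases hs : s ∈ A
    · rw [Set.indicator_of_mem hs, Set.indicator_of_mem (by simpa using hs), heavyPdf_neg]
    · rw [Set.indicator_of_notMem hs, Set.indicator_of_notMem (by simpa using hs)]
  have := measurePreserving_pi (f := fun (j : ι) (s : ℝ) => if j = i then -s else s)
    (fun _ : ι => heavyLaw) (fun _ : ι => heavyLaw) (fun j => by
      by_cases h : j = i
      · simpa [h] using hneg
      · simp only [h, if_false]
        exact MeasurePreserving.id heavyLaw)
  exact this

/-- Fourth moments of vector valued sums. -/
theorem integral_heavySum_pow_le (S : Finset ι) (b : ι → E) :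
    ∫ s : ι → ℝ, ‖∑ i ∈ S, s i • b i‖ ^ 4 ∂heavyPi ι ≤
      9 * heavyMoment * (∑ i ∈ S, ‖b i‖ ^ 2) ^ 2 := by
  classical
  induction S using Finset.induction_on with
  | empty => simp
  | insert i S hi ih =>
    set X : (ι → ℝ) → E := fun s => ∑ j ∈ S, s j • b j with hX
    set B := ∑ j ∈ S, ‖b j‖ ^ 2 with hB
    set β := ‖b i‖ ^ 2 with hβ
    have hBnn : 0 ≤ B := Finset.sum_nonneg fun j _ => sq_nonneg _
    have hβnn : 0 ≤ β := sq_nonneg _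
    have hM := heavyMoment_nonneg
    have hins : ∀ s : ι → ℝ, ∑ j ∈ insert i S, s j • b j = X s + s i • b i := fun s => by
      rw [Finset.sum_insert hi, add_comm]
    have i1 := integrable_heavySum_pow (insert i S) b
    have i0 := integrable_heavySum_pow S b
    have i4 := integrable_eval_pow_four (ι := ι) i
    simp only [hins] at i1
    have hflip : ∀ s : ι → ℝ, X (fun j => if j = i then -s j else s j) = X s := fun s =>
      Finset.sum_congr rfl fun j hj => by
        have : j ≠ i := fun h => hi (h ▸ hj)
        simp [this]
    have i2 : Integrable (fun s : ι → ℝ => ‖X s - s i • b i‖ ^ 4) (heavyPi ι) := by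
      have := (measurePreserving_flip (ι := ι) i).integrable_comp_of_integrable i1
      refine this.congr (Filter.Eventually.of_forall fun s => ?_)
      simp [hflip, sub_eq_add_neg]
    have e2 : ∫ s : ι → ℝ, ‖X s - s i • b i‖ ^ 4 ∂heavyPi ι =
        ∫ s : ι → ℝ, ‖X s + s i • b i‖ ^ 4 ∂heavyPi ι := by
      have h := measurePreserving_flip (ι := ι) i
      conv_rhs => rw [← h.map_eq]
      rw [integral_map h.measurable.aemeasurable]
      · refine integral_congr_ae (Filter.Eventually.of_forall fun s => ?_)
        simp [hflip, sub_eq_add_neg]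
      · rw [h.map_eq]
        exact i1.aestronglyMeasurable
    -- Adding the flipped sum kills the odd terms. Young's inequality with weight β/B splits the
    -- cross term so that, after integration, the bound is 9B² + 18Bβ + β² times the moment, which
    -- is at most 9(B+β)² times it.
    have hpt : ∀ s : ι → ℝ, ‖X s + s i • b i‖ ^ 4 + ‖X s - s i • b i‖ ^ 4 ≤
        2 * ((1 + β / B) * ‖X s‖ ^ 4 + (9 * B * β + β ^ 2) * s i ^ 4) := by
      intro s
      refine (norm_add_pow_four_add_le _ _).trans ?_
      have ev : ‖s i • b i‖ ^ 2 = s i ^ 2 * β := by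
        rw [norm_smul, mul_pow, Real.norm_eq_abs, sq_abs]
      have ev4 : ‖s i • b i‖ ^ 4 = s i ^ 4 * β ^ 2 := by
        rw [show ‖s i • b i‖ ^ 4 = (‖s i • b i‖ ^ 2) ^ 2 by ring, ev]; ring
      rw [ev, ev4]
      -- For B = 0 the quotient β/B is read as 0, and then the partial sum X vanishes.
      rcases hBnn.eq_or_lt with h0 | hpos
      · have hz : ∀ j ∈ S, ‖b j‖ ^ 2 = 0 :=
          (Finset.sum_eq_zero_iff_of_nonneg fun j _ => sq_nonneg _).1 h0.symm
        have hXz : X s = 0 := Finset.sum_eq_zero fun j hj => by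
          have : b j = 0 := by simpa using hz j hj
          simp [this]
        simp only [hXz, ← h0]
        simp
        linarith
      · have key : 6 * (‖X s‖ ^ 2 * (s i ^ 2 * β)) ≤
            β / B * ‖X s‖ ^ 4 + 9 * B * β * s i ^ 4 := by
          have h5 : β / B * ‖X s‖ ^ 4 + 9 * B * β * s i ^ 4 -
              6 * (‖X s‖ ^ 2 * (s i ^ 2 * β)) =
              β / B * (‖X s‖ ^ 2 - 3 * B * s i ^ 2) ^ 2 := by
            field_simp
            ring
          have : 0 ≤ β / B * (‖X s‖ ^ 2 - 3 * B * s i ^ 2) ^ 2 := by positivity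
          linarith
        nlinarith
    have hint := integral_mono (i1.add i2)
      (((i0.const_mul (1 + β / B)).add (i4.const_mul (9 * B * β + β ^ 2))).const_mul 2) hpt
    simp only [Pi.add_apply] at hint
    rw [integral_add i1 i2, e2, integral_const_mul, integral_add (i0.const_mul _)
      (i4.const_mul _), integral_const_mul, integral_const_mul, integral_eval_pow_four] at hint
    simp only [hins]
    rw [Finset.sum_insert hi]
    have h6 : (1 + β / B) * ∫ s : ι → ℝ, ‖X s‖ ^ 4 ∂heavyPi ι ≤
        9 * heavyMoment * B ^ 2 + 9 * heavyMoment * B * β := by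
      refine (mul_le_mul_of_nonneg_left ih (by positivity)).trans (le_of_eq ?_)
      rcases eq_or_ne B 0 with h0 | h0
      · rw [h0]; simp
      · field_simp
    nlinarith [mul_nonneg hM (sq_nonneg β)]

lemma lintegral_heavyPi_rows_le {κ : Type*} [Fintype κ] (b : ι → κ → ℝ) :
    ∫⁻ s, ENNReal.ofReal ((∑ j, (∑ i, b i j * s i) ^ 2) ^ 2) ∂heavyPi ι ≤
      ENNReal.ofReal (9 * heavyMoment * (∑ i, ∑ j, b i j ^ 2) ^ 2) := by
  set b' : ι → EuclideanSpace ℝ κ := fun i => WithLp.toLp 2 (b i) with hb'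
  have e1 : ∀ s : ι → ℝ, (∑ j, (∑ i, b i j * s i) ^ 2) ^ 2 = ‖∑ i, s i • b' i‖ ^ 4 := by
    intro s
    rw [show ‖∑ i, s i • b' i‖ ^ 4 = (‖∑ i, s i • b' i‖ ^ 2) ^ 2 by ring,
      EuclideanSpace.real_norm_sq_eq]
    congr 1
    refine Finset.sum_congr rfl fun j _ => ?_
    congr 1
    rw [WithLp.ofLp_sum, Finset.sum_apply]
    refine Finset.sum_congr rfl fun i _ => ?_
    simp [hb', mul_comm]
  have e2 : ∑ i, ∑ j, b i j ^ 2 = ∑ i, ‖b' i‖ ^ 2 :=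
    Finset.sum_congr rfl fun i _ => by rw [EuclideanSpace.real_norm_sq_eq]
  simp only [e1, e2]
  rw [← ofReal_integral_eq_lintegral_ofReal (integrable_heavySum_pow _ _)
    (Filter.Eventually.of_forall fun s => by positivity)]
  exact ENNReal.ofReal_le_ofReal (integral_heavySum_pow_le _ _)

lemma lintegral_heavyPi_form_le (b : ι → ℝ) :
    ∫⁻ s, ENNReal.ofReal ((∑ i, b i * s i) ^ 4) ∂heavyPi ι ≤
      ENNReal.ofReal (9 * heavyMoment * (∑ i, b i ^ 2) ^ 2) := by
  have := lintegral_heavyPi_rows_le (ι := ι) (κ := Unit) (fun i _ => b i)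
  simpa [← pow_mul] using this

lemma measurePreserving_sum_split (ι κ : Type*) [Fintype ι] [Fintype κ] :
    MeasurePreserving (fun s : ι ⊕ κ → ℝ => ((fun i => s (Sum.inl i)), fun j => s (Sum.inr j)))
      (heavyPi (ι ⊕ κ)) ((heavyPi ι).prod (heavyPi κ)) :=
  measurePreserving_sumPiEquivProdPi (X := fun _ : ι ⊕ κ => ℝ) (fun _ => heavyLaw)

lemma measurePreserving_sum_inl (ι κ : Type*) [Fintype ι] [Fintype κ] :
    MeasurePreserving (fun (s : ι ⊕ κ → ℝ) i => s (Sum.inl i)) (heavyPi (ι ⊕ κ)) (heavyPi ι) :=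
  measurePreserving_fst.comp (measurePreserving_sum_split ι κ)

lemma measurePreserving_sum_inr (ι κ : Type*) [Fintype ι] [Fintype κ] :
    MeasurePreserving (fun (s : ι ⊕ κ → ℝ) i => s (Sum.inr i)) (heavyPi (ι ⊕ κ)) (heavyPi κ) :=
  measurePreserving_snd.comp (measurePreserving_sum_split ι κ)

/-- Fourth moments of bilinear forms. -/
lemma lintegral_heavyPi_bilin_le {κ : Type*} [Fintype κ] (b : ι → κ → ℝ) :
    ∫⁻ s, ENNReal.ofReal ((∑ i, ∑ j, b i j * s (Sum.inl i) * s (Sum.inr j)) ^ 4)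
        ∂heavyPi (ι ⊕ κ) ≤
      ENNReal.ofReal ((9 * heavyMoment) ^ 2 * (∑ i, ∑ j, b i j ^ 2) ^ 2) := by
  have hc : Continuous fun q : (ι → ℝ) × (κ → ℝ) =>
      (∑ i, ∑ j, b i j * q.1 i * q.2 j) ^ 4 := by fun_prop
  rw [(measurePreserving_sum_split ι κ).lintegral_comp
    (f := fun q => ENNReal.ofReal ((∑ i, ∑ j, b i j * q.1 i * q.2 j) ^ 4))
    hc.measurable.ennreal_ofReal, lintegral_prod _ hc.measurable.ennreal_ofReal.aemeasurable]
  have hM : 0 ≤ 9 * heavyMoment := mul_nonneg (by norm_num) heavyMoment_nonneg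
  calc ∫⁻ s, ∫⁻ u, ENNReal.ofReal ((∑ i, ∑ j, b i j * s i * u j) ^ 4) ∂heavyPi κ ∂heavyPi ι
      ≤ ∫⁻ s, ENNReal.ofReal (9 * heavyMoment) *
          ENNReal.ofReal ((∑ j, (∑ i, b i j * s i) ^ 2) ^ 2) ∂heavyPi ι := by
        refine lintegral_mono fun s => ?_
        rw [← ENNReal.ofReal_mul hM]
        refine le_trans (le_of_eq ?_) (lintegral_heavyPi_form_le fun j => ∑ i, b i j * s i)
        refine lintegral_congr fun u => ?_
        rw [Finset.sum_comm]
        simp only [Finset.sum_mul]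
    _ ≤ _ := by
        rw [lintegral_const_mul _ (by fun_prop), sq (9 * heavyMoment), mul_assoc,
          ENNReal.ofReal_mul hM]
        gcongr
        exact lintegral_heavyPi_rows_le b

end Moments

/-! ### Packing and covering. -/

/-- A maximal packing argument. -/
theorem exists_packing {α Ω : Type*} [MeasurableSpace Ω] (μ : Measure Ω) [IsProbabilityMeasure μ]
    (P : Set α) (G : α → Set Ω) (hG : ∀ x ∈ P, MeasurableSet (G x)) {δ : ℝ} (hδ : 0 < δ)
    (hμ : ∀ x ∈ P, ENNReal.ofReal δ ≤ μ (G x)) :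
    ∃ F : Finset α, (∀ x ∈ F, x ∈ P) ∧ (F.card : ℝ) ≤ δ⁻¹ ∧
      ∀ x ∈ P, ∃ a ∈ F, (G x ∩ G a).Nonempty := by
  classical
  have hcard : ∀ F : Finset α, (∀ x ∈ F, x ∈ P) → (F : Set α).PairwiseDisjoint G →
      (F.card : ℝ) ≤ δ⁻¹ := by
    intro F hF hd
    have h1 : ENNReal.ofReal (F.card * δ) ≤ 1 := by
      calc ENNReal.ofReal (F.card * δ) = ∑ x ∈ F, ENNReal.ofReal δ := by
            rw [ENNReal.ofReal_mul (Nat.cast_nonneg _)]; simp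
        _ ≤ ∑ x ∈ F, μ (G x) := Finset.sum_le_sum fun x hx => hμ x (hF x hx)
        _ = μ (⋃ x ∈ F, G x) := (measure_biUnion_finset hd fun x hx => hG x (hF x hx)).symm
        _ ≤ 1 := prob_le_one
    rw [ENNReal.ofReal_le_one] at h1
    rwa [← one_div, le_div_iff₀ hδ]
  by_contra hcon
  push Not at hcon
  -- If no admissible family were maximal, disjoint families of every size could be built, against
  -- the volume bound `hcard`.
  have hex : ∀ k : ℕ, ∃ F : Finset α, (∀ x ∈ F, x ∈ P) ∧ (F : Set α).PairwiseDisjoint G ∧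
      F.card = k := by
    intro k
    induction k with
    | zero => exact ⟨∅, by simp, by simp, rfl⟩
    | succ k ih =>
      obtain ⟨F, hF, hd, hk⟩ := ih
      obtain ⟨x, hx, hxF⟩ := hcon F hF (hcard F hF hd)
      have hxnot : x ∉ F := by
        intro h
        have h0 := hxF x h
        rw [Set.inter_self] at h0
        have := hμ x hx
        rw [h0, measure_empty] at this
        simp only [nonpos_iff_eq_zero, ENNReal.ofReal_eq_zero] at this
        linarith
      refine ⟨insert x F, ?_, ?_, by rw [Finset.card_insert_of_notMem hxnot, hk]⟩
      · intro y hy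
        rcases Finset.mem_insert.1 hy with rfl | hy
        · exact hx
        · exact hF y hy
      · rw [Finset.coe_insert]
        refine hd.insert fun y hy _ => ?_
        rw [Set.disjoint_iff_inter_eq_empty]
        exact hxF y hy
  obtain ⟨k, hk⟩ := exists_nat_gt δ⁻¹
  obtain ⟨F, hF, hd, hFk⟩ := hex k
  have := hcard F hF hd
  rw [hFk] at this
  linarith

/-- Covering by the translates of sublevel sets of even functionals that are small on average. -/
theorem exists_cover {ι κ α : Type*} [Fintype ι] [Fintype κ] [Nonempty κ] (τ : ι → ℝ)
    (hτ : ∀ i, 0 < τ i)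
    (P : Set α) (pt : α → ι → ℝ) (v : ι → ℝ) {c : ℝ}
    (hc : ∀ x ∈ P, ∑ i, Real.log (1 + ((pt x i - v i) / τ i) ^ 2) ≤ c)
    (Q : α → κ → (ι → ℝ) → ℝ) (hQc : ∀ x k, Continuous (Q x k))
    (hQe : ∀ x k u, Q x k (-u) = Q x k u) (m : κ → ℝ) (hm : ∀ k, 0 < m k)
    (hQ : ∀ x ∈ P, ∀ k, ∫⁻ s, ENNReal.ofReal (Q x k (fun i => τ i * s i)) ∂heavyPi ι ≤
      ENNReal.ofReal (m k / (2 * Fintype.card κ))) :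
    ∃ F : Finset α, (∀ x ∈ F, x ∈ P) ∧ (F.card : ℝ) ≤ 2 * Real.exp (3 * c) ∧
      ∀ x ∈ P, ∃ a ∈ F, ∃ ξ : ι → ℝ, ∀ k, Q x k (pt x - ξ) ≤ m k ∧ Q a k (pt a - ξ) ≤ m k := by
  have hτc : Continuous fun (s : ι → ℝ) i => τ i * s i := by fun_prop
  set A : α → Set (ι → ℝ) := fun x => {s | ∀ k, Q x k (fun i => τ i * s i) ≤ m k} with hA
  have hAm : ∀ x, MeasurableSet (A x) := fun x => by
    have : A x = ⋂ k, {s | Q x k (fun i => τ i * s i) ≤ m k} := by ext s; simp [hA]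
    rw [this]
    exact MeasurableSet.iInter fun k =>
      measurableSet_le ((hQc x k).comp hτc).measurable measurable_const
  have hAsymm : ∀ x, ∀ s ∈ A x, -s ∈ A x := fun x s hs k => by
    have e : (fun i => τ i * (-s) i) = -(fun i => τ i * s i) := by funext i; simp
    rw [e, hQe]
    exact hs k
  have hcard : (0 : ℝ) < Fintype.card κ := by exact_mod_cast Fintype.card_pos
  -- Markov's inequality for each functional and a union bound: every bad event has probability at
  -- most 1/(2 card κ).
  have hhalf : ∀ x ∈ P, ENNReal.ofReal (1 / 2) ≤ heavyPi ι (A x) := by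
    intro x hx
    have hbad : ∀ k, heavyPi ι {s | m k ≤ Q x k (fun i => τ i * s i)} ≤
        ENNReal.ofReal (1 / (2 * Fintype.card κ)) := by
      intro k
      have h1 := mul_meas_ge_le_lintegral₀ (μ := heavyPi ι)
        (f := fun s => ENNReal.ofReal (Q x k (fun i => τ i * s i)))
        ((hQc x k).comp hτc).measurable.ennreal_ofReal.aemeasurable (ENNReal.ofReal (m k))
      have h2 : heavyPi ι {s | m k ≤ Q x k (fun i => τ i * s i)} ≤
          heavyPi ι {s | ENNReal.ofReal (m k) ≤ ENNReal.ofReal (Q x k (fun i => τ i * s i))} :=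
        measure_mono fun s hs => ENNReal.ofReal_le_ofReal hs
      have h3 := h1.trans (hQ x hx k)
      rw [div_eq_mul_one_div (m k), ENNReal.ofReal_mul (hm k).le] at h3
      exact h2.trans ((ENNReal.mul_le_mul_iff_right
        (by simpa using hm k) ENNReal.ofReal_ne_top).1 h3)
    have hcompl : heavyPi ι (A x)ᶜ ≤ ENNReal.ofReal (1 / 2) := by
      have hsub : (A x)ᶜ ⊆ ⋃ k, {s | m k ≤ Q x k (fun i => τ i * s i)} := by
        intro s hs
        simp only [hA, Set.mem_compl_iff, Set.mem_ofPred_eq, not_forall, not_le] at hs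
        obtain ⟨k, hk⟩ := hs
        exact Set.mem_iUnion.2 ⟨k, hk.le⟩
      calc heavyPi ι (A x)ᶜ ≤ ∑ k, heavyPi ι {s | m k ≤ Q x k (fun i => τ i * s i)} :=
            (measure_mono hsub).trans (measure_iUnion_fintype_le _ _)
        _ ≤ ∑ _k : κ, ENNReal.ofReal (1 / (2 * Fintype.card κ)) :=
            Finset.sum_le_sum fun k _ => hbad k
        _ = ENNReal.ofReal (1 / 2) := by
            rw [Finset.sum_const, Finset.card_univ, nsmul_eq_mul, ← ENNReal.ofReal_natCast,
              ← ENNReal.ofReal_mul hcard.le]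
            congr 1
            field_simp
    have h1 : heavyPi ι (A x) + heavyPi ι (A x)ᶜ = 1 := prob_add_prob_compl (hAm x)
    by_contra hlt
    push Not at hlt
    have h2 : heavyPi ι (A x) + heavyPi ι (A x)ᶜ < ENNReal.ofReal (1 / 2) +
        ENNReal.ofReal (1 / 2) :=
      ENNReal.add_lt_add_of_lt_of_le (measure_ne_top _ _) hlt hcompl
    rw [h1, ← ENNReal.ofReal_add (by norm_num) (by norm_num)] at h2
    norm_num at h2
  set h : α → ι → ℝ := fun x i => (pt x i - v i) / τ i with hh
  obtain ⟨F, hFP, hFc, hF⟩ := exists_packing (heavyPi ι) P (fun x => {s | s - h x ∈ A x})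
    (fun x _ => (measurable_id.sub_const (h x)) (hAm x))
    (δ := Real.exp (-(3 * c)) * (1 / 2)) (by positivity) (fun x hx => by
      rw [ENNReal.ofReal_mul (Real.exp_pos _).le]
      refine le_trans ?_ (heavyPi_translate (hAm x) (hAsymm x) (h x))
      gcongr
      · exact exp_neg_le_prod_heavyDensity (hc x hx)
      · exact hhalf x hx)
  refine ⟨F, hFP, hFc.trans (le_of_eq ?_), fun x hx => ?_⟩
  · rw [mul_inv, Real.exp_neg, inv_inv]; ring
  · obtain ⟨a, ha, s, hsx, hsa⟩ := hF x hx
    -- A common point s of two translated sublevel sets gives one ξ close to both pt x and pt a. As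
    -- the functionals may depend on the point, the comparison through ξ is left to the
    -- applications.
    refine ⟨a, ha, fun i => v i + τ i * s i, fun k => ?_⟩
    have e : ∀ y : α, pt y - (fun i => v i + τ i * s i) = -(fun i => τ i * (s - h y) i) := by
      intro y
      funext i
      have := (hτ i).ne'
      simp only [hh, Pi.sub_apply, Pi.neg_apply]
      field_simp
      ring
    rw [e x, e a, hQe, hQe]
    exact ⟨hsx k, hsa k⟩

/-! ### Contractions of arrays and quartic functionals. -/

section Forms

variable {I J : Type*} [Fintype I] {n : ℕ}

/-- The contraction of an array with a vector in the first variable. -/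
def contract (a : I → J → Fin n → ℝ) (x : I → ℝ) : J → Fin n → ℝ :=
  fun j k => ∑ i, a i j k * x i

lemma contract_add (a : I → J → Fin n → ℝ) (x x' : I → ℝ) :
    contract a (x + x') = contract a x + contract a x' := by
  funext j k; simp [contract, mul_add, Finset.sum_add_distrib]

lemma contract_neg (a : I → J → Fin n → ℝ) (x : I → ℝ) : contract a (-x) = -contract a x := by
  funext j k; simp [contract]

variable [Fintype J]

/-- The weighted quartic functional `∑ q_k t_k⁴`. -/
def quartic (q t : Fin n → ℝ) : ℝ := ∑ k, q k * t k ^ 4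

/-- The linear map with matrix `c`. -/
def linForm (c : J → Fin n → ℝ) (y : J → ℝ) : Fin n → ℝ := fun k => ∑ j, c j k * y j

/-- The quartic size of a matrix. -/
def matQuartic (q : Fin n → ℝ) (c : J → Fin n → ℝ) : ℝ := ∑ k, q k * (∑ j, c j k ^ 2) ^ 2

/-- The vector `(∑_{ij} a_{ijk} x_i y_j)_k`. -/
def tens (a : I → J → Fin n → ℝ) (x : I → ℝ) (y : J → ℝ) : Fin n → ℝ :=
  linForm (contract a x) y

/-- The array with the first two indices exchanged. -/
def swapArray (a : I → J → Fin n → ℝ) : J → I → Fin n → ℝ := fun j i k => a i j k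

/-- The sum of squares of the `k`-th slice. -/
def sliceSq (a : I → J → Fin n → ℝ) (k : Fin n) : ℝ := ∑ i, ∑ j, a i j k ^ 2

/-- The inverse slice weights. -/
noncomputable def sliceWeight (a : I → J → Fin n → ℝ) (k : Fin n) : ℝ := (sliceSq a k)⁻¹

/-- The total sum of squares. -/
def totalSq (a : I → J → Fin n → ℝ) : ℝ := ∑ k, sliceSq a k

lemma sliceSq_nonneg (a : I → J → Fin n → ℝ) (k : Fin n) : 0 ≤ sliceSq a k :=
  Finset.sum_nonneg fun _ _ => Finset.sum_nonneg fun _ _ => sq_nonneg _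

lemma sliceWeight_nonneg (a : I → J → Fin n → ℝ) (k : Fin n) : 0 ≤ sliceWeight a k :=
  inv_nonneg.2 (sliceSq_nonneg a k)

lemma sliceSq_swap (a : I → J → Fin n → ℝ) : sliceSq (swapArray a) = sliceSq a := by
  funext k; exact Finset.sum_comm

lemma sliceWeight_swap (a : I → J → Fin n → ℝ) : sliceWeight (swapArray a) = sliceWeight a := by
  funext k; simp [sliceWeight, sliceSq_swap]

lemma totalSq_swap (a : I → J → Fin n → ℝ) : totalSq (swapArray a) = totalSq a := by
  simp [totalSq, sliceSq_swap]

lemma tens_apply (a : I → J → Fin n → ℝ) (x : I → ℝ) (y : J → ℝ) (k : Fin n) :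
    tens a x y k = ∑ i, ∑ j, a i j k * x i * y j := by
  simp only [tens, linForm, contract, Finset.sum_mul]
  exact Finset.sum_comm

lemma tens_swap (a : I → J → Fin n → ℝ) (x : I → ℝ) (y : J → ℝ) :
    tens (swapArray a) y x = tens a x y := by
  funext k
  rw [tens_apply, tens_apply, Finset.sum_comm]
  refine Finset.sum_congr rfl fun i _ => Finset.sum_congr rfl fun j _ => ?_
  simp only [swapArray]
  ring

lemma linForm_add (c : J → Fin n → ℝ) (y y' : J → ℝ) :
    linForm c (y + y') = linForm c y + linForm c y' := by
  funext k; simp [linForm, mul_add, Finset.sum_add_distrib]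

lemma linForm_neg (c : J → Fin n → ℝ) (y : J → ℝ) : linForm c (-y) = -linForm c y := by
  funext k; simp [linForm]

lemma linForm_sub (c : J → Fin n → ℝ) (y y' : J → ℝ) :
    linForm c (y - y') = linForm c y - linForm c y' := by
  rw [sub_eq_add_neg, linForm_add, linForm_neg, ← sub_eq_add_neg]

lemma tens_sub_right (a : I → J → Fin n → ℝ) (x : I → ℝ) (y y' : J → ℝ) :
    tens a x (y - y') = tens a x y - tens a x y' := linForm_sub _ _ _

lemma tens_sub_left (a : I → J → Fin n → ℝ) (x x' : I → ℝ) (y : J → ℝ) :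
    tens a (x - x') y = tens a x y - tens a x' y := by
  rw [← tens_swap, tens_sub_right, tens_swap, tens_swap]

lemma quartic_neg (q t : Fin n → ℝ) : quartic q (-t) = quartic q t := by
  simp only [quartic, Pi.neg_apply]
  exact Finset.sum_congr rfl fun k _ => by ring

/-- For q ≥ 0 this is (s+t)⁴ ≤ 8(s⁴+t⁴) summed up. Using fourth powers in place of the seminorm
itself costs a factor 8 per use of the triangle inequality, which is where the later numerical
constants come from. -/
lemma quartic_add_le {q : Fin n → ℝ} (hq : ∀ k, 0 ≤ q k) (t t' : Fin n → ℝ) :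
    quartic q (t + t') ≤ 8 * (quartic q t + quartic q t') := by
  unfold quartic
  rw [← Finset.sum_add_distrib, Finset.mul_sum]
  refine Finset.sum_le_sum fun k _ => ?_
  have h : (t k + t' k) ^ 4 ≤ 8 * (t k ^ 4 + t' k ^ 4) := by
    have h1 : (t k + t' k) ^ 2 ≤ 2 * (t k ^ 2 + t' k ^ 2) := by nlinarith [sq_nonneg (t k - t' k)]
    have h2 : ((t k + t' k) ^ 2) ^ 2 ≤ (2 * (t k ^ 2 + t' k ^ 2)) ^ 2 :=
      pow_le_pow_left₀ (sq_nonneg _) h1 2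
    nlinarith [sq_nonneg (t k ^ 2 - t' k ^ 2)]
  have := mul_le_mul_of_nonneg_left h (hq k)
  simp only [Pi.add_apply]
  linarith

lemma quartic_sub_le {q : Fin n → ℝ} (hq : ∀ k, 0 ≤ q k) (t t' : Fin n → ℝ) :
    quartic q (t - t') ≤ 8 * (quartic q t + quartic q t') := by
  have := quartic_add_le hq t (-t')
  rwa [quartic_neg, ← sub_eq_add_neg] at this

lemma matQuartic_neg (q : Fin n → ℝ) (c : J → Fin n → ℝ) :
    matQuartic q (-c) = matQuartic q c := by
  simp [matQuartic]

lemma matQuartic_add_le {q : Fin n → ℝ} (hq : ∀ k, 0 ≤ q k) (c c' : J → Fin n → ℝ) :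
    matQuartic q (c + c') ≤ 8 * (matQuartic q c + matQuartic q c') := by
  unfold matQuartic
  rw [← Finset.sum_add_distrib, Finset.mul_sum]
  refine Finset.sum_le_sum fun k _ => ?_
  have h0 : 0 ≤ ∑ j, (c + c') j k ^ 2 := Finset.sum_nonneg fun j _ => sq_nonneg _
  have h1 : ∑ j, (c + c') j k ^ 2 ≤ 2 * (∑ j, c j k ^ 2 + ∑ j, c' j k ^ 2) := by
    rw [← Finset.sum_add_distrib, Finset.mul_sum]
    refine Finset.sum_le_sum fun j _ => ?_
    simp only [Pi.add_apply]
    nlinarith [sq_nonneg (c j k - c' j k)]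
  have h2 := pow_le_pow_left₀ h0 h1 2
  have h3 : (∑ j, (c + c') j k ^ 2) ^ 2 ≤
      8 * ((∑ j, c j k ^ 2) ^ 2 + (∑ j, c' j k ^ 2) ^ 2) := by
    nlinarith [sq_nonneg (∑ j, c j k ^ 2 - ∑ j, c' j k ^ 2)]
  have := mul_le_mul_of_nonneg_left h3 (hq k)
  linarith

/-- The quartic size of the contraction. -/
noncomputable def rowForm (a : I → J → Fin n → ℝ) (x : I → ℝ) : ℝ :=
  matQuartic (sliceWeight a) (contract a x)

lemma rowForm_neg (a : I → J → Fin n → ℝ) (x : I → ℝ) : rowForm a (-x) = rowForm a x := by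
  rw [rowForm, contract_neg, matQuartic_neg, rowForm]

lemma rowForm_sub_le (a : I → J → Fin n → ℝ) (x x' : I → ℝ) :
    rowForm a (x - x') ≤ 8 * (rowForm a x + rowForm a x') := by
  rw [sub_eq_add_neg, rowForm, contract_add, contract_neg]
  refine (matQuartic_add_le (sliceWeight_nonneg a) _ _).trans ?_
  rw [matQuartic_neg]
  exact le_rfl

lemma continuous_rowForm (a : I → J → Fin n → ℝ) : Continuous (rowForm a) := by
  unfold rowForm matQuartic contract
  fun_prop

lemma continuous_quartic_linForm (q : Fin n → ℝ) (c : J → Fin n → ℝ) :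
    Continuous fun y => quartic q (linForm c y) := by
  unfold quartic linForm
  fun_prop

/-- Restricting a matrix decreases its quartic size. -/
lemma matQuartic_comp_le {q : Fin n → ℝ} (hq : ∀ k, 0 ≤ q k) (c : J → Fin n → ℝ) {f : I → J}
    (hf : Function.Injective f) : matQuartic q (fun i => c (f i)) ≤ matQuartic q c := by
  classical
  unfold matQuartic
  refine Finset.sum_le_sum fun k _ => mul_le_mul_of_nonneg_left ?_ (hq k)
  refine pow_le_pow_left₀ (Finset.sum_nonneg fun i _ => sq_nonneg _) ?_ 2
  have : ∑ i, c (f i) k ^ 2 = ∑ j ∈ Finset.univ.map ⟨f, hf⟩, c j k ^ 2 := by simp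
  rw [this]
  exact Finset.sum_le_sum_of_subset_of_nonneg (Finset.subset_univ _) fun _ _ _ => sq_nonneg _

/-- The moment constant. -/
noncomputable def momConst : ℝ := 9 * heavyMoment + 1

lemma one_le_momConst : 1 ≤ momConst := by
  have := heavyMoment_nonneg
  unfold momConst
  linarith

lemma lintegral_weighted_sum_le {Ω : Type*} [MeasurableSpace Ω] (μ : Measure Ω) {q : Fin n → ℝ}
    (hq : ∀ k, 0 ≤ q k) (f : Fin n → Ω → ℝ) (hf : ∀ k, Measurable (f k))
    (hf0 : ∀ k ω, 0 ≤ f k ω) {b : Fin n → ℝ} (hb : ∀ k, 0 ≤ b k)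
    (h : ∀ k, ∫⁻ ω, ENNReal.ofReal (f k ω) ∂μ ≤ ENNReal.ofReal (b k)) :
    ∫⁻ ω, ENNReal.ofReal (∑ k, q k * f k ω) ∂μ ≤ ENNReal.ofReal (∑ k, q k * b k) := by
  have e : ∀ ω, ENNReal.ofReal (∑ k, q k * f k ω) =
      ∑ k, ENNReal.ofReal (q k) * ENNReal.ofReal (f k ω) := by
    intro ω
    rw [ENNReal.ofReal_sum_of_nonneg fun k _ => mul_nonneg (hq k) (hf0 k ω)]
    exact Finset.sum_congr rfl fun k _ => ENNReal.ofReal_mul (hq k)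
  simp only [e]
  rw [lintegral_finsetSum _ fun k _ => ((hf k).ennreal_ofReal.const_mul _),
    ENNReal.ofReal_sum_of_nonneg fun k _ => mul_nonneg (hq k) (hb k)]
  refine Finset.sum_le_sum fun k _ => ?_
  rw [lintegral_const_mul _ (hf k).ennreal_ofReal, ENNReal.ofReal_mul (hq k)]
  gcongr
  exact h k

lemma sum_mul_sq_le {c τ : J → ℝ} {θ : ℝ} (hτ : ∀ j, |τ j| ≤ θ) :
    ∑ j, (c j * τ j) ^ 2 ≤ θ ^ 2 * ∑ j, c j ^ 2 := by
  rw [Finset.mul_sum]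
  refine Finset.sum_le_sum fun j _ => ?_
  have : τ j ^ 2 ≤ θ ^ 2 := by
    rw [← sq_abs]; exact pow_le_pow_left₀ (abs_nonneg _) (hτ j) 2
  nlinarith [sq_nonneg (c j)]

lemma lintegral_quartic_linForm_le {q : Fin n → ℝ} (hq : ∀ k, 0 ≤ q k) (c : J → Fin n → ℝ)
    {τ : J → ℝ} {θ : ℝ} (hτ : ∀ j, |τ j| ≤ θ) :
    ∫⁻ s, ENNReal.ofReal (quartic q (linForm c fun j => τ j * s j)) ∂heavyPi J ≤
      ENNReal.ofReal (momConst * θ ^ 4 * matQuartic q c) := by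
  have hM := heavyMoment_nonneg
  refine (lintegral_weighted_sum_le (heavyPi J) hq
    (fun k s => (linForm c (fun j => τ j * s j) k) ^ 4) (fun k => by unfold linForm; fun_prop)
    (fun k s => by positivity)
    (b := fun k => 9 * heavyMoment * (∑ j, (c j k * τ j) ^ 2) ^ 2) (fun k => by positivity)
    (fun k => ?_)).trans (ENNReal.ofReal_le_ofReal ?_)
  · refine le_trans (le_of_eq ?_) (lintegral_heavyPi_form_le fun j => c j k * τ j)
    simp only [linForm, mul_assoc]
  · unfold matQuartic
    rw [Finset.mul_sum]
    refine Finset.sum_le_sum fun k _ => ?_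
    have h1 : (∑ j, (c j k * τ j) ^ 2) ^ 2 ≤ (θ ^ 2 * ∑ j, c j k ^ 2) ^ 2 :=
      pow_le_pow_left₀ (Finset.sum_nonneg fun j _ => sq_nonneg _)
        (sum_mul_sq_le (c := fun j => c j k) hτ) 2
    have h2 : 9 * heavyMoment ≤ momConst := by unfold momConst; linarith
    have h4 := one_le_momConst
    calc q k * (9 * heavyMoment * (∑ j, (c j k * τ j) ^ 2) ^ 2)
        ≤ q k * (momConst * (θ ^ 2 * ∑ j, c j k ^ 2) ^ 2) := by
          have := hq k
          gcongr
      _ = momConst * θ ^ 4 * (q k * (∑ j, c j k ^ 2) ^ 2) := by ring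

/-- The reason for the inverse weights: a quartic moment of slice k is of order S_k², and the
weights turn the sum of these into the total sum of squares H. Vanishing slices get weight 0. -/
lemma sliceWeight_mul_sq_le (a : I → J → Fin n → ℝ) (k : Fin n) :
    sliceWeight a k * sliceSq a k ^ 2 ≤ sliceSq a k := by
  unfold sliceWeight
  rcases (sliceSq_nonneg a k).eq_or_lt with h | h
  · rw [← h]; simp
  · rw [sq, ← mul_assoc, inv_mul_cancel₀ h.ne', one_mul]

lemma lintegral_rowForm_le (a : I → J → Fin n → ℝ) {τ : I → ℝ} {θ : ℝ} (hτ : ∀ i, |τ i| ≤ θ) :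
    ∫⁻ s, ENNReal.ofReal (rowForm a fun i => τ i * s i) ∂heavyPi I ≤
      ENNReal.ofReal (momConst * θ ^ 4 * totalSq a) := by
  have hM := heavyMoment_nonneg
  refine (lintegral_weighted_sum_le (heavyPi I) (sliceWeight_nonneg a)
    (fun k s => (∑ j, contract a (fun i => τ i * s i) j k ^ 2) ^ 2)
    (fun k => by unfold contract; fun_prop) (fun k s => by positivity)
    (b := fun k => 9 * heavyMoment * (∑ i, ∑ j, (a i j k * τ i) ^ 2) ^ 2) (fun k => by positivity)
    (fun k => ?_)).trans (ENNReal.ofReal_le_ofReal ?_)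
  · refine le_trans (le_of_eq ?_) (lintegral_heavyPi_rows_le fun i j => a i j k * τ i)
    simp only [contract, mul_assoc]
  · unfold totalSq
    rw [Finset.mul_sum]
    refine Finset.sum_le_sum fun k _ => ?_
    have h0 : ∑ i, ∑ j, (a i j k * τ i) ^ 2 ≤ θ ^ 2 * sliceSq a k := by
      unfold sliceSq
      rw [Finset.sum_comm, Finset.sum_comm (f := fun i j => a i j k ^ 2), Finset.mul_sum]
      exact Finset.sum_le_sum fun j _ => sum_mul_sq_le (c := fun i => a i j k) hτ
    have h1 : (∑ i, ∑ j, (a i j k * τ i) ^ 2) ^ 2 ≤ (θ ^ 2 * sliceSq a k) ^ 2 :=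
      pow_le_pow_left₀ (Finset.sum_nonneg fun i _ => Finset.sum_nonneg fun j _ => sq_nonneg _) h0 2
    have h2 : 9 * heavyMoment ≤ momConst := by unfold momConst; linarith
    have h3 := sliceWeight_nonneg a k
    have h4 := one_le_momConst
    calc sliceWeight a k * (9 * heavyMoment * (∑ i, ∑ j, (a i j k * τ i) ^ 2) ^ 2)
        ≤ sliceWeight a k * (momConst * (θ ^ 2 * sliceSq a k) ^ 2) := by gcongr
      _ = momConst * θ ^ 4 * (sliceWeight a k * sliceSq a k ^ 2) := by ring
      _ ≤ momConst * θ ^ 4 * sliceSq a k := by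
        gcongr
        exact sliceWeight_mul_sq_le a k

lemma lintegral_quartic_tens_le (a : I → J → Fin n → ℝ) {τ : I ⊕ J → ℝ} {θ : ℝ}
    (hτ : ∀ i, |τ i| ≤ θ) :
    ∫⁻ s, ENNReal.ofReal (quartic (sliceWeight a)
        (tens a (fun i => τ (Sum.inl i) * s (Sum.inl i)) fun j => τ (Sum.inr j) * s (Sum.inr j)))
        ∂heavyPi (I ⊕ J) ≤
      ENNReal.ofReal (momConst ^ 2 * θ ^ 8 * totalSq a) := by
  have hM := heavyMoment_nonneg
  refine (lintegral_weighted_sum_le (heavyPi (I ⊕ J)) (sliceWeight_nonneg a)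
    (fun k s => (tens a (fun i => τ (Sum.inl i) * s (Sum.inl i))
      (fun j => τ (Sum.inr j) * s (Sum.inr j)) k) ^ 4)
    (fun k => by simp only [tens_apply]; fun_prop) (fun k s => by positivity)
    (b := fun k => (9 * heavyMoment) ^ 2 *
      (∑ i, ∑ j, (a i j k * τ (Sum.inl i) * τ (Sum.inr j)) ^ 2) ^ 2) (fun k => by positivity)
    (fun k => ?_)).trans (ENNReal.ofReal_le_ofReal ?_)
  · refine le_trans (le_of_eq ?_)
      (lintegral_heavyPi_bilin_le fun i j => a i j k * τ (Sum.inl i) * τ (Sum.inr j))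
    refine lintegral_congr fun s => ?_
    rw [tens_apply]
    congr 2
    refine Finset.sum_congr rfl fun i _ => Finset.sum_congr rfl fun j _ => by ring
  · unfold totalSq
    rw [Finset.mul_sum]
    refine Finset.sum_le_sum fun k _ => ?_
    have h0 : ∑ i, ∑ j, (a i j k * τ (Sum.inl i) * τ (Sum.inr j)) ^ 2 ≤ θ ^ 4 * sliceSq a k := by
      calc ∑ i, ∑ j, (a i j k * τ (Sum.inl i) * τ (Sum.inr j)) ^ 2
          ≤ ∑ i, θ ^ 2 * ∑ j, (a i j k * τ (Sum.inl i)) ^ 2 :=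
            Finset.sum_le_sum fun i _ =>
              sum_mul_sq_le (c := fun j => a i j k * τ (Sum.inl i)) fun j => hτ (Sum.inr j)
        _ = θ ^ 2 * ∑ j, ∑ i, (a i j k * τ (Sum.inl i)) ^ 2 := by
            rw [← Finset.mul_sum, Finset.sum_comm]
        _ ≤ θ ^ 2 * ∑ j, θ ^ 2 * ∑ i, a i j k ^ 2 := by
            gcongr with j
            exact sum_mul_sq_le (c := fun i => a i j k) fun i => hτ (Sum.inl i)
        _ = θ ^ 4 * sliceSq a k := by
            unfold sliceSq
            rw [← Finset.mul_sum, Finset.sum_comm]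
            ring
    have h1 := pow_le_pow_left₀
      (Finset.sum_nonneg fun i _ => Finset.sum_nonneg fun j _ => sq_nonneg _) h0 2
    have h2 : 9 * heavyMoment ≤ momConst := by unfold momConst; linarith
    have h3 := sliceWeight_nonneg a k
    have h4 := one_le_momConst
    calc sliceWeight a k * ((9 * heavyMoment) ^ 2 *
          (∑ i, ∑ j, (a i j k * τ (Sum.inl i) * τ (Sum.inr j)) ^ 2) ^ 2)
        ≤ sliceWeight a k * (momConst ^ 2 * (θ ^ 4 * sliceSq a k) ^ 2) := by gcongr
      _ = momConst ^ 2 * θ ^ 8 * (sliceWeight a k * sliceSq a k ^ 2) := by ring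
      _ ≤ momConst ^ 2 * θ ^ 8 * sliceSq a k := by
        gcongr
        exact sliceWeight_mul_sq_le a k

/-- A weighted Cauchy-Schwarz inequality. -/
lemma sum_sq_mul_le {w z m : Fin n → ℝ} (hw : ∀ k, 0 ≤ w k) (hm : ∀ k, w k = 0 → m k = 0) :
    ∑ k, z k ^ 2 * m k ≤
      Real.sqrt (∑ k, w k * z k ^ 4) * Real.sqrt (∑ k, (w k)⁻¹ * m k ^ 2) := by
  have h := Real.sum_mul_le_sqrt_mul_sqrt Finset.univ (fun k => Real.sqrt (w k) * z k ^ 2)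
    (fun k => (Real.sqrt (w k))⁻¹ * m k)
  refine le_trans (le_of_eq (Finset.sum_congr rfl fun k _ => ?_)) (h.trans (le_of_eq ?_))
  · rcases (hw k).eq_or_lt with h0 | h0
    · rw [hm k h0.symm]; simp
    · have := (Real.sqrt_pos.2 h0).ne'
      field_simp
  · congr 2
    · refine Finset.sum_congr rfl fun k _ => ?_
      rw [mul_pow, Real.sq_sqrt (hw k)]; ring
    · refine Finset.sum_congr rfl fun k _ => ?_
      rw [mul_pow, inv_pow, Real.sq_sqrt (hw k)]

lemma contract_eq_zero {a : I → J → Fin n → ℝ} {k : Fin n} (h : sliceSq a k = 0) (i : I)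
    (j : J) : a i j k = 0 := by
  have h1 := (Finset.sum_eq_zero_iff_of_nonneg fun i _ =>
    Finset.sum_nonneg fun j _ => sq_nonneg (a i j k)).1 h i (Finset.mem_univ i)
  have h2 := (Finset.sum_eq_zero_iff_of_nonneg fun j _ => sq_nonneg (a i j k)).1 h1 j
    (Finset.mem_univ j)
  simpa using h2

/-- This separates z from t: the L² size of the Rademacher form with coefficients z_k t_k is at most
a scalar depending on z times a quartic size independent of z. Partitions made in the latter serve
all z at once. -/
lemma sum_sq_mul_tens_le (a : I → J → Fin n → ℝ) (z t : Fin n → ℝ)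
    (ht : ∀ k, sliceSq a k = 0 → t k = 0) :
    ∑ k, (z k * t k) ^ 2 ≤ Real.sqrt (∑ k, sliceSq a k * z k ^ 4) *
      Real.sqrt (quartic (sliceWeight a) t) := by
  have := sum_sq_mul_le (w := sliceSq a) (z := z) (m := fun k => t k ^ 2) (sliceSq_nonneg a)
    (fun k hk => by simp [ht k hk])
  simp only [mul_pow]
  refine this.trans (le_of_eq ?_)
  simp only [quartic, sliceWeight, ← pow_mul]

lemma sum_sq_mul_contract_le (a : I → J → Fin n → ℝ) (z : Fin n → ℝ) (x : I → ℝ) :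
    ∑ k, z k ^ 2 * ∑ j, contract a x j k ^ 2 ≤ Real.sqrt (∑ k, sliceSq a k * z k ^ 4) *
      Real.sqrt (rowForm a x) := by
  refine sum_sq_mul_le (sliceSq_nonneg a) fun k hk => ?_
  simp [contract, contract_eq_zero hk]

end Forms

/-! ### The lifted ball and its covering scales. -/

/-- The set `B_2^n × √p B_1^n` in `ℝⁿ × ℝⁿ`. -/
def liftBall (p : ℝ) (n : ℕ) : Set (Fin n ⊕ Fin n → ℝ) :=
  {x | ∑ i, x (Sum.inl i) ^ 2 ≤ 1 ∧ ∑ i, |x (Sum.inr i)| ≤ Real.sqrt p}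

/-- The scales at which `liftBall` is covered by `exp(O(r))` pieces. -/
noncomputable def liftScale (κ p r : ℝ) (n : ℕ) : Fin n ⊕ Fin n → ℝ :=
  Sum.elim (fun _ => κ / Real.sqrt r) fun _ => κ * Real.sqrt p / r

section Scale

variable {κ p r : ℝ} {n : ℕ}

lemma liftScale_pos (hκ : 0 < κ) (hp : 0 < p) (hpr : p ≤ r) (i : Fin n ⊕ Fin n) :
    0 < liftScale κ p r n i := by
  have hr : 0 < r := hp.trans_le hpr
  have h1 := Real.sqrt_pos.2 hr
  have h2 := Real.sqrt_pos.2 hp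
  rcases i with i | i <;> simp only [liftScale, Sum.elim_inl, Sum.elim_inr] <;> positivity

/-- As p ≤ r, the ℓ_1 scale κ√p/r is at most κ/√r, so moment bounds need only the ℓ_2 scale. -/
lemma abs_liftScale_le (hκ : 0 < κ) (hp : 0 < p) (hpr : p ≤ r) (i : Fin n ⊕ Fin n) :
    |liftScale κ p r n i| ≤ κ / Real.sqrt r := by
  rw [abs_of_pos (liftScale_pos hκ hp hpr i)]
  have hr : 0 < r := hp.trans_le hpr
  have h1 := Real.sqrt_pos.2 hr
  rcases i with i | i
  · exact le_rfl
  · simp only [liftScale, Sum.elim_inr]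
    rw [mul_div_assoc, div_eq_mul_one_div κ (Real.sqrt r)]
    refine mul_le_mul_of_nonneg_left ?_ hκ.le
    rw [div_le_div_iff₀ hr h1, one_mul]
    calc Real.sqrt p * Real.sqrt r ≤ Real.sqrt r * Real.sqrt r := by gcongr
      _ = r := Real.mul_self_sqrt hr.le

lemma div_sqrt_pow_four (hr : 0 < r) : (κ / Real.sqrt r) ^ 4 = κ ^ 4 / r ^ 2 := by
  rw [div_pow]
  congr 1
  rw [show (4 : ℕ) = 2 * 2 by norm_num, pow_mul, Real.sq_sqrt hr.le]

lemma div_sqrt_pow_eight (hr : 0 < r) : (κ / Real.sqrt r) ^ 8 = κ ^ 8 / r ^ 4 := by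
  rw [div_pow]
  congr 1
  rw [show (8 : ℕ) = 2 * 4 by norm_num, pow_mul, Real.sq_sqrt hr.le]

/-- The quadratic bound on the logarithm gives r/κ² on the ℓ_2 part and the linear bound gives 2r/κ
on the ℓ_1 part. The two scales are chosen to make both costs of order r. -/
lemma sum_log_liftScale_le (hκ : 0 < κ) (hκ1 : κ ≤ 1) (hp : 0 < p) (hpr : p ≤ r)
    {x : Fin n ⊕ Fin n → ℝ} (hx : x ∈ liftBall p n) :
    ∑ i, Real.log (1 + (x i / liftScale κ p r n i) ^ 2) ≤ 3 * r / κ ^ 2 := by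
  have hr : 0 < r := hp.trans_le hpr
  have hsr := Real.sqrt_pos.2 hr
  have hsp := Real.sqrt_pos.2 hp
  rw [Fintype.sum_sum_type]
  simp only [liftScale, Sum.elim_inl, Sum.elim_inr]
  have h1 : ∑ i, Real.log (1 + (x (Sum.inl i) / (κ / Real.sqrt r)) ^ 2) ≤ r / κ ^ 2 := by
    calc ∑ i, Real.log (1 + (x (Sum.inl i) / (κ / Real.sqrt r)) ^ 2)
        ≤ ∑ i, (r / κ ^ 2) * x (Sum.inl i) ^ 2 := by
          refine Finset.sum_le_sum fun i _ => (log_one_add_sq_le_sq _).trans (le_of_eq ?_)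
          rw [div_pow, div_pow, Real.sq_sqrt hr.le]
          field_simp
      _ ≤ r / κ ^ 2 * 1 := by
          rw [← Finset.mul_sum]
          gcongr
          exact hx.1
      _ = r / κ ^ 2 := mul_one _
  have h2 : ∑ i, Real.log (1 + (x (Sum.inr i) / (κ * Real.sqrt p / r)) ^ 2) ≤ 2 * r / κ := by
    calc ∑ i, Real.log (1 + (x (Sum.inr i) / (κ * Real.sqrt p / r)) ^ 2)
        ≤ ∑ i, 2 * (r / (κ * Real.sqrt p)) * |x (Sum.inr i)| := by
          refine Finset.sum_le_sum fun i _ => (log_one_add_sq_le_abs _).trans (le_of_eq ?_)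
          rw [abs_div, abs_of_pos (show 0 < κ * Real.sqrt p / r by positivity)]
          field_simp
      _ ≤ 2 * (r / (κ * Real.sqrt p)) * Real.sqrt p := by
          rw [← Finset.mul_sum]
          gcongr
          exact hx.2
      _ = 2 * r / κ := by field_simp
  have h3 : 2 * r / κ ≤ 2 * r / κ ^ 2 := by
    gcongr
    nlinarith
  have e : 3 * r / κ ^ 2 = r / κ ^ 2 + 2 * r / κ ^ 2 := by ring
  linarith

theorem exists_liftCover (hκ : 0 < κ) (hκ1 : κ ≤ 1) (hp : 0 < p) (hpr : p ≤ r)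
    {P : Set (Fin n ⊕ Fin n → ℝ)} {v : Fin n ⊕ Fin n → ℝ} (hP : ∀ x ∈ P, x - v ∈ liftBall p n)
    {K : Type*} [Fintype K] [Nonempty K] (Q : K → (Fin n ⊕ Fin n → ℝ) → ℝ)
    (hQc : ∀ k, Continuous (Q k)) (hQe : ∀ k u, Q k (-u) = Q k u) (m : K → ℝ) (hm : ∀ k, 0 < m k)
    (hQ : ∀ k, ∫⁻ s, ENNReal.ofReal (Q k (fun i => liftScale κ p r n i * s i))
      ∂heavyPi (Fin n ⊕ Fin n) ≤ ENNReal.ofReal (m k / (2 * Fintype.card K))) :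
    ∃ F : Finset (Fin n ⊕ Fin n → ℝ), (∀ x ∈ F, x ∈ P) ∧
      (F.card : ℝ) ≤ 2 * Real.exp (9 * r / κ ^ 2) ∧
      ∀ x ∈ P, ∃ b ∈ F, ∃ ξ, ∀ k, Q k (x - ξ) ≤ m k ∧ Q k (b - ξ) ≤ m k := by
  obtain ⟨F, h1, h2, h3⟩ := exists_cover (liftScale κ p r n) (liftScale_pos hκ hp hpr) P
    (fun x => x) v (c := 3 * r / κ ^ 2)
    (fun x hx => sum_log_liftScale_le hκ hκ1 hp hpr (hP x hx)) (fun _ => Q) (fun _ => hQc)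
    (fun _ => hQe) m hm (fun _ _ => hQ)
  refine ⟨F, h1, h2.trans (le_of_eq ?_), h3⟩
  ring_nf

end Scale

/-! ### Covers for rows, for linear images and for pairs. -/

section Covers

variable {p r : ℝ} {n : ℕ} (a : Fin n ⊕ Fin n → Fin n ⊕ Fin n → Fin n → ℝ)

/-- The covering scale attached to an accuracy `δ`. -/
noncomputable def coverScale (δ : ℝ) : ℝ := δ / (10 * momConst)

lemma coverScale_pos {δ : ℝ} (hδ : 0 < δ) : 0 < coverScale δ := by
  have := one_le_momConst
  unfold coverScale; positivity

lemma coverScale_le_one {δ : ℝ} (hδ1 : δ ≤ 1) : coverScale δ ≤ 1 := by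
  have := one_le_momConst
  unfold coverScale
  rw [div_le_one (by positivity)]
  linarith

/-- The 10 is 2·5: in the covering of pairs, Markov's inequality is applied to five functionals with
total failure probability 1/2. The smaller families have room to spare. -/
lemma momConst_mul_coverScale_pow {δ : ℝ} (hδ : 0 < δ) (hδ1 : δ ≤ 1) :
    momConst * coverScale δ ^ 4 ≤ δ / 10 := by
  have h1 := one_le_momConst
  have h2 : coverScale δ ^ 4 ≤ coverScale δ :=
    pow_le_of_le_one (coverScale_pos hδ).le (coverScale_le_one hδ1) (by norm_num)
  calc momConst * coverScale δ ^ 4 ≤ momConst * coverScale δ := by gcongr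
    _ = δ / 10 := by unfold coverScale; field_simp

lemma momConst_sq_mul_coverScale_pow {δ : ℝ} (hδ : 0 < δ) (hδ1 : δ ≤ 1) :
    momConst ^ 2 * coverScale δ ^ 8 ≤ δ / 10 := by
  have h1 := momConst_mul_coverScale_pow hδ hδ1
  have h0 : 0 ≤ momConst * coverScale δ ^ 4 := by
    have := one_le_momConst
    positivity
  calc momConst ^ 2 * coverScale δ ^ 8 = (momConst * coverScale δ ^ 4) ^ 2 := by ring
    _ ≤ (δ / 10) ^ 2 := pow_le_pow_left₀ h0 h1 2
    _ ≤ δ / 10 := by nlinarith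

lemma exists_rowCover {δ : ℝ} (hδ : 0 < δ) (hδ1 : δ ≤ 1) (hp : 0 < p) (hpr : p ≤ r)
    (hH : 0 < totalSq a)
    {P : Set (Fin n ⊕ Fin n → ℝ)} {v : Fin n ⊕ Fin n → ℝ} (hP : ∀ x ∈ P, x - v ∈ liftBall p n) :
    ∃ F : Finset (Fin n ⊕ Fin n → ℝ), (∀ x ∈ F, x ∈ P) ∧
      (F.card : ℝ) ≤ 2 * Real.exp (9 * r / coverScale δ ^ 2) ∧
      ∀ x ∈ P, ∃ b ∈ F, rowForm a (x - b) ≤ 16 * δ * (totalSq a / r ^ 2) := by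
  have hr : 0 < r := hp.trans_le hpr
  have hκ := coverScale_pos hδ
  obtain ⟨F, h1, h2, h3⟩ := exists_liftCover hκ (coverScale_le_one hδ1) hp hpr hP
    (K := Unit) (fun _ => rowForm a) (fun _ => continuous_rowForm a) (fun _ => rowForm_neg a)
    (fun _ => δ * (totalSq a / r ^ 2)) (fun _ => by positivity) (fun _ => by
      refine (lintegral_rowForm_le a (abs_liftScale_le hκ hp hpr)).trans
        (ENNReal.ofReal_le_ofReal ?_)
      rw [div_sqrt_pow_four hr]
      have := momConst_mul_coverScale_pow hδ hδ1
      calc momConst * (coverScale δ ^ 4 / r ^ 2) * totalSq a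
          = momConst * coverScale δ ^ 4 * (totalSq a / r ^ 2) := by ring
        _ ≤ δ / 10 * (totalSq a / r ^ 2) := by gcongr
        _ ≤ δ * (totalSq a / r ^ 2) / (2 * (Fintype.card Unit : ℕ)) := by
            have : 0 < δ * (totalSq a / r ^ 2) := by positivity
            simp only [Fintype.card_unit, Nat.cast_one]
            linarith)
  refine ⟨F, h1, h2, fun x hx => ?_⟩
  obtain ⟨b, hb, ξ, hξ⟩ := h3 x hx
  refine ⟨b, hb, ?_⟩
  have := rowForm_sub_le a (x - ξ) (b - ξ)
  rw [sub_sub_sub_cancel_right] at this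
  have h4 := (hξ ()).1
  have h5 := (hξ ()).2
  linarith

/-- Besides the full linear image, the image of the ℓ_1 coordinates alone must be small: it provides
the initial diameter for the separate ℓ_1 chaining in `radBound_side`. The 16 is 8·(1+1), from
comparing both points with ξ. -/
lemma exists_linCover {δ : ℝ} (hδ : 0 < δ) (hδ1 : δ ≤ 1) (hp : 0 < p) (hpr : p ≤ r)
    {q : Fin n → ℝ} (hq : ∀ k, 0 ≤ q k) (c : Fin n ⊕ Fin n → Fin n → ℝ) {H : ℝ} (hH : 0 < H)
    (hc : matQuartic q c ≤ H / r ^ 2)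
    {P : Set (Fin n ⊕ Fin n → ℝ)} {v : Fin n ⊕ Fin n → ℝ} (hP : ∀ x ∈ P, x - v ∈ liftBall p n) :
    ∃ F : Finset (Fin n ⊕ Fin n → ℝ), (∀ x ∈ F, x ∈ P) ∧
      (F.card : ℝ) ≤ 2 * Real.exp (9 * r / coverScale δ ^ 2) ∧
      ∀ x ∈ P, ∃ b ∈ F, quartic q (linForm c (x - b)) ≤ 16 * δ * (H / r ^ 4) ∧
        quartic q (linForm (fun j => c (Sum.inr j)) (fun j => (x - b) (Sum.inr j))) ≤
          16 * δ * (H / r ^ 4) := by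
  have hr : 0 < r := hp.trans_le hpr
  have hκ := coverScale_pos hδ
  set Q : Bool → (Fin n ⊕ Fin n → ℝ) → ℝ := fun k u => cond k (quartic q (linForm c u))
    (quartic q (linForm (fun j => c (Sum.inr j)) (fun j => u (Sum.inr j)))) with hQdef
  have hbound : ∀ M : ℝ, M ≤ H / r ^ 2 →
      momConst * (coverScale δ / Real.sqrt r) ^ 4 * M ≤
        δ * (H / r ^ 4) / (2 * (Fintype.card Bool : ℕ)) := by
    intro M hM
    rw [div_sqrt_pow_four hr]
    have h1 := momConst_mul_coverScale_pow hδ hδ1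
    have h2 := one_le_momConst
    calc momConst * (coverScale δ ^ 4 / r ^ 2) * M
        ≤ momConst * (coverScale δ ^ 4 / r ^ 2) * (H / r ^ 2) := by gcongr
      _ = momConst * coverScale δ ^ 4 * (H / r ^ 4) := by
          field_simp
      _ ≤ δ / 10 * (H / r ^ 4) := by gcongr
      _ ≤ δ * (H / r ^ 4) / (2 * (Fintype.card Bool : ℕ)) := by
          have : 0 < δ * (H / r ^ 4) := by positivity
          simp only [Fintype.card_bool]
          push_cast
          linarith
  obtain ⟨F, h1, h2, h3⟩ := exists_liftCover hκ (coverScale_le_one hδ1) hp hpr hP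
    Q (fun k => by
      cases k
      · exact (continuous_quartic_linForm q _).comp (by fun_prop)
      · exact continuous_quartic_linForm q c) (fun k u => by
      cases k
      · have e : (fun j => (-u) (Sum.inr j)) = -(fun j : Fin n => u (Sum.inr j)) := rfl
        simp only [hQdef, cond_false]
        rw [e, linForm_neg, quartic_neg]
      · simp only [hQdef, cond_true]
        rw [linForm_neg, quartic_neg])
    (fun _ => δ * (H / r ^ 4)) (fun _ => by positivity) (fun k => by
      cases k
      · simp only [hQdef, cond_false]
        have := (measurePreserving_sum_inr (Fin n) (Fin n)).lintegral_comp
          (f := fun s => ENNReal.ofReal (quartic q (linForm (fun j => c (Sum.inr j))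
            (fun j => liftScale (coverScale δ) p r n (Sum.inr j) * s j))))
          (((continuous_quartic_linForm q _).comp (by fun_prop)).measurable.ennreal_ofReal)
        rw [this]
        refine (lintegral_quartic_linForm_le hq _ (fun j =>
          abs_liftScale_le hκ hp hpr (Sum.inr j))).trans (ENNReal.ofReal_le_ofReal ?_)
        exact hbound _ ((matQuartic_comp_le hq c Sum.inr_injective).trans hc)
      · simp only [hQdef, cond_true]
        refine (lintegral_quartic_linForm_le hq _
          (abs_liftScale_le hκ hp hpr)).trans (ENNReal.ofReal_le_ofReal ?_)
        exact hbound _ hc)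
  refine ⟨F, h1, h2, fun x hx => ?_⟩
  obtain ⟨b, hb, ξ, hξ⟩ := h3 x hx
  refine ⟨b, hb, ?_, ?_⟩
  · have h4 := (hξ true).1
    have h5 := (hξ true).2
    simp only [hQdef, cond_true] at h4 h5
    have := quartic_sub_le hq (linForm c (x - ξ)) (linForm c (b - ξ))
    rw [← linForm_sub, sub_sub_sub_cancel_right] at this
    linarith
  · have h4 := (hξ false).1
    have h5 := (hξ false).2
    simp only [hQdef, cond_false] at h4 h5
    have := quartic_sub_le hq (linForm (fun j => c (Sum.inr j)) (fun j => (x - ξ) (Sum.inr j)))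
      (linForm (fun j => c (Sum.inr j)) (fun j => (b - ξ) (Sum.inr j)))
    rw [← linForm_sub] at this
    have e : ((fun j => (x - ξ) (Sum.inr j)) - fun j => (b - ξ) (Sum.inr j)) =
        fun j : Fin n => (x - b) (Sum.inr j) := by
      funext j; simp
    rw [e] at this
    linarith

/-- The functionals controlled in the covering of pairs. -/
noncomputable def pairTest (w : (Fin n ⊕ Fin n → ℝ) × (Fin n ⊕ Fin n → ℝ)) (k : Fin 5)
    (u : (Fin n ⊕ Fin n) ⊕ (Fin n ⊕ Fin n) → ℝ) : ℝ :=
  ![rowForm a (fun i => u (Sum.inl i)), rowForm (swapArray a) (fun i => u (Sum.inr i)),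
    quartic (sliceWeight a) (tens a (fun i => u (Sum.inl i)) (fun i => u (Sum.inr i))),
    quartic (sliceWeight a) (tens a w.1 (fun i => u (Sum.inr i))),
    quartic (sliceWeight a) (tens a (fun i => u (Sum.inl i)) w.2)] k

lemma continuous_pairTest (w : (Fin n ⊕ Fin n → ℝ) × (Fin n ⊕ Fin n → ℝ)) (k : Fin 5) :
    Continuous (pairTest a w k) := by
  have hcl : Continuous fun (u : (Fin n ⊕ Fin n) ⊕ (Fin n ⊕ Fin n) → ℝ) i => u (Sum.inl i) := by
    fun_prop
  have hcr : Continuous fun (u : (Fin n ⊕ Fin n) ⊕ (Fin n ⊕ Fin n) → ℝ) i => u (Sum.inr i) := by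
    fun_prop
  have c0 : Continuous fun u : (Fin n ⊕ Fin n) ⊕ (Fin n ⊕ Fin n) → ℝ =>
      rowForm a (fun i => u (Sum.inl i)) := (continuous_rowForm a).comp hcl
  have c1 : Continuous fun u : (Fin n ⊕ Fin n) ⊕ (Fin n ⊕ Fin n) → ℝ =>
      rowForm (swapArray a) (fun i => u (Sum.inr i)) := (continuous_rowForm _).comp hcr
  have c2 : Continuous fun u : (Fin n ⊕ Fin n) ⊕ (Fin n ⊕ Fin n) → ℝ =>
      quartic (sliceWeight a) (tens a (fun i => u (Sum.inl i)) (fun i => u (Sum.inr i))) := by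
    simp only [quartic, tens_apply]
    fun_prop
  have c3 : ∀ x, Continuous fun u : (Fin n ⊕ Fin n) ⊕ (Fin n ⊕ Fin n) → ℝ =>
      quartic (sliceWeight a) (tens a x (fun i => u (Sum.inr i))) := fun x =>
    (continuous_quartic_linForm _ _).comp hcr
  have c4 : ∀ y, Continuous fun u : (Fin n ⊕ Fin n) ⊕ (Fin n ⊕ Fin n) → ℝ =>
      quartic (sliceWeight a) (tens a (fun i => u (Sum.inl i)) y) := fun y => by
    simp only [← tens_swap a]
    exact (continuous_quartic_linForm _ _).comp hcl
  fin_cases k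
  exacts [c0, c1, c2, c3 w.1, c4 w.2]

lemma tens_neg_right (x y : Fin n ⊕ Fin n → ℝ) : tens a x (-y) = -tens a x y := linForm_neg _ _

lemma tens_neg_left (x y : Fin n ⊕ Fin n → ℝ) : tens a (-x) y = -tens a x y := by
  rw [← tens_swap, tens, linForm_neg, ← tens, tens_swap]

lemma pairTest_neg (w : (Fin n ⊕ Fin n → ℝ) × (Fin n ⊕ Fin n → ℝ)) (k : Fin 5)
    (u : (Fin n ⊕ Fin n) ⊕ (Fin n ⊕ Fin n) → ℝ) : pairTest a w k (-u) = pairTest a w k u := by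
  have hnl : (fun i => (-u) (Sum.inl i)) = -(fun i => u (Sum.inl i)) := rfl
  have hnr : (fun i => (-u) (Sum.inr i)) = -(fun i => u (Sum.inr i)) := rfl
  simp only [pairTest, hnl, hnr, rowForm_neg, tens_neg_left, tens_neg_right, quartic_neg, neg_neg]

lemma lintegral_comp_inl {I J : Type*} [Fintype I] [Fintype J] {f : (I → ℝ) → ℝ}
    (hf : Continuous f) : ∫⁻ s, ENNReal.ofReal (f fun i => s (Sum.inl i)) ∂heavyPi (I ⊕ J) =
      ∫⁻ s, ENNReal.ofReal (f s) ∂heavyPi I :=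
  (measurePreserving_sum_inl I J).lintegral_comp (f := fun s => ENNReal.ofReal (f s))
    hf.measurable.ennreal_ofReal

lemma lintegral_comp_inr {I J : Type*} [Fintype I] [Fintype J] {f : (J → ℝ) → ℝ}
    (hf : Continuous f) : ∫⁻ s, ENNReal.ofReal (f fun i => s (Sum.inr i)) ∂heavyPi (I ⊕ J) =
      ∫⁻ s, ENNReal.ofReal (f s) ∂heavyPi J :=
  (measurePreserving_sum_inr I J).lintegral_comp (f := fun s => ENNReal.ofReal (f s))
    hf.measurable.ennreal_ofReal

lemma lintegral_pairTest_le {w : (Fin n ⊕ Fin n → ℝ) × (Fin n ⊕ Fin n → ℝ)}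
    {τ : (Fin n ⊕ Fin n) ⊕ (Fin n ⊕ Fin n) → ℝ} {θ A B : ℝ} (hτle : ∀ i, |τ i| ≤ θ)
    (hA : momConst * θ ^ 4 * totalSq a ≤ A) (hB : momConst ^ 2 * θ ^ 8 * totalSq a ≤ B)
    (hrow : momConst * θ ^ 4 * rowForm a w.1 ≤ B)
    (hcol : momConst * θ ^ 4 * rowForm (swapArray a) w.2 ≤ B) (k : Fin 5) :
    ∫⁻ s, ENNReal.ofReal (pairTest a w k fun i => τ i * s i)
      ∂heavyPi ((Fin n ⊕ Fin n) ⊕ (Fin n ⊕ Fin n)) ≤ ENNReal.ofReal (![A, A, B, B, B] k) := by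
  have i0 : ∫⁻ s, ENNReal.ofReal (rowForm a fun i => τ (Sum.inl i) * s (Sum.inl i))
      ∂heavyPi ((Fin n ⊕ Fin n) ⊕ (Fin n ⊕ Fin n)) ≤ ENNReal.ofReal A := by
    rw [lintegral_comp_inl (f := fun s => rowForm a fun i => τ (Sum.inl i) * s i)
      ((continuous_rowForm a).comp (by fun_prop))]
    exact (lintegral_rowForm_le a (fun i => hτle (Sum.inl i))).trans
      (ENNReal.ofReal_le_ofReal hA)
  have i1 : ∫⁻ s, ENNReal.ofReal (rowForm (swapArray a) fun i => τ (Sum.inr i) * s (Sum.inr i))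
      ∂heavyPi ((Fin n ⊕ Fin n) ⊕ (Fin n ⊕ Fin n)) ≤ ENNReal.ofReal A := by
    rw [lintegral_comp_inr (f := fun s => rowForm (swapArray a) fun i => τ (Sum.inr i) * s i)
      ((continuous_rowForm _).comp (by fun_prop))]
    refine (lintegral_rowForm_le (swapArray a) (fun i => hτle (Sum.inr i))).trans
      (ENNReal.ofReal_le_ofReal ?_)
    rwa [totalSq_swap]
  have i2 : ∫⁻ s, ENNReal.ofReal (quartic (sliceWeight a)
      (tens a (fun i => τ (Sum.inl i) * s (Sum.inl i)) fun i => τ (Sum.inr i) * s (Sum.inr i)))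
      ∂heavyPi ((Fin n ⊕ Fin n) ⊕ (Fin n ⊕ Fin n)) ≤ ENNReal.ofReal B :=
    (lintegral_quartic_tens_le a hτle).trans (ENNReal.ofReal_le_ofReal hB)
  have i3 : ∫⁻ s, ENNReal.ofReal (quartic (sliceWeight a)
      (tens a w.1 fun i => τ (Sum.inr i) * s (Sum.inr i)))
      ∂heavyPi ((Fin n ⊕ Fin n) ⊕ (Fin n ⊕ Fin n)) ≤ ENNReal.ofReal B := by
    rw [lintegral_comp_inr (f := fun s => quartic (sliceWeight a)
        (tens a w.1 fun i => τ (Sum.inr i) * s i))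
      ((continuous_quartic_linForm _ _).comp (by fun_prop))]
    exact (lintegral_quartic_linForm_le (sliceWeight_nonneg a) (contract a w.1)
      (fun i => hτle (Sum.inr i))).trans (ENNReal.ofReal_le_ofReal hrow)
  have i4 : ∫⁻ s, ENNReal.ofReal (quartic (sliceWeight a)
      (tens a (fun i => τ (Sum.inl i) * s (Sum.inl i)) w.2))
      ∂heavyPi ((Fin n ⊕ Fin n) ⊕ (Fin n ⊕ Fin n)) ≤ ENNReal.ofReal B := by
    simp only [← tens_swap a]
    rw [← sliceWeight_swap a, lintegral_comp_inl (f := fun s => quartic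
        (sliceWeight (swapArray a)) (tens (swapArray a) w.2 fun i => τ (Sum.inl i) * s i))
      ((continuous_quartic_linForm _ _).comp (by fun_prop))]
    exact (lintegral_quartic_linForm_le (sliceWeight_nonneg (swapArray a))
      (contract (swapArray a) w.2)
      (fun i => hτle (Sum.inl i))).trans (ENNReal.ofReal_le_ofReal hcol)
  fin_cases k
  exacts [i0, i1, i2, i3, i4]

/-- Differences of tensors expand into a bilinear term in w - ξ and two linear terms whose
coefficients are contractions with w. The latter functionals depend on w, and the row and column
hypotheses bound their moments at order r^{-4}. -/
lemma exists_pairCover {δ : ℝ} (hδ : 0 < δ) (hδ1 : δ ≤ 1) (hp : 0 < p) (hpr : p ≤ r)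
    (hH : 0 < totalSq a)
    {P : Set ((Fin n ⊕ Fin n → ℝ) × (Fin n ⊕ Fin n → ℝ))}
    {v : (Fin n ⊕ Fin n → ℝ) × (Fin n ⊕ Fin n → ℝ)}
    (hP : ∀ w ∈ P, w.1 - v.1 ∈ liftBall p n ∧ w.2 - v.2 ∈ liftBall p n)
    (hrow : ∀ w ∈ P, rowForm a w.1 ≤ totalSq a / r ^ 2)
    (hcol : ∀ w ∈ P, rowForm (swapArray a) w.2 ≤ totalSq a / r ^ 2) :
    ∃ F : Finset ((Fin n ⊕ Fin n → ℝ) × (Fin n ⊕ Fin n → ℝ)), (∀ w ∈ F, w ∈ P) ∧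
      (F.card : ℝ) ≤ 2 * Real.exp (18 * r / coverScale δ ^ 2) ∧
      ∀ w ∈ P, ∃ b ∈ F, rowForm a (w.1 - b.1) ≤ 16 * δ * (totalSq a / r ^ 2) ∧
        rowForm (swapArray a) (w.2 - b.2) ≤ 16 * δ * (totalSq a / r ^ 2) ∧
        quartic (sliceWeight a) (tens a w.1 w.2 - tens a b.1 b.2) ≤
          2176 * δ * (totalSq a / r ^ 4) := by
  have hr : 0 < r := hp.trans_le hpr
  have hκ := coverScale_pos hδ
  have hM := one_le_momConst
  set τ : (Fin n ⊕ Fin n) ⊕ (Fin n ⊕ Fin n) → ℝ :=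
    Sum.elim (liftScale (coverScale δ) p r n) (liftScale (coverScale δ) p r n) with hτ
  have hτpos : ∀ i, 0 < τ i := by
    rintro (i | i) <;> exact liftScale_pos hκ hp hpr i
  have hτle : ∀ i, |τ i| ≤ coverScale δ / Real.sqrt r := by
    rintro (i | i) <;> exact abs_liftScale_le hκ hp hpr i
  have b1 : momConst * (coverScale δ / Real.sqrt r) ^ 4 * totalSq a ≤ δ * (totalSq a / r ^ 2) / 10 := by
    rw [div_sqrt_pow_four hr]
    have h1 := momConst_mul_coverScale_pow hδ hδ1
    calc momConst * (coverScale δ ^ 4 / r ^ 2) * totalSq a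
        = momConst * coverScale δ ^ 4 * (totalSq a / r ^ 2) := by ring
      _ ≤ δ / 10 * (totalSq a / r ^ 2) := by gcongr
      _ = _ := by ring
  have b2 : momConst ^ 2 * (coverScale δ / Real.sqrt r) ^ 8 * totalSq a ≤ δ * (totalSq a / r ^ 4) / 10 := by
    rw [div_sqrt_pow_eight hr]
    have h1 := momConst_sq_mul_coverScale_pow hδ hδ1
    calc momConst ^ 2 * (coverScale δ ^ 8 / r ^ 4) * totalSq a
        = momConst ^ 2 * coverScale δ ^ 8 * (totalSq a / r ^ 4) := by ring
      _ ≤ δ / 10 * (totalSq a / r ^ 4) := by gcongr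
      _ = _ := by ring
  have b3 : ∀ M : ℝ, M ≤ totalSq a / r ^ 2 →
      momConst * (coverScale δ / Real.sqrt r) ^ 4 * M ≤ δ * (totalSq a / r ^ 4) / 10 := by
    intro M hM
    rw [div_sqrt_pow_four hr]
    have h1 := momConst_mul_coverScale_pow hδ hδ1
    calc momConst * (coverScale δ ^ 4 / r ^ 2) * M
        ≤ momConst * (coverScale δ ^ 4 / r ^ 2) * (totalSq a / r ^ 2) := by gcongr
      _ = momConst * coverScale δ ^ 4 * (totalSq a / r ^ 4) := by field_simp
      _ ≤ δ / 10 * (totalSq a / r ^ 4) := by gcongr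
      _ = _ := by ring
  have hcard : (2 * (Fintype.card (Fin 5) : ℕ) : ℝ) = 10 := by norm_num
  obtain ⟨F, h1, h2, h3⟩ := exists_cover τ hτpos P (fun w => Sum.elim w.1 w.2)
    (Sum.elim v.1 v.2) (c := 6 * r / coverScale δ ^ 2) (fun w hw => by
      rw [Fintype.sum_sum_type]
      have e1 := sum_log_liftScale_le hκ (coverScale_le_one hδ1) hp hpr (hP w hw).1
      have e2 := sum_log_liftScale_le hκ (coverScale_le_one hδ1) hp hpr (hP w hw).2
      simp only [hτ, Sum.elim_inl, Sum.elim_inr]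
      simp only [Pi.sub_apply] at e1 e2
      refine (add_le_add e1 e2).trans (le_of_eq ?_)
      ring) (pairTest a) (continuous_pairTest a)
    (pairTest_neg a)
    (![δ * (totalSq a / r ^ 2), δ * (totalSq a / r ^ 2), δ * (totalSq a / r ^ 4), δ * (totalSq a / r ^ 4), δ * (totalSq a / r ^ 4)])
    (fun k => by fin_cases k <;> simp <;> positivity)
    (fun w hw k => by
      rw [hcard]
      refine (lintegral_pairTest_le a hτle b1 b2 (b3 _ (hrow w hw)) (b3 _ (hcol w hw)) k).trans
        (le_of_eq ?_)
      fin_cases k <;> rfl)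
  refine ⟨F, h1, h2.trans (le_of_eq (by ring_nf)), fun w hw => ?_⟩
  obtain ⟨b, hb, ξ, hξ⟩ := h3 w hw
  refine ⟨b, hb, ?_⟩
  set ξ₁ : Fin n ⊕ Fin n → ℝ := fun i => ξ (Sum.inl i) with hξ₁
  set ξ₂ : Fin n ⊕ Fin n → ℝ := fun i => ξ (Sum.inr i) with hξ₂
  have p1 : ∀ y : (Fin n ⊕ Fin n → ℝ) × (Fin n ⊕ Fin n → ℝ),
      (fun i => ((Sum.elim y.1 y.2 : (Fin n ⊕ Fin n) ⊕ (Fin n ⊕ Fin n) → ℝ) - ξ) (Sum.inl i)) =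
        y.1 - ξ₁ := fun y => rfl
  have p2 : ∀ y : (Fin n ⊕ Fin n → ℝ) × (Fin n ⊕ Fin n → ℝ),
      (fun i => ((Sum.elim y.1 y.2 : (Fin n ⊕ Fin n) ⊕ (Fin n ⊕ Fin n) → ℝ) - ξ) (Sum.inr i)) =
        y.2 - ξ₂ := fun y => rfl
  have q0 := hξ 0
  have q1 := hξ 1
  have q2 := hξ 2
  have q3 := hξ 3
  have q4 := hξ 4
  simp only [pairTest, p1, p2, Matrix.cons_val] at q0 q1 q2 q3 q4
  refine ⟨?_, ?_, ?_⟩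
  · have := rowForm_sub_le a (w.1 - ξ₁) (b.1 - ξ₁)
    rw [sub_sub_sub_cancel_right] at this
    linarith [q0.1, q0.2]
  · have := rowForm_sub_le (swapArray a) (w.2 - ξ₂) (b.2 - ξ₂)
    rw [sub_sub_sub_cancel_right] at this
    linarith [q1.1, q1.2]
  · have hsw := sliceWeight_nonneg a
    -- Two uses of the factor-8 inequality give 136 = 8(8·2+1); comparing w and b through ξ then
    -- gives 2176 = 8(136+136).
    have hone : ∀ y : (Fin n ⊕ Fin n → ℝ) × (Fin n ⊕ Fin n → ℝ),
        quartic (sliceWeight a) (tens a (y.1 - ξ₁) (y.2 - ξ₂)) ≤ δ * (totalSq a / r ^ 4) →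
        quartic (sliceWeight a) (tens a y.1 (y.2 - ξ₂)) ≤ δ * (totalSq a / r ^ 4) →
        quartic (sliceWeight a) (tens a (y.1 - ξ₁) y.2) ≤ δ * (totalSq a / r ^ 4) →
        quartic (sliceWeight a) (tens a y.1 y.2 - tens a ξ₁ ξ₂) ≤ 136 * (δ * (totalSq a / r ^ 4)) := by
      intro y k1 k2 k3
      have e : tens a y.1 y.2 - tens a ξ₁ ξ₂ = (tens a y.1 (y.2 - ξ₂) + tens a (y.1 - ξ₁) y.2) -
          tens a (y.1 - ξ₁) (y.2 - ξ₂) := by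
        simp only [tens_sub_left, tens_sub_right]
        abel
      rw [e]
      have l1 := quartic_sub_le hsw (tens a y.1 (y.2 - ξ₂) + tens a (y.1 - ξ₁) y.2)
        (tens a (y.1 - ξ₁) (y.2 - ξ₂))
      have l2 := quartic_add_le hsw (tens a y.1 (y.2 - ξ₂)) (tens a (y.1 - ξ₁) y.2)
      linarith
    have r1 := hone w q2.1 q3.1 q4.1
    have r2 := hone b q2.2 q3.2 q4.2
    have := quartic_sub_le hsw (tens a w.1 w.2 - tens a ξ₁ ξ₂) (tens a b.1 b.2 - tens a ξ₁ ξ₂)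
    rw [sub_sub_sub_cancel_right] at this
    linarith

end Covers

/-! ### Suprema of linear images of Euclidean and ℓ_1 balls. -/

section Linear

variable {n : ℕ}

lemma signForm_mul_linForm {J : Type*} [Fintype J] (ε : Fin n → Bool) (z : Fin n → ℝ)
    (c : J → Fin n → ℝ) (y : J → ℝ) :
    signForm ε (z * linForm c y) = ∑ j, y j * signForm ε (z * c j) := by
  simp only [signForm, linForm, Pi.mul_apply, Finset.mul_sum]
  rw [Finset.sum_comm]
  refine Finset.sum_congr rfl fun j _ => Finset.sum_congr rfl fun k _ => by ring

/-- The expected supremum over a Euclidean ball. -/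
lemma radBound_euclideanBall {J : Type*} [Fintype J] (c : J → Fin n → ℝ) (z : Fin n → ℝ)
    {ρ V : ℝ} (hρ : 0 ≤ ρ) (hV : 0 ≤ V) (h : ∑ k, z k ^ 2 * ∑ j, c j k ^ 2 ≤ V ^ 2) :
    RadBound ((fun y => z * linForm c y) '' {y | ∑ j, y j ^ 2 ≤ ρ ^ 2}) (ρ * V) := by
  refine ⟨fun ε => ρ * Real.sqrt (∑ j, signForm ε (z * c j) ^ 2), ?_, ?_⟩
  · rintro ε _ ⟨y, hy, rfl⟩
    dsimp only
    rw [signForm_mul_linForm]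
    refine (Real.sum_mul_le_sqrt_mul_sqrt _ _ _).trans ?_
    gcongr
    rw [← Real.sqrt_sq hρ]
    exact Real.sqrt_le_sqrt hy
  · rw [signAvg_const_mul]
    refine mul_le_mul_of_nonneg_left ?_ hρ
    refine (signAvg_le_sqrt _).trans ?_
    rw [← Real.sqrt_sq hV]
    refine Real.sqrt_le_sqrt (le_trans (le_of_eq ?_) h)
    have e : ∀ ε : Fin n → Bool, Real.sqrt (∑ j, signForm ε (z * c j) ^ 2) ^ 2 =
        ∑ j, signForm ε (z * c j) ^ 2 := fun ε =>
      Real.sq_sqrt (Finset.sum_nonneg fun j _ => sq_nonneg _)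
    simp only [e]
    rw [signAvg_sum]
    simp only [signAvg_signForm_sq, Pi.mul_apply, mul_pow, Finset.mul_sum]
    exact Finset.sum_comm

/-- On an ℓ_1 ball the translation cost is linear, so e^{O(s)} cells already reach resolution √p
B/s. This decay 1/s, rather than 1/√s, makes the ℓ_1 chaining summable. -/
lemma exists_l1Cover {δ p s B : ℝ} (hδ : 0 < δ) (hδ1 : δ ≤ 1) (hp : 0 < p) (hs : 0 < s)
    (hB : 0 < B) {q : Fin n → ℝ} (hq : ∀ k, 0 ≤ q k) (c : Fin n → Fin n → ℝ)
    (hc : matQuartic q c ≤ B ^ 4) {P : Set (Fin n → ℝ)} {v : Fin n → ℝ}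
    (hP : ∀ y ∈ P, ∑ j, |y j - v j| ≤ Real.sqrt p) :
    ∃ F : Finset (Fin n → ℝ), (∀ y ∈ F, y ∈ P) ∧
      (F.card : ℝ) ≤ 2 * Real.exp (6 * s / coverScale δ) ∧
      ∀ y ∈ P, ∃ b ∈ F, quartic q (linForm c (y - b)) ≤ 16 * δ * (Real.sqrt p / s * B) ^ 4 := by
  have hκ := coverScale_pos hδ
  have hsp := Real.sqrt_pos.2 hp
  have hM := one_le_momConst
  set θ : ℝ := coverScale δ * Real.sqrt p / s with hθ
  have hθpos : 0 < θ := by positivity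
  obtain ⟨F, h1, h2, h3⟩ := exists_cover (fun _ : Fin n => θ) (fun _ => hθpos) P (fun y => y) v
    (c := 2 * s / coverScale δ) (fun y hy => by
      calc ∑ i, Real.log (1 + ((y i - v i) / θ) ^ 2)
          ≤ ∑ i, 2 / θ * |y i - v i| := by
            refine Finset.sum_le_sum fun i _ => (log_one_add_sq_le_abs _).trans (le_of_eq ?_)
            rw [abs_div, abs_of_pos hθpos]
            ring
        _ ≤ 2 / θ * Real.sqrt p := by
            rw [← Finset.mul_sum]
            gcongr
            exact hP y hy
        _ = 2 * s / coverScale δ := by rw [hθ]; field_simp)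
    (fun _ (_ : Unit) u => quartic q (linForm c u))
    (fun _ _ => continuous_quartic_linForm q c)
    (fun _ _ u => by rw [linForm_neg, quartic_neg]) (fun _ => δ * (Real.sqrt p / s * B) ^ 4)
    (fun _ => by positivity) (fun _ _ _ => by
      refine (lintegral_quartic_linForm_le hq c (fun _ => (abs_of_pos hθpos).le)).trans
        (ENNReal.ofReal_le_ofReal ?_)
      have h1 := momConst_mul_coverScale_pow hδ hδ1
      calc momConst * θ ^ 4 * matQuartic q c ≤ momConst * θ ^ 4 * B ^ 4 := by gcongr
        _ = momConst * coverScale δ ^ 4 * (Real.sqrt p / s * B) ^ 4 := by rw [hθ]; ring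
        _ ≤ δ / 10 * (Real.sqrt p / s * B) ^ 4 := by gcongr
        _ ≤ δ * (Real.sqrt p / s * B) ^ 4 / (2 * (Fintype.card Unit : ℕ)) := by
          have : 0 < δ * (Real.sqrt p / s * B) ^ 4 := by positivity
          simp only [Fintype.card_unit, Nat.cast_one]
          linarith)
  refine ⟨F, h1, h2.trans (le_of_eq (by ring_nf)), fun y hy => ?_⟩
  obtain ⟨b, hb, ξ, hξ⟩ := h3 y hy
  refine ⟨b, hb, ?_⟩
  have := quartic_sub_le hq (linForm c (y - ξ)) (linForm c (b - ξ))
  rw [← linForm_sub, sub_sub_sub_cancel_right] at this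
  linarith [(hξ ()).1, (hξ ()).2]

/-- The entropy constant of the `ℓ_1` ball. -/
noncomputable def l1Const : ℝ := 6 / coverScale (1 / 256) + 1

lemma l1Const_pos : 0 < l1Const := by
  have := coverScale_pos (δ := 1 / 256) (by norm_num)
  unfold l1Const; positivity

lemma two_le_exp {s : ℝ} (hs : 1 ≤ s) : 2 ≤ Real.exp s := by
  have := Real.add_one_le_exp s
  linarith

lemma quartic_diam_le {q : Fin n → ℝ} (hq : ∀ k, 0 ≤ q k) {t t' b : Fin n → ℝ} {M : ℝ}
    (h : quartic q (t - b) ≤ M) (h' : quartic q (t' - b) ≤ M) :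
    quartic q (t - t') ≤ 16 * M := by
  have := quartic_sub_le hq (t - b) (t' - b)
  rw [sub_sub_sub_cancel_right] at this
  linarith

/-- One chaining level: split into e^{O(s)} cells of diameter √p B/s and pay √s times the current L²
diameter WΔ, where W converts the quartic metric into the L² one. -/
lemma radBound_l1_step {p s B W Δ : ℝ} (hp : 0 < p) (hs : 1 ≤ s) (hB : 0 < B) (hW : 0 < W)
    (hΔ : 0 < Δ) {q z : Fin n → ℝ} (hq : ∀ k, 0 ≤ q k) {c : Fin n → Fin n → ℝ}
    (hc : matQuartic q c ≤ B ^ 4)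
    (hz : ∀ y, ∑ k, (z k * linForm c y k) ^ 2 ≤ W ^ 2 * Real.sqrt (quartic q (linForm c y)))
    {P : Set (Fin n → ℝ)} {v : Fin n → ℝ} (hP : ∀ y ∈ P, ∑ j, |y j - v j| ≤ Real.sqrt p)
    (hd : ∀ y ∈ P, ∀ y' ∈ P, quartic q (linForm c (y - y')) ≤ Δ ^ 4) {e : ℝ}
    (hrec : ∀ P' ⊆ P, (∀ y ∈ P', ∀ y' ∈ P',
      quartic q (linForm c (y - y')) ≤ (Real.sqrt p / s * B) ^ 4) →
      RadBound ((fun y => z * linForm c y) '' P') e) :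
    RadBound ((fun y => z * linForm c y) '' P) (e + 9 * Real.sqrt (l1Const * s) * (W * Δ)) := by
  have hs0 : 0 < s := by linarith
  have hκ := coverScale_pos (δ := 1 / 256) (by norm_num)
  -- With δ = 1/256 one has 16·16δ = 1: one 16 comes from the cover, the other from passing from
  -- radius to diameter.
  obtain ⟨F, h1, h2, h3⟩ := exists_l1Cover (δ := 1 / 256) (by norm_num) (by norm_num) hp hs0 hB
    hq c hc hP
  set cell : (Fin n → ℝ) → Set (Fin n → ℝ) := fun b =>
    {y ∈ P | quartic q (linForm c (y - b)) ≤ 16 * (1 / 256) * (Real.sqrt p / s * B) ^ 4}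
    with hcell
  have hsub : (⋃ b ∈ F, (fun y => z * linForm c y) '' cell b) ⊆
      (fun y => z * linForm c y) '' P := by
    refine Set.iUnion₂_subset fun b _ => Set.image_mono fun y hy => hy.1
  refine (radBound_biUnion F (fun b => (fun y => z * linForm c y) '' cell b)
    (c := e) (mul_pos hW hΔ) (mul_pos l1Const_pos hs0) ?_ ?_ ?_).mono ?_ le_rfl
  · refine h2.trans ?_
    calc 2 * Real.exp (6 * s / coverScale (1 / 256))
        ≤ Real.exp s * Real.exp (6 * s / coverScale (1 / 256)) := by
          gcongr
          exact two_le_exp hs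
      _ = Real.exp (l1Const * s) := by
          rw [← Real.exp_add, l1Const]
          ring_nf
  · intro b _
    refine hrec _ (fun y hy => hy.1) fun y hy y' hy' => ?_
    have k1 := hy.2
    have k2 := hy'.2
    rw [linForm_sub] at k1 k2
    rw [linForm_sub]
    exact (quartic_diam_le hq k1 k2).trans (le_of_eq (by ring))
  · intro t ht t' ht'
    obtain ⟨y, hy, rfl⟩ := hsub ht
    obtain ⟨y', hy', rfl⟩ := hsub ht'
    have e1 : ∀ k, (z * linForm c y) k - (z * linForm c y') k = z k * linForm c (y - y') k := by
      intro k
      rw [linForm_sub]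
      simp only [Pi.mul_apply, Pi.sub_apply]
      ring
    simp only [e1]
    refine (hz _).trans ?_
    rw [mul_pow]
    gcongr
    rw [show Δ ^ 2 = Real.sqrt ((Δ ^ 2) ^ 2) from (Real.sqrt_sq (sq_nonneg Δ)).symm]
    exact Real.sqrt_le_sqrt ((hd y hy y' hy').trans (le_of_eq (by ring)))
  · rintro _ ⟨y, hy, rfl⟩
    obtain ⟨b, hb, hyb⟩ := h3 y hy
    exact Set.mem_biUnion hb ⟨y, ⟨hy, hyb⟩, rfl⟩

/-- The expected supremum over a translate of a part of the `ℓ_1` ball. -/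
theorem radBound_l1 {p r B W Δ : ℝ} (hp : 1 ≤ p) (hpr : p ≤ r) (hB : 0 < B) (hW : 0 < W)
    (hΔ : 0 < Δ) {q z : Fin n → ℝ} (hq : ∀ k, 0 ≤ q k) {c : Fin n → Fin n → ℝ}
    (hc : matQuartic q c ≤ B ^ 4)
    (hz : ∀ y, ∑ k, (z k * linForm c y k) ^ 2 ≤ W ^ 2 * Real.sqrt (quartic q (linForm c y)))
    {P : Set (Fin n → ℝ)} {v : Fin n → ℝ} (hP : ∀ y ∈ P, ∑ j, |y j - v j| ≤ Real.sqrt p)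
    (hd : ∀ y ∈ P, ∀ y' ∈ P, quartic q (linForm c (y - y')) ≤ Δ ^ 4) :
    RadBound ((fun y => z * linForm c y) '' P)
      (Real.sqrt l1Const * W * (54 * B + 9 * Real.sqrt r * Δ)) := by
  have hp0 : 0 < p := by linarith
  have hr : 1 ≤ r := by linarith
  have hr0 : 0 < r := by linarith
  have hsp := Real.sqrt_pos.2 hp0
  have hsr := Real.sqrt_pos.2 hr0
  have hL := Real.sqrt_pos.2 l1Const_pos
  have hpow : ∀ m : ℕ, 1 ≤ (4 : ℝ) ^ m * r := fun m => by
    have : (1 : ℝ) ≤ 4 ^ m := one_le_pow₀ (by norm_num)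
    nlinarith
  -- The first split starts from the given diameter Δ and yields the term 9√r Δ; from there on the
  -- diameters are √p B/(4^m r) and the chain is geometric.
  refine (radBound_l1_step hp0 hr hB hW hΔ hq hc hz hP hd
    (e := 3 * (18 * Real.sqrt l1Const * (W * B))) fun P' hP' hd' => ?_).mono subset_rfl
    (le_of_eq ?_)
  swap
  · rw [Real.sqrt_mul l1Const_pos.le]; ring
  refine radBound_of_geometric_chain (fun m => {T | ∃ Q : Set (Fin n → ℝ), Q ⊆ P ∧
      (∀ y ∈ Q, ∀ y' ∈ Q, quartic q (linForm c (y - y')) ≤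
        (Real.sqrt p / (4 ^ m * r) * B) ^ 4) ∧ T = (fun y => z * linForm c y) '' Q})
    (R := Real.sqrt n * (W * (Real.sqrt p / r * B))) (by positivity) ?_ ?_ _
    ⟨P', hP', by simpa using hd', rfl⟩
  · rintro m _ ⟨Q, hQP, hQd, rfl⟩ e he
    have hm : 0 < (4 : ℝ) ^ m * r := by linarith [hpow m]
    refine (radBound_l1_step (Δ := Real.sqrt p / (4 ^ m * r) * B) hp0 (hpow (m + 1)) hB hW
      (by positivity) hq hc hz (fun y hy => hP y (hQP hy)) hQd (e := e) fun Q' hQ' hQd' =>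
      he _ ⟨Q', hQ'.trans hQP, hQd', rfl⟩).mono subset_rfl ?_
    have e1 : Real.sqrt (l1Const * (4 ^ (m + 1) * r)) =
        Real.sqrt l1Const * (2 ^ (m + 1) * Real.sqrt r) := by
      rw [Real.sqrt_mul l1Const_pos.le, Real.sqrt_mul (by positivity)]
      congr 2
      rw [show (4 : ℝ) ^ (m + 1) = (2 ^ (m + 1)) ^ 2 by rw [← pow_mul, mul_comm, pow_mul]; norm_num]
      exact Real.sqrt_sq (by positivity)
    have e2 : Real.sqrt p * Real.sqrt r ≤ r := by
      calc Real.sqrt p * Real.sqrt r ≤ Real.sqrt r * Real.sqrt r := by gcongr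
        _ = r := Real.mul_self_sqrt hr0.le
    have e3 : (1 / 2 : ℝ) ^ m * 4 ^ m = 2 ^ m := by rw [← mul_pow]; norm_num
    rw [e1]
    refine add_le_add_right ?_ e
    -- Level m splits at scale 4^{m+1} r a set of diameter √p B/(4^m r): the powers of 4 leave
    -- 2·2^{-m}, and √p √r ≤ r absorbs the rest.
    have e4 : 9 * (Real.sqrt l1Const * (2 ^ (m + 1) * Real.sqrt r)) *
        (W * (Real.sqrt p / (4 ^ m * r) * B)) =
        18 * Real.sqrt l1Const * (W * B) * (1 / 2) ^ m * ((Real.sqrt p * Real.sqrt r) / r) := by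
      rw [pow_succ, ← e3]
      field_simp
      ring
    rw [e4]
    refine mul_le_of_le_one_right (by positivity) ?_
    rwa [div_le_one hr0]
  · rintro m _ ⟨Q, hQP, hQd, rfl⟩
    have hm : 0 < (4 : ℝ) ^ m * r := by linarith [hpow m]
    refine (radBound_of_diam (σ := W * (Real.sqrt p / (4 ^ m * r) * B)) (by positivity)
      ?_).mono subset_rfl (le_of_eq ?_)
    · rintro _ ⟨y, hy, rfl⟩ _ ⟨y', hy', rfl⟩
      have e1 : ∀ k, (z * linForm c y) k - (z * linForm c y') k = z k * linForm c (y - y') k := by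
        intro k
        rw [linForm_sub]
        simp only [Pi.mul_apply, Pi.sub_apply]
        ring
      simp only [e1]
      refine (hz _).trans ?_
      rw [mul_pow]
      gcongr
      rw [← Real.sqrt_sq (sq_nonneg (Real.sqrt p / (4 ^ m * r) * B))]
      exact Real.sqrt_le_sqrt ((hQd y hy y' hy').trans (le_of_eq (by ring)))
    · rw [one_div, inv_pow]
      field_simp

end Linear

/-! ### Chaining for the bilinear map. -/

section Bilinear

variable {n : ℕ}

/-- Sets of pairs that lie in a translate of `liftBall p n × liftBall p n` and have small rows
and columns. -/
structure SmallRows (a : Fin n ⊕ Fin n → Fin n ⊕ Fin n → Fin n → ℝ) (p r : ℝ)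
    (P : Set ((Fin n ⊕ Fin n → ℝ) × (Fin n ⊕ Fin n → ℝ))) : Prop where
  translate : ∃ v : (Fin n ⊕ Fin n → ℝ) × (Fin n ⊕ Fin n → ℝ),
    ∀ w ∈ P, w.1 - v.1 ∈ liftBall p n ∧ w.2 - v.2 ∈ liftBall p n
  row : ∀ w ∈ P, rowForm a w.1 ≤ totalSq a / r ^ 2
  col : ∀ w ∈ P, rowForm (swapArray a) w.2 ≤ totalSq a / r ^ 2

/-- The diameter of the set of tensors is small. -/
def SmallDiam (a : Fin n ⊕ Fin n → Fin n ⊕ Fin n → Fin n → ℝ) (r : ℝ)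
    (P : Set ((Fin n ⊕ Fin n → ℝ) × (Fin n ⊕ Fin n → ℝ))) : Prop :=
  ∀ w ∈ P, ∀ w' ∈ P,
    quartic (sliceWeight a) (tens a w.1 w.2 - tens a w'.1 w'.2) ≤ totalSq a / r ^ 4

/-- The `ℓ_1` parts of the second coordinates are close in the metric given by a contraction. -/
def SmallSide (a : Fin n ⊕ Fin n → Fin n ⊕ Fin n → Fin n → ℝ) (r : ℝ) (x : Fin n ⊕ Fin n → ℝ)
    (Y : Set (Fin n ⊕ Fin n → ℝ)) : Prop :=
  ∀ y ∈ Y, ∀ y' ∈ Y, quartic (sliceWeight a)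
    (linForm (fun j => contract a x (Sum.inr j)) fun j => (y - y') (Sum.inr j)) ≤
      totalSq a / r ^ 4

/-- The accuracy used in the partitioning step. -/
noncomputable def stepAcc : ℝ := 1 / 10 ^ 8

/-- The entropy constant of the partitioning step. -/
noncomputable def stepConst : ℝ := 36 / coverScale stepAcc ^ 2 + 3

lemma stepAcc_pos : 0 < stepAcc := by unfold stepAcc; positivity

lemma stepAcc_le_one : stepAcc ≤ 1 := by unfold stepAcc; norm_num

lemma stepConst_pos : 0 < stepConst := by
  have := coverScale_pos stepAcc_pos
  unfold stepConst; positivity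

/-- The partitioning step. -/
theorem exists_partition {a : Fin n ⊕ Fin n → Fin n ⊕ Fin n → Fin n → ℝ} {p r : ℝ} (hp : 1 ≤ p)
    (hpr : p ≤ r) (hH : 0 < totalSq a)
    {P : Set ((Fin n ⊕ Fin n → ℝ) × (Fin n ⊕ Fin n → ℝ))} (hP : SmallRows a p r P) :
    ∃ (N : ℕ) (b : Fin N → (Fin n ⊕ Fin n → ℝ) × (Fin n ⊕ Fin n → ℝ))
      (R : Fin N → Set ((Fin n ⊕ Fin n → ℝ) × (Fin n ⊕ Fin n → ℝ))),
      (N : ℝ) ≤ Real.exp (stepConst * r) ∧ (∀ l, b l ∈ P) ∧ P = ⋃ l, R l ∧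
      (∀ l, SmallRows a p (4 * r) ((fun w => w - b l) '' R l)) ∧
      (∀ l, SmallDiam a (4 * r) ((fun w => w - b l) '' R l)) ∧
      (∀ l, SmallSide a r (b l).1 (Prod.snd '' R l)) ∧
      (∀ l, SmallSide (swapArray a) r (b l).2 (Prod.fst '' R l)) := by
  have hp0 : 0 < p := by linarith
  have hr1 : 1 ≤ r := by linarith
  have hr : 0 < r := by linarith
  have hδ := stepAcc_pos
  have hδ1 := stepAcc_le_one
  have hq := sliceWeight_nonneg a
  have hκ := coverScale_pos hδ
  obtain ⟨v, hv⟩ := hP.translate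
  obtain ⟨F, hFP, hFc, hF⟩ := exists_pairCover a hδ hδ1 hp0 hpr hH hv hP.row hP.col
  -- Each centre l gets two further covers, in the metrics of the linear maps obtained by fixing one
  -- component of l. Since l lies in P, its rows and columns are small, so these covers also have
  -- e^{O(r)} members.
  have hex2 : ∀ l ∈ P, ∃ G : Finset (Fin n ⊕ Fin n → ℝ),
      (G.card : ℝ) ≤ 2 * Real.exp (9 * r / coverScale stepAcc ^ 2) ∧
      ∀ x ∈ Prod.snd '' P, ∃ b ∈ G,
        quartic (sliceWeight a) (linForm (contract a l.1) (x - b)) ≤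
          16 * stepAcc * (totalSq a / r ^ 4) ∧
        quartic (sliceWeight a) (linForm (fun j => contract a l.1 (Sum.inr j))
          (fun j => (x - b) (Sum.inr j))) ≤ 16 * stepAcc * (totalSq a / r ^ 4) := by
    intro l hl
    obtain ⟨G, -, h2, h3⟩ := exists_linCover hδ hδ1 hp0 hpr hq (contract a l.1) hH
      (hP.row l hl) (P := Prod.snd '' P) (v := v.2) (by
        rintro _ ⟨w, hw, rfl⟩
        exact (hv w hw).2)
    exact ⟨G, h2, h3⟩
  have hex1 : ∀ l ∈ P, ∃ G : Finset (Fin n ⊕ Fin n → ℝ),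
      (G.card : ℝ) ≤ 2 * Real.exp (9 * r / coverScale stepAcc ^ 2) ∧
      ∀ x ∈ Prod.fst '' P, ∃ b ∈ G,
        quartic (sliceWeight a) (linForm (contract (swapArray a) l.2) (x - b)) ≤
          16 * stepAcc * (totalSq a / r ^ 4) ∧
        quartic (sliceWeight a) (linForm (fun j => contract (swapArray a) l.2 (Sum.inr j))
          (fun j => (x - b) (Sum.inr j))) ≤ 16 * stepAcc * (totalSq a / r ^ 4) := by
    intro l hl
    have hcol := hP.col l hl
    rw [rowForm, sliceWeight_swap] at hcol
    obtain ⟨G, -, h2, h3⟩ := exists_linCover hδ hδ1 hp0 hpr hq (contract (swapArray a) l.2) hH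
      hcol (P := Prod.fst '' P) (v := v.1) (by
        rintro _ ⟨w, hw, rfl⟩
        exact (hv w hw).1)
    exact ⟨G, h2, h3⟩
  choose! G₂ hG₂c hG₂ using hex2
  choose! G₁ hG₁c hG₁ using hex1
  set S := F.sigma fun l => G₁ l ×ˢ G₂ l with hS
  set cell : (Σ _ : (Fin n ⊕ Fin n → ℝ) × (Fin n ⊕ Fin n → ℝ),
      (Fin n ⊕ Fin n → ℝ) × (Fin n ⊕ Fin n → ℝ)) →
      Set ((Fin n ⊕ Fin n → ℝ) × (Fin n ⊕ Fin n → ℝ)) := fun i =>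
    {w | w ∈ P ∧ (rowForm a (w.1 - i.1.1) ≤ 16 * stepAcc * (totalSq a / r ^ 2) ∧
        rowForm (swapArray a) (w.2 - i.1.2) ≤ 16 * stepAcc * (totalSq a / r ^ 2) ∧
        quartic (sliceWeight a) (tens a w.1 w.2 - tens a i.1.1 i.1.2) ≤
          2176 * stepAcc * (totalSq a / r ^ 4)) ∧
      (quartic (sliceWeight a) (linForm (contract (swapArray a) i.1.2) (w.1 - i.2.1)) ≤
          16 * stepAcc * (totalSq a / r ^ 4) ∧
        quartic (sliceWeight a) (linForm (fun j => contract (swapArray a) i.1.2 (Sum.inr j))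
          (fun j => (w.1 - i.2.1) (Sum.inr j))) ≤ 16 * stepAcc * (totalSq a / r ^ 4)) ∧
      (quartic (sliceWeight a) (linForm (contract a i.1.1) (w.2 - i.2.2)) ≤
          16 * stepAcc * (totalSq a / r ^ 4) ∧
        quartic (sliceWeight a) (linForm (fun j => contract a i.1.1 (Sum.inr j))
          (fun j => (w.2 - i.2.2) (Sum.inr j))) ≤ 16 * stepAcc * (totalSq a / r ^ 4))}
    with hcell
  have hHr2 : 0 < totalSq a / r ^ 2 := by positivity
  have hHr4 : 0 < totalSq a / r ^ 4 := by positivity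
  -- The binding requirement is the new tensor diameter: 8(16·2176 + 8·2·256)·10^{-8} must be below
  -- 4^{-4}.
  have hacc : stepAcc = 1 / 10 ^ 8 := rfl
  refine ⟨S.card, fun l => (S.equivFin.symm l).1.1, fun l => cell (S.equivFin.symm l).1,
    ?_, ?_, ?_, ?_, ?_, ?_, ?_⟩
  · have h1 : (S.card : ℝ) ≤ (F.card : ℝ) * ((2 * Real.exp (9 * r / coverScale stepAcc ^ 2)) *
        (2 * Real.exp (9 * r / coverScale stepAcc ^ 2))) := by
      rw [hS, Finset.card_sigma]
      push_cast
      rw [← nsmul_eq_mul]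
      refine Finset.sum_le_card_nsmul _ _ _ fun l hl => ?_
      rw [Finset.card_product]
      push_cast
      have := hG₁c l (hFP l hl)
      have := hG₂c l (hFP l hl)
      gcongr
    calc (S.card : ℝ) ≤ (2 * Real.exp (18 * r / coverScale stepAcc ^ 2)) *
          ((2 * Real.exp (9 * r / coverScale stepAcc ^ 2)) *
          (2 * Real.exp (9 * r / coverScale stepAcc ^ 2))) := h1.trans (by gcongr)
      _ = 2 * 2 * 2 * Real.exp (36 * r / coverScale stepAcc ^ 2) := by
          have : Real.exp (36 * r / coverScale stepAcc ^ 2) =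
              Real.exp (18 * r / coverScale stepAcc ^ 2) *
              (Real.exp (9 * r / coverScale stepAcc ^ 2) *
                Real.exp (9 * r / coverScale stepAcc ^ 2)) := by
            rw [← Real.exp_add, ← Real.exp_add]; ring_nf
          rw [this]; ring
      _ ≤ Real.exp r * Real.exp r * Real.exp r * Real.exp (36 * r / coverScale stepAcc ^ 2) := by
          have := two_le_exp hr1
          gcongr
      _ = Real.exp (stepConst * r) := by
          rw [← Real.exp_add, ← Real.exp_add, ← Real.exp_add, stepConst]; ring_nf
  · intro l
    have := (S.equivFin.symm l).2
    exact hFP _ (Finset.mem_sigma.1 this).1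
  · refine Set.Subset.antisymm (fun w hw => ?_) (Set.iUnion_subset fun l w hw => hw.1)
    obtain ⟨l, hl, hwl⟩ := hF w hw
    obtain ⟨b₁, hb₁, h₁⟩ := hG₁ l (hFP l hl) w.1 ⟨w, hw, rfl⟩
    obtain ⟨b₂, hb₂, h₂⟩ := hG₂ l (hFP l hl) w.2 ⟨w, hw, rfl⟩
    have hmem : (⟨l, (b₁, b₂)⟩ : Σ _ : (Fin n ⊕ Fin n → ℝ) × (Fin n ⊕ Fin n → ℝ),
      (Fin n ⊕ Fin n → ℝ) × (Fin n ⊕ Fin n → ℝ)) ∈ S :=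
      Finset.mem_sigma.2 ⟨hl, Finset.mem_product.2 ⟨hb₁, hb₂⟩⟩
    refine Set.mem_iUnion.2 ⟨S.equivFin ⟨_, hmem⟩, ?_⟩
    rw [Equiv.symm_apply_apply]
    exact ⟨hw, hwl, h₁, h₂⟩
  · intro l
    have e4 : totalSq a / (4 * r) ^ 2 = 1 / 16 * (totalSq a / r ^ 2) := by
      field_simp; norm_num
    refine ⟨⟨v - (S.equivFin.symm l).1.1, ?_⟩, ?_, ?_⟩
    · rintro _ ⟨w, hw, rfl⟩
      have := hv w hw.1
      simpa only [Prod.fst_sub, Prod.snd_sub, sub_sub_sub_cancel_right] using this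
    · rintro _ ⟨w, hw, rfl⟩
      refine hw.2.1.1.trans ?_
      rw [e4, hacc]
      gcongr
      norm_num
    · rintro _ ⟨w, hw, rfl⟩
      refine hw.2.1.2.1.trans ?_
      rw [e4, hacc]
      gcongr
      norm_num
  · rintro l _ ⟨w, hw, rfl⟩ _ ⟨w', hw', rfl⟩
    set i := (S.equivFin.symm l).1 with hi
    have e4 : totalSq a / (4 * r) ^ 4 = 1 / 256 * (totalSq a / r ^ 4) := by
      field_simp; norm_num
    -- Recentring at the same b leaves the difference of the original tensors minus two linear
    -- differences, one for each of the three covers.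
    have e : tens a (w - i.1).1 (w - i.1).2 - tens a (w' - i.1).1 (w' - i.1).2 =
        (tens a w.1 w.2 - tens a w'.1 w'.2) -
        ((tens a i.1.1 w.2 - tens a i.1.1 w'.2) + (tens a w.1 i.1.2 - tens a w'.1 i.1.2)) := by
      simp only [Prod.fst_sub, Prod.snd_sub, tens_sub_left, tens_sub_right]
      abel
    have d1 := quartic_diam_le hq hw.2.1.2.2 hw'.2.1.2.2
    have k2 := hw.2.2.2.1
    have k2' := hw'.2.2.2.1
    rw [linForm_sub] at k2 k2'
    have d2 : quartic (sliceWeight a) (tens a i.1.1 w.2 - tens a i.1.1 w'.2) ≤ _ :=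
      quartic_diam_le hq k2 k2'
    have k3 := hw.2.2.1.1
    have k3' := hw'.2.2.1.1
    rw [linForm_sub] at k3 k3'
    have d3 : quartic (sliceWeight a)
        (tens (swapArray a) i.1.2 w.1 - tens (swapArray a) i.1.2 w'.1) ≤ _ :=
      quartic_diam_le hq k3 k3'
    rw [tens_swap, tens_swap] at d3
    dsimp only
    rw [e, e4]
    have l1 := quartic_sub_le hq (tens a w.1 w.2 - tens a w'.1 w'.2)
      ((tens a i.1.1 w.2 - tens a i.1.1 w'.2) + (tens a w.1 i.1.2 - tens a w'.1 i.1.2))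
    have l2 := quartic_add_le hq (tens a i.1.1 w.2 - tens a i.1.1 w'.2)
      (tens a w.1 i.1.2 - tens a w'.1 i.1.2)
    rw [hacc] at d1 d2 d3
    linarith
  · rintro l _ ⟨w, hw, rfl⟩ _ ⟨w', hw', rfl⟩
    have k := hw.2.2.2.2
    have k' := hw'.2.2.2.2
    have e : ∀ x y : Fin n ⊕ Fin n → ℝ, (fun j : Fin n => (x - y) (Sum.inr j)) =
      (fun j : Fin n => x (Sum.inr j)) - fun j : Fin n => y (Sum.inr j) := fun x y => rfl
    rw [e, linForm_sub] at k k' ⊢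
    refine (quartic_diam_le hq k k').trans ?_
    rw [hacc]
    linarith
  · rintro l _ ⟨w, hw, rfl⟩ _ ⟨w', hw', rfl⟩
    have k := hw.2.2.1.2
    have k' := hw'.2.2.1.2
    have e : ∀ x y : Fin n ⊕ Fin n → ℝ, (fun j : Fin n => (x - y) (Sum.inr j)) =
      (fun j : Fin n => x (Sum.inr j)) - fun j : Fin n => y (Sum.inr j) := fun x y => rfl
    rw [sliceWeight_swap, totalSq_swap]
    rw [e, linForm_sub] at k k' ⊢
    refine (quartic_diam_le hq k k').trans ?_
    rw [hacc]
    linarith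

/-- The constant in the one-sided estimate. -/
noncomputable def sideConst : ℝ := 2 + 63 * Real.sqrt l1Const

lemma sum_sq_mul_linForm_contract_le (a : Fin n ⊕ Fin n → Fin n ⊕ Fin n → Fin n → ℝ)
    {z : Fin n → ℝ} {W : ℝ} (hW : 0 < W) (hWz : ∑ k, sliceSq a k * z k ^ 4 = W ^ 4)
    (x : Fin n ⊕ Fin n → ℝ) {D : Type*} [Fintype D] (f : D → Fin n ⊕ Fin n) (y : D → ℝ) :
    ∑ k, (z k * linForm (fun j => contract a x (f j)) y k) ^ 2 ≤
      W ^ 2 * Real.sqrt (quartic (sliceWeight a) (linForm (fun j => contract a x (f j)) y)) := by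
  have h := sum_sq_mul_tens_le a z (linForm (fun j => contract a x (f j)) y) (fun k hk => by
    simp [linForm, contract, contract_eq_zero hk])
  have e : Real.sqrt (W ^ 4) = W ^ 2 := by
    rw [show W ^ 4 = (W ^ 2) ^ 2 by ring]
    exact Real.sqrt_sq (by positivity)
  rwa [hWz, e] at h

/-- The ℓ_2 coordinates of y - b fill at most a Euclidean ball of radius 2, treated by
Cauchy-Schwarz. The ℓ_1 coordinates fall under `radBound_l1` with B = h/√r and Δ = h/r, so that B
and √r Δ agree and 54 + 9 = 63. -/
lemma radBound_side {a : Fin n ⊕ Fin n → Fin n ⊕ Fin n → Fin n → ℝ} {p r h W : ℝ} (hp : 1 ≤ p)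
    (hpr : p ≤ r) (hh : 0 < h) (hhH : h ^ 4 = totalSq a) (hW : 0 < W) {z : Fin n → ℝ}
    (hWz : ∑ k, sliceSq a k * z k ^ 4 = W ^ 4) {x : Fin n ⊕ Fin n → ℝ}
    (hx : rowForm a x ≤ totalSq a / r ^ 2) {Y : Set (Fin n ⊕ Fin n → ℝ)}
    {v b : Fin n ⊕ Fin n → ℝ} (hY : ∀ y ∈ Y, y - v ∈ liftBall p n) (hb : b - v ∈ liftBall p n)
    (hs : SmallSide a r x Y) :
    RadBound ((fun y => z * tens a x (y - b)) '' Y) (sideConst * (W * h / Real.sqrt r)) := by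
  have hr : 0 < r := by linarith
  have hsr := Real.sqrt_pos.2 hr
  have hsr2 : Real.sqrt r ^ 2 = r := Real.sq_sqrt hr.le
  have hq := sliceWeight_nonneg a
  have hB4 : (h / Real.sqrt r) ^ 4 = totalSq a / r ^ 2 := by
    rw [div_pow, hhH, show Real.sqrt r ^ 4 = (Real.sqrt r ^ 2) ^ 2 by ring, hsr2]
  have hΔ4 : (h / r) ^ 4 = totalSq a / r ^ 4 := by rw [div_pow, hhH]
  have hW4 : Real.sqrt (W ^ 4) = W ^ 2 := by
    rw [show W ^ 4 = (W ^ 2) ^ 2 by ring]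
    exact Real.sqrt_sq (by positivity)
  -- the Euclidean part
  have h1 := radBound_euclideanBall (fun i : Fin n => contract a x (Sum.inl i)) z (ρ := 2)
    (V := W * (h / Real.sqrt r)) (by norm_num) (by positivity) (by
      have k1 : ∑ k, z k ^ 2 * ∑ j : Fin n, contract a x (Sum.inl j) k ^ 2 ≤
          ∑ k, z k ^ 2 * ∑ j, contract a x j k ^ 2 := by
        refine Finset.sum_le_sum fun k _ => mul_le_mul_of_nonneg_left ?_ (sq_nonneg _)
        rw [Fintype.sum_sum_type]
        have : 0 ≤ ∑ j : Fin n, contract a x (Sum.inr j) k ^ 2 :=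
          Finset.sum_nonneg fun j _ => sq_nonneg _
        linarith
      refine k1.trans ((sum_sq_mul_contract_le a z x).trans ?_)
      rw [hWz, hW4, mul_pow]
      gcongr
      rw [← Real.sqrt_sq (sq_nonneg (h / Real.sqrt r))]
      refine Real.sqrt_le_sqrt (hx.trans (le_of_eq ?_))
      rw [← hB4]; ring)
  -- the `ℓ_1` part
  have h2 := radBound_l1 (p := p) (r := r) (B := h / Real.sqrt r) (W := W) (Δ := h / r) hp hpr
    (by positivity) hW (by positivity) hq (z := z)
    (c := fun j : Fin n => contract a x (Sum.inr j))
    ((matQuartic_comp_le hq (contract a x) Sum.inr_injective).trans (hx.trans hB4.ge))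
    (fun y => sum_sq_mul_linForm_contract_le a hW hWz x Sum.inr y)
    (P := (fun y j => (y - b) (Sum.inr j)) '' Y) (v := fun j => (v - b) (Sum.inr j)) (by
      rintro _ ⟨y, hy, rfl⟩
      have := (hY y hy).2
      simpa only [Pi.sub_apply, sub_sub_sub_cancel_right] using this) (by
      rintro _ ⟨y, hy, rfl⟩ _ ⟨y', hy', rfl⟩
      rw [hΔ4]
      have := hs y hy y' hy'
      have e : ((fun j : Fin n => (y - b) (Sum.inr j)) - fun j : Fin n => (y' - b) (Sum.inr j)) =
          fun j : Fin n => (y - y') (Sum.inr j) := by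
        funext j; simp
      rwa [e])
  refine (h1.add h2).mono ?_ (le_of_eq ?_)
  · rintro _ ⟨y, hy, rfl⟩
    refine ⟨_, ⟨fun i => (y - b) (Sum.inl i), ?_, rfl⟩, _, ⟨_, ⟨y, hy, rfl⟩, rfl⟩, ?_⟩
    · have k1 := (hY y hy).1
      have k2 := hb.1
      have k3 : ∑ i : Fin n, (y - b) (Sum.inl i) ^ 2 ≤
          ∑ i : Fin n, (2 * (y - v) (Sum.inl i) ^ 2 + 2 * (b - v) (Sum.inl i) ^ 2) := by
        refine Finset.sum_le_sum fun i _ => ?_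
        simp only [Pi.sub_apply]
        nlinarith [sq_nonneg ((y (Sum.inl i) - v (Sum.inl i)) + (b (Sum.inl i) - v (Sum.inl i)))]
      rw [Finset.sum_add_distrib, ← Finset.mul_sum, ← Finset.mul_sum] at k3
      simp only [Set.mem_ofPred_eq]
      linarith
    · funext k
      simp only [Pi.add_apply, Pi.mul_apply, tens, linForm, Fintype.sum_sum_type, mul_add]
  · rw [sideConst]
    have : Real.sqrt r * (h / r) = h / Real.sqrt r := by
      rw [← mul_div_assoc, div_eq_div_iff hr.ne' hsr.ne']
      linear_combination h * hsr2
    linear_combination (9 * Real.sqrt l1Const * W) * this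

/-- The constant in the chaining estimate. -/
noncomputable def chainConst : ℝ := 9 * Real.sqrt stepConst + 2 * sideConst

lemma sideConst_pos : 0 < sideConst := by
  unfold sideConst; positivity

lemma chainConst_pos : 0 < chainConst := by
  have := sideConst_pos
  unfold chainConst; positivity

/-- The conditional estimate, by chaining. -/
theorem radBound_tens {a : Fin n ⊕ Fin n → Fin n ⊕ Fin n → Fin n → ℝ} {p r h W : ℝ} (hp : 1 ≤ p)
    (hpr : p ≤ r) (hh : 0 < h) (hhH : h ^ 4 = totalSq a) (hW : 0 < W) {z : Fin n → ℝ}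
    (hWz : ∑ k, sliceSq a k * z k ^ 4 = W ^ 4)
    {P : Set ((Fin n ⊕ Fin n → ℝ) × (Fin n ⊕ Fin n → ℝ))} (hP : SmallRows a p r P)
    (hPd : SmallDiam a r P) :
    RadBound ((fun w => z * tens a w.1 w.2) '' P) (3 * (chainConst * (W * h / Real.sqrt r))) := by
  have hr1 : 1 ≤ r := by linarith
  have hr : 0 < r := by linarith
  have hsr := Real.sqrt_pos.2 hr
  have hH : 0 < totalSq a := by rw [← hhH]; positivity
  have hpow : ∀ m : ℕ, r ≤ (4 : ℝ) ^ m * r := fun m => by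
    have : (1 : ℝ) ≤ 4 ^ m := one_le_pow₀ (by norm_num)
    nlinarith
  have hswap : ∑ k, sliceSq (swapArray a) k * z k ^ 4 = W ^ 4 := by rwa [sliceSq_swap]
  have hdiam : ∀ (s : ℝ), 0 < s → ∀ Q, SmallDiam a s Q → ∀ t ∈ (fun w => z * tens a w.1 w.2) '' Q,
      ∀ t' ∈ (fun w => z * tens a w.1 w.2) '' Q, ∑ k, (t k - t' k) ^ 2 ≤ (W * h / s) ^ 2 := by
    rintro s hs Q hQ _ ⟨w, hw, rfl⟩ _ ⟨w', hw', rfl⟩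
    have e1 : ∀ k, (z * tens a w.1 w.2) k - (z * tens a w'.1 w'.2) k =
        z k * (tens a w.1 w.2 - tens a w'.1 w'.2) k := by
      intro k
      simp only [Pi.mul_apply, Pi.sub_apply]
      ring
    simp only [e1]
    refine (sum_sq_mul_tens_le a z _ fun k hk => ?_).trans ?_
    · simp [tens, linForm, contract, contract_eq_zero hk]
    · have e2 : Real.sqrt (W ^ 4) = W ^ 2 := by
        rw [show W ^ 4 = (W ^ 2) ^ 2 by ring]
        exact Real.sqrt_sq (by positivity)
      rw [hWz, e2, mul_div_assoc, mul_pow]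
      gcongr
      rw [← Real.sqrt_sq (sq_nonneg (h / s))]
      refine Real.sqrt_le_sqrt ((hQ w hw w' hw').trans (le_of_eq ?_))
      rw [← hhH]; ring
  refine radBound_of_geometric_chain (fun m => {T | ∃ Q : Set _, SmallRows a p (4 ^ m * r) Q ∧
      SmallDiam a (4 ^ m * r) Q ∧ T = (fun w => z * tens a w.1 w.2) '' Q})
    (R := Real.sqrt n * (W * h / r))
    (mul_pos chainConst_pos (by positivity)) ?_ ?_ _ ⟨P, by simpa using hP, by simpa using hPd, rfl⟩
  · rintro m _ ⟨Q, hQ, hQd, rfl⟩ e he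
    set s := (4 : ℝ) ^ m * r with hs
    have hs1 : 1 ≤ s := hr1.trans (hpow m)
    have hs0 : 0 < s := by linarith
    have hps : p ≤ s := hpr.trans (hpow m)
    obtain ⟨N, b, R, hN, hbQ, hQR, hRrows, hRdiam, hR2, hR1⟩ := exists_partition hp hps hH hQ
    obtain ⟨v, hv⟩ := hQ.translate
    have hRQ : ∀ l, R l ⊆ Q := fun l => by rw [hQR]; exact Set.subset_iUnion R l
    -- The tensor of w is that of b (a single point, cost 0), plus that of w - b (recursion), plus
    -- two linear terms bounded by `radBound_side`, the second via the swapped array.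
    have hpiece : ∀ l, RadBound ((fun w => z * tens a w.1 w.2) '' R l)
        (e + 2 * (sideConst * (W * h / Real.sqrt s))) := by
      intro l
      have k0 := he _ ⟨_, by
        rw [pow_succ', mul_assoc]; exact hRrows l, by rw [pow_succ', mul_assoc]; exact hRdiam l,
        rfl⟩
      have k1 := radBound_side hp hps hh hhH hW hWz (hQ.row _ (hbQ l)) (Y := Prod.snd '' R l)
        (v := v.2) (b := (b l).2) (by
          rintro _ ⟨w, hw, rfl⟩
          exact (hv w (hRQ l hw)).2) (hv _ (hbQ l)).2 (hR2 l)
      have k2 := radBound_side (a := swapArray a) hp hps hh (by rw [hhH, totalSq_swap]) hW hswap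
        (by rw [totalSq_swap]; exact hQ.col _ (hbQ l)) (Y := Prod.fst '' R l)
        (v := v.1) (b := (b l).1) (by
          rintro _ ⟨w, hw, rfl⟩
          exact (hv w (hRQ l hw)).1) (hv _ (hbQ l)).1 (hR1 l)
      refine (((radBound_singleton (z * tens a (b l).1 (b l).2)).add k0).add
        (k1.add k2)).mono ?_ (le_of_eq (by ring))
      rintro _ ⟨w, hw, rfl⟩
      refine ⟨_, ⟨_, rfl, _, ⟨_, ⟨w, hw, rfl⟩, rfl⟩, rfl⟩, _,
        ⟨_, ⟨_, ⟨w, hw, rfl⟩, rfl⟩, _, ⟨_, ⟨w, hw, rfl⟩, rfl⟩, rfl⟩, ?_⟩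
      simp only [tens_swap, Prod.fst_sub, Prod.snd_sub, tens_sub_left, tens_sub_right]
      ring
    have himg : (fun w => z * tens a w.1 w.2) '' Q =
        ⋃ l ∈ (Finset.univ : Finset (Fin N)), (fun w => z * tens a w.1 w.2) '' R l := by
      conv_lhs => rw [hQR]
      rw [Set.image_iUnion]
      simp
    -- Entropy stepConst·s against L² diameter Wh/s costs a multiple of Wh/√s, the same order as the
    -- linear terms; √s = 2^m √r makes the errors geometric.
    have hu := radBound_biUnion (Finset.univ : Finset (Fin N))
      (fun l => (fun w => z * tens a w.1 w.2) '' R l) (σ := W * h / s) (l := stepConst * s)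
      (by positivity) (mul_pos stepConst_pos hs0) (by simpa using hN) (fun l _ => hpiece l) (by
        rw [← himg]
        exact hdiam s hs0 Q hQd)
    rw [himg]
    refine hu.mono subset_rfl (le_of_eq ?_)
    have e1 : Real.sqrt s = 2 ^ m * Real.sqrt r := by
      rw [hs, Real.sqrt_mul (by positivity)]
      congr 1
      rw [show (4 : ℝ) ^ m = (2 ^ m) ^ 2 by rw [← pow_mul, mul_comm, pow_mul]; norm_num]
      exact Real.sqrt_sq (by positivity)
    have e2 : Real.sqrt s * (W * h / s) = W * h / Real.sqrt s := by
      have hss := Real.sqrt_pos.2 hs0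
      rw [← mul_div_assoc, div_eq_div_iff hs0.ne' hss.ne']
      linear_combination (W * h) * Real.sq_sqrt hs0.le
    have e3 : W * h / Real.sqrt s = W * h / Real.sqrt r * (1 / 2) ^ m := by
      rw [e1, one_div, inv_pow]
      field_simp
    rw [Real.sqrt_mul stepConst_pos.le, chainConst, mul_assoc, mul_assoc, e2, e3]
    ring
  · rintro m _ ⟨Q, -, hQd, rfl⟩
    have hs0 : 0 < (4 : ℝ) ^ m * r := by linarith [hpow m]
    refine (radBound_of_diam (by positivity) (hdiam _ hs0 Q hQd)).mono subset_rfl (le_of_eq ?_)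
    rw [one_div, inv_pow]
    field_simp

end Bilinear

/-! ### From the Minkowski sum to the lifted product. -/

section Lift

variable {n : ℕ}

/-- The array indexed by two copies of the index set. -/
def liftArray (a : Fin n → Fin n → Fin n → ℝ) : Fin n ⊕ Fin n → Fin n ⊕ Fin n → Fin n → ℝ :=
  fun i j k => a (Sum.elim id id i) (Sum.elim id id j) k

/-- The sum of the two components of a lifted vector. -/
def foldVec (x : Fin n ⊕ Fin n → ℝ) : Fin n → ℝ := fun i => x (Sum.inl i) + x (Sum.inr i)

/-- The coefficients of the linear form `z ↦ trilinForm a x y z`. -/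
def coeffVec (a : Fin n → Fin n → Fin n → ℝ) (w : (Fin n → ℝ) × (Fin n → ℝ)) : Fin n → ℝ :=
  fun k => ∑ i, ∑ j, a i j k * w.1 i * w.2 j

lemma sum_rotate (f : Fin n → Fin n → Fin n → ℝ) :
    ∑ k, ∑ i, ∑ j, f i j k = ∑ i, ∑ j, ∑ k, f i j k := by
  rw [Finset.sum_comm]
  exact Finset.sum_congr rfl fun i _ => Finset.sum_comm

lemma trilinForm_eq (a : Fin n → Fin n → Fin n → ℝ) (w : (Fin n → ℝ) × (Fin n → ℝ))
    (z : Fin n → ℝ) : trilinForm a w.1 w.2 z = ∑ k, coeffVec a w k * z k := by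
  simp only [trilinForm, coeffVec, Finset.sum_mul]
  exact (sum_rotate fun i j k => a i j k * w.1 i * w.2 j * z k).symm

lemma tens_liftArray (a : Fin n → Fin n → Fin n → ℝ) (x y : Fin n ⊕ Fin n → ℝ) :
    tens (liftArray a) x y = coeffVec a (foldVec x, foldVec y) := by
  funext k
  rw [tens_apply]
  simp only [coeffVec, foldVec, Fintype.sum_sum_type, liftArray, Sum.elim_inl, Sum.elim_inr, id,
    ← Finset.sum_add_distrib]
  refine Finset.sum_congr rfl fun i _ => Finset.sum_congr rfl fun j _ => by ring

/-- Every entry occurs four times in the doubled array; this 4 is later absorbed as (√2)⁴. -/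
lemma sliceSq_liftArray (a : Fin n → Fin n → Fin n → ℝ) (k : Fin n) :
    sliceSq (liftArray a) k = 4 * ∑ i, ∑ j, a i j k ^ 2 := by
  simp only [sliceSq, Fintype.sum_sum_type, liftArray, Sum.elim_inl, Sum.elim_inr, id,
    Finset.mul_sum, ← Finset.sum_add_distrib]
  refine Finset.sum_congr rfl fun i _ => Finset.sum_congr rfl fun j _ => by ring

lemma totalSq_liftArray (a : Fin n → Fin n → Fin n → ℝ) :
    totalSq (liftArray a) = 4 * sumSq a := by
  simp only [totalSq, sliceSq_liftArray, ← Finset.mul_sum]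
  rw [sum_rotate (fun i j k => a i j k ^ 2), sumSq]

lemma sum_sliceSq_liftArray (a : Fin n → Fin n → Fin n → ℝ) (z : Fin n → ℝ) :
    ∑ k, sliceSq (liftArray a) k * z k ^ 4 = 4 * weightedSumSq a z := by
  simp only [sliceSq_liftArray, weightedSumSq, mul_assoc, ← Finset.mul_sum]
  congr 1
  rw [← sum_rotate (fun i j k => a i j k ^ 2 * z k ^ 4)]
  simp only [Finset.sum_mul]

lemma mem_lpUnitBall_two {x : Fin n → ℝ} : x ∈ lpUnitBall 2 n ↔ ∑ i, x i ^ 2 ≤ 1 := by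
  simp only [lpUnitBall, Set.mem_ofPred_eq]
  rw [← sq_le_one_iff₀ (norm_nonneg _), EuclideanSpace.real_norm_sq_eq]

lemma mem_lpUnitBall_one {x : Fin n → ℝ} : x ∈ lpUnitBall 1 n ↔ ∑ i, |x i| ≤ 1 := by
  simp only [lpUnitBall, Set.mem_ofPred_eq]
  rw [PiLp.norm_eq_of_L1]
  simp

lemma mem_mixedBall_iff {p : ℝ} (hp : 0 < p) {x : Fin n → ℝ} :
    x ∈ mixedBall p n ↔ ∃ u ∈ liftBall p n, foldVec u = x := by
  have hsp := Real.sqrt_pos.2 hp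
  constructor
  · rintro ⟨u, hu, _, ⟨w, hw, rfl⟩, rfl⟩
    refine ⟨Sum.elim u (Real.sqrt p • w), ⟨?_, ?_⟩, ?_⟩
    · simpa using mem_lpUnitBall_two.1 hu
    · have := mem_lpUnitBall_one.1 hw
      simp only [Sum.elim_inr, Pi.smul_apply, smul_eq_mul, abs_mul, abs_of_pos hsp,
        ← Finset.mul_sum]
      exact mul_le_of_le_one_right hsp.le this
    · funext i; simp [foldVec]
  · rintro ⟨u, ⟨hu1, hu2⟩, rfl⟩
    refine ⟨fun i => u (Sum.inl i), mem_lpUnitBall_two.2 hu1, fun i => u (Sum.inr i),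
      ⟨fun i => (Real.sqrt p)⁻¹ * u (Sum.inr i), mem_lpUnitBall_one.2 ?_, ?_⟩, rfl⟩
    · simp only [abs_mul, abs_of_pos (inv_pos.2 hsp), ← Finset.mul_sum]
      rw [inv_mul_le_iff₀ hsp]
      simpa using hu2
    · funext i
      simp only [Pi.smul_apply, smul_eq_mul]
      field_simp

lemma abs_le_of_mem_liftBall {p : ℝ} {x : Fin n ⊕ Fin n → ℝ} (hx : x ∈ liftBall p n)
    (i : Fin n) : |foldVec x i| ≤ 1 + Real.sqrt p := by
  have h1 : x (Sum.inl i) ^ 2 ≤ 1 :=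
    (Finset.single_le_sum (f := fun i => x (Sum.inl i) ^ 2) (fun i _ => sq_nonneg _)
      (Finset.mem_univ i)).trans hx.1
  have h2 : |x (Sum.inr i)| ≤ Real.sqrt p :=
    (Finset.single_le_sum (f := fun i => |x (Sum.inr i)|) (fun i _ => abs_nonneg _)
      (Finset.mem_univ i)).trans hx.2
  have h3 : |x (Sum.inl i)| ≤ 1 := by rwa [← sq_le_one_iff_abs_le_one]
  exact (abs_add_le _ _).trans (add_le_add h3 h2)

lemma foldVec_sub (x y : Fin n ⊕ Fin n → ℝ) : foldVec (x - y) = foldVec x - foldVec y := by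
  funext i; simp only [foldVec, Pi.sub_apply]; ring

/-- The entropy constant of the final covering. -/
noncomputable def coverConst : ℝ := 18 / coverScale (1 / 16) ^ 2 + 2 + stepConst

lemma coverConst_pos : 0 < coverConst := by
  have := coverScale_pos (δ := 1 / 16) (by norm_num)
  have := stepConst_pos
  unfold coverConst; positivity

/-- The partition of the lifted set. -/
theorem exists_lift_partition {a : Fin n ⊕ Fin n → Fin n ⊕ Fin n → Fin n → ℝ} {p : ℝ}
    (hp : 1 ≤ p) (hH : 0 < totalSq a) :
    ∃ (N : ℕ) (b : Fin N → (Fin n ⊕ Fin n → ℝ) × (Fin n ⊕ Fin n → ℝ))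
      (R : Fin N → Set ((Fin n ⊕ Fin n → ℝ) × (Fin n ⊕ Fin n → ℝ))),
      (N : ℝ) ≤ Real.exp (coverConst * p) ∧ (∀ l, b l ∈ liftBall p n ×ˢ liftBall p n) ∧
      liftBall p n ×ˢ liftBall p n = ⋃ l, R l ∧
      (∀ l, SmallRows a p (4 * p) ((fun w => w - b l) '' R l)) ∧
      (∀ l, SmallDiam a (4 * p) ((fun w => w - b l) '' R l)) := by
  classical
  have hp0 : 0 < p := by linarith
  have hzero : ∀ x ∈ liftBall p n, x - (0 : Fin n ⊕ Fin n → ℝ) ∈ liftBall p n := fun x hx => by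
    rwa [sub_zero]
  -- The partitioning step presupposes small rows and columns, so the lifted ball is first cut by a
  -- row cover and a column cover at scale p; 16·(1/16) = 1 gives exactly the required size.
  obtain ⟨F₁, -, hc₁, hF₁⟩ := exists_rowCover a (δ := 1 / 16) (by norm_num) (by norm_num) hp0
    le_rfl hH hzero
  obtain ⟨F₂, -, hc₂, hF₂⟩ := exists_rowCover (swapArray a) (δ := 1 / 16) (by norm_num)
    (by norm_num) hp0 le_rfl (by rwa [totalSq_swap]) hzero
  rw [totalSq_swap] at hF₂
  set P : (Fin n ⊕ Fin n → ℝ) × (Fin n ⊕ Fin n → ℝ) →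
      Set ((Fin n ⊕ Fin n → ℝ) × (Fin n ⊕ Fin n → ℝ)) := fun c =>
    {w | w + c ∈ liftBall p n ×ˢ liftBall p n ∧ rowForm a w.1 ≤ totalSq a / p ^ 2 ∧
      rowForm (swapArray a) w.2 ≤ totalSq a / p ^ 2} with hPdef
  have hP : ∀ c, SmallRows a p p (P c) := fun c =>
    ⟨⟨-c, fun w hw => by
      simp only [Prod.fst_neg, Prod.snd_neg, sub_neg_eq_add]
      exact ⟨hw.1.1, hw.1.2⟩⟩, fun w hw => hw.2.1, fun w hw => hw.2.2⟩
  choose N b R hN hb hR hrows hdiam _ _ using fun c => exists_partition hp le_rfl hH (hP c)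
  set S := (F₁ ×ˢ F₂).sigma fun c => (Finset.univ : Finset (Fin (N c))) with hS
  refine ⟨S.card, fun l => (S.equivFin.symm l).1.1 + b _ (S.equivFin.symm l).1.2,
    fun l => (fun w => (S.equivFin.symm l).1.1 + w) '' R _ (S.equivFin.symm l).1.2,
    ?_, ?_, ?_, ?_, ?_⟩
  · have h1 : (S.card : ℝ) ≤ ((F₁ ×ˢ F₂).card : ℝ) * Real.exp (stepConst * p) := by
      rw [hS, Finset.card_sigma]
      push_cast
      rw [← nsmul_eq_mul]
      refine Finset.sum_le_card_nsmul _ _ _ fun c _ => ?_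
      rw [Finset.card_univ, Fintype.card_fin]
      exact hN c
    rw [Finset.card_product] at h1
    push_cast at h1
    calc (S.card : ℝ) ≤ ((2 * Real.exp (9 * p / coverScale (1 / 16) ^ 2)) *
          (2 * Real.exp (9 * p / coverScale (1 / 16) ^ 2))) * Real.exp (stepConst * p) :=
          h1.trans (by gcongr)
      _ ≤ ((Real.exp p * Real.exp (9 * p / coverScale (1 / 16) ^ 2)) *
          (Real.exp p * Real.exp (9 * p / coverScale (1 / 16) ^ 2))) *
          Real.exp (stepConst * p) := by
          have := two_le_exp hp
          gcongr
      _ = Real.exp (coverConst * p) := by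
          simp only [← Real.exp_add, coverConst]
          ring_nf
  · intro l
    have := (hb _ (S.equivFin.symm l).1.2).1
    rwa [add_comm] at this
  · ext w
    simp only [Set.mem_iUnion]
    constructor
    · intro hw
      obtain ⟨c₁, hc₁, h₁⟩ := hF₁ w.1 hw.1
      obtain ⟨c₂, hc₂, h₂⟩ := hF₂ w.2 hw.2
      have hmem : w - (c₁, c₂) ∈ P (c₁, c₂) := by
        refine ⟨by rwa [sub_add_cancel], ?_, ?_⟩
        · refine h₁.trans (le_of_eq ?_); ring
        · refine h₂.trans (le_of_eq ?_); ring
      rw [hR (c₁, c₂)] at hmem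
      obtain ⟨l, hl⟩ := Set.mem_iUnion.1 hmem
      have hS' : (⟨(c₁, c₂), l⟩ : Σ c, Fin (N c)) ∈ S :=
        Finset.mem_sigma.2 ⟨Finset.mem_product.2 ⟨hc₁, hc₂⟩, Finset.mem_univ _⟩
      refine ⟨S.equivFin ⟨_, hS'⟩, ?_⟩
      rw [Equiv.symm_apply_apply]
      exact ⟨_, hl, by simp⟩
    · rintro ⟨l, w', hw', rfl⟩
      have : w' ∈ P (S.equivFin.symm l).1.1 := by
        rw [hR]
        exact Set.mem_iUnion.2 ⟨_, hw'⟩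
      have := this.1
      rwa [add_comm] at this
  · intro l
    have := hrows _ (S.equivFin.symm l).1.2
    rw [Set.image_image]
    simpa only [add_sub_add_left_eq_sub] using this
  · intro l
    have := hdiam _ (S.equivFin.symm l).1.2
    rw [Set.image_image]
    simpa only [add_sub_add_left_eq_sub] using this

lemma sumSq_nonneg (a : Fin n → Fin n → Fin n → ℝ) : 0 ≤ sumSq a :=
  Finset.sum_nonneg fun _ _ => Finset.sum_nonneg fun _ _ => Finset.sum_nonneg fun _ _ =>
    sq_nonneg _

lemma weightedSumSq_nonneg (a : Fin n → Fin n → Fin n → ℝ) (z : Fin n → ℝ) :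
    0 ≤ weightedSumSq a z :=
  Finset.sum_nonneg fun _ _ => Finset.sum_nonneg fun _ _ => Finset.sum_nonneg fun _ _ => by
    positivity

lemma mul_eq_zero_of_weightedSumSq {a : Fin n → Fin n → Fin n → ℝ} {z : Fin n → ℝ}
    (h : weightedSumSq a z = 0) (i j k : Fin n) : z k * a i j k = 0 := by
  have h1 := (Finset.sum_eq_zero_iff_of_nonneg fun i _ => Finset.sum_nonneg fun j _ =>
    Finset.sum_nonneg fun k _ => by positivity).1 h i (Finset.mem_univ i)
  have h2 := (Finset.sum_eq_zero_iff_of_nonneg fun j _ =>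
    Finset.sum_nonneg fun k _ => by positivity).1 h1 j (Finset.mem_univ j)
  have h3 := (Finset.sum_eq_zero_iff_of_nonneg fun k _ => by positivity).1 h2 k
    (Finset.mem_univ k)
  rcases mul_eq_zero.1 h3 with h4 | h4
  · simp [pow_eq_zero_iff (two_ne_zero) |>.1 h4]
  · simp [pow_eq_zero_iff (four_ne_zero) |>.1 h4]

lemma radBound_of_weightedSumSq_eq_zero {a : Fin n → Fin n → Fin n → ℝ} {z : Fin n → ℝ}
    (h : weightedSumSq a z = 0) (T : Set ((Fin n → ℝ) × (Fin n → ℝ))) :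
    RadBound ((fun w => z * coeffVec a w) '' T) 0 := by
  refine (radBound_singleton (0 : Fin n → ℝ)).mono ?_ le_rfl
  rintro _ ⟨w, -, rfl⟩
  refine Set.mem_singleton_iff.2 (funext fun k => ?_)
  simp only [Pi.mul_apply, coeffVec, Finset.mul_sum, Pi.zero_apply]
  refine Finset.sum_eq_zero fun i _ => Finset.sum_eq_zero fun j _ => ?_
  rw [← mul_assoc, ← mul_assoc, mul_eq_zero_of_weightedSumSq h, zero_mul, zero_mul]

lemma rpow_quarter_pow_four {x : ℝ} (hx : 0 ≤ x) : (x ^ (1 / 4 : ℝ)) ^ 4 = x := by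
  rw [← Real.rpow_natCast, ← Real.rpow_mul hx]
  norm_num

/-- The partition of `mixedBall`, with the conditional estimate. -/
theorem exists_mixedBall_partition (a : Fin n → Fin n → Fin n → ℝ) {p : ℝ} (hp : 1 ≤ p) :
    ∃ (N : ℕ) (v : Fin N → (Fin n → ℝ) × (Fin n → ℝ))
      (T : Fin N → Set ((Fin n → ℝ) × (Fin n → ℝ))) (M : ℝ),
      (N : ℝ) ≤ Real.exp (coverConst * p) ∧ (∀ l, v l ∈ mixedBall p n ×ˢ mixedBall p n) ∧
      mixedBall p n ×ˢ mixedBall p n = ⋃ l, (fun w => v l + w) '' T l ∧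
      (∀ l, ∀ w ∈ T l, ∀ k, |coeffVec a w k| ≤ M) ∧
      ∀ l z, RadBound ((fun w => z * coeffVec a w) '' T l)
        (3 * chainConst / Real.sqrt p * sumSq a ^ (1 / 4 : ℝ) *
          weightedSumSq a z ^ (1 / 4 : ℝ)) := by
  have hp0 : 0 < p := by linarith
  have hsp := Real.sqrt_pos.2 hp0
  have hcc := chainConst_pos
  -- A uniform entry bound of any size: it makes the suprema finite and integrable but does not
  -- enter the estimate.
  have hbddcoeff : ∀ (B : ℝ), ∃ M, ∀ w : (Fin n → ℝ) × (Fin n → ℝ), (∀ i, |w.1 i| ≤ B) →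
      (∀ i, |w.2 i| ≤ B) → ∀ k, |coeffVec a w k| ≤ M := by
    intro B
    refine ⟨∑ k, ∑ i, ∑ j, |a i j k| * B * B, fun w h1 h2 k => ?_⟩
    have hle : |coeffVec a w k| ≤ ∑ i, ∑ j, |a i j k| * B * B := by
      refine (Finset.abs_sum_le_sum_abs _ _).trans (Finset.sum_le_sum fun i _ => ?_)
      refine (Finset.abs_sum_le_sum_abs _ _).trans (Finset.sum_le_sum fun j _ => ?_)
      rw [abs_mul, abs_mul]
      have hB : 0 ≤ B := (abs_nonneg _).trans (h1 i)
      gcongr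
      · exact h1 i
      · exact h2 j
    refine hle.trans (Finset.single_le_sum (f := fun k => ∑ i, ∑ j, |a i j k| * B * B)
      (fun k _ => Finset.sum_nonneg fun i _ => Finset.sum_nonneg fun j _ => ?_)
      (Finset.mem_univ k))
    rw [mul_assoc]
    exact mul_nonneg (abs_nonneg _) (mul_self_nonneg B)
  have hmb : ∀ x ∈ mixedBall p n, ∀ i, |x i| ≤ 1 + Real.sqrt p := by
    intro x hx i
    obtain ⟨u, hu, rfl⟩ := (mem_mixedBall_iff hp0).1 hx
    exact abs_le_of_mem_liftBall hu i
  -- The covers need a positive total sum of squares. For the zero array a single piece suffices,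
  -- all forms being 0.
  rcases (sumSq_nonneg a).eq_or_lt with h0 | hpos
  · obtain ⟨M, hM⟩ := hbddcoeff (1 + Real.sqrt p)
    refine ⟨1, fun _ => 0, fun _ => mixedBall p n ×ˢ mixedBall p n, M, ?_, ?_, ?_, ?_, ?_⟩
    · have := mul_pos coverConst_pos hp0
      simpa using this.le
    · have : (0 : Fin n → ℝ) ∈ mixedBall p n :=
        (mem_mixedBall_iff hp0).2 ⟨0, by simp [liftBall], by funext i; simp [foldVec]⟩
      exact fun _ => ⟨this, this⟩
    · simp only [zero_add, Set.image_id', Set.iUnion_const]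
    · exact fun _ w hw => hM w (hmb _ hw.1) (hmb _ hw.2)
    · intro l z
      have hw0 : weightedSumSq a z = 0 := by
        have h1 : ∀ i j k, a i j k ^ 2 = 0 := fun i j k => by
          have h1 := (Finset.sum_eq_zero_iff_of_nonneg fun i _ => Finset.sum_nonneg fun j _ =>
            Finset.sum_nonneg fun k _ => by positivity).1 h0.symm i (Finset.mem_univ i)
          have h2 := (Finset.sum_eq_zero_iff_of_nonneg fun j _ =>
            Finset.sum_nonneg fun k _ => by positivity).1 h1 j (Finset.mem_univ j)
          exact (Finset.sum_eq_zero_iff_of_nonneg fun k _ => by positivity).1 h2 k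
            (Finset.mem_univ k)
        simp [weightedSumSq, h1]
      refine (radBound_of_weightedSumSq_eq_zero hw0 _).mono subset_rfl ?_
      have := Real.rpow_nonneg (sumSq_nonneg a) (1 / 4 : ℝ)
      have := Real.rpow_nonneg (weightedSumSq_nonneg a z) (1 / 4 : ℝ)
      positivity
  · have hH : 0 < totalSq (liftArray a) := by rw [totalSq_liftArray]; positivity
    obtain ⟨N, b, R, hN, hb, hR, hrows, hdiam⟩ := exists_lift_partition hp hH
    obtain ⟨M, hM⟩ := hbddcoeff (2 * (1 + Real.sqrt p))
    have hRb : ∀ l, ∀ w ∈ R l, w.1 ∈ liftBall p n ∧ w.2 ∈ liftBall p n := fun l w hw => by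
      have : w ∈ liftBall p n ×ˢ liftBall p n := by rw [hR]; exact Set.mem_iUnion.2 ⟨l, hw⟩
      exact this
    have habs : ∀ u ∈ liftBall p n, ∀ u' ∈ liftBall p n, ∀ i,
        |foldVec (u - u') i| ≤ 2 * (1 + Real.sqrt p) := by
      intro u hu u' hu' i
      rw [foldVec_sub, Pi.sub_apply, two_mul]
      exact (abs_sub _ _).trans (add_le_add (abs_le_of_mem_liftBall hu i)
        (abs_le_of_mem_liftBall hu' i))
    refine ⟨N, fun l => (foldVec (b l).1, foldVec (b l).2),
      fun l => (fun w => (foldVec (w.1 - (b l).1), foldVec (w.2 - (b l).2))) '' R l, M, hN,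
      ?_, ?_, ?_, ?_⟩
    · intro l
      exact ⟨(mem_mixedBall_iff hp0).2 ⟨_, (hb l).1, rfl⟩,
        (mem_mixedBall_iff hp0).2 ⟨_, (hb l).2, rfl⟩⟩
    · have e : ∀ l, (fun w => (foldVec (b l).1, foldVec (b l).2) + w) ''
          ((fun w : (Fin n ⊕ Fin n → ℝ) × (Fin n ⊕ Fin n → ℝ) =>
            (foldVec (w.1 - (b l).1), foldVec (w.2 - (b l).2))) '' R l) =
          (fun w => (foldVec w.1, foldVec w.2)) '' R l := by
        intro l
        rw [Set.image_image]
        refine Set.image_congr fun w _ => ?_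
        simp [foldVec_sub]
      simp only [e]
      rw [← Set.image_iUnion, ← hR]
      ext x
      simp only [Set.mem_prod, mem_mixedBall_iff hp0, Set.mem_image, Prod.exists, Prod.ext_iff]
      constructor
      · rintro ⟨⟨u, hu, h1⟩, u', hu', h2⟩
        exact ⟨u, u', ⟨hu, hu'⟩, h1, h2⟩
      · rintro ⟨u, u', ⟨hu, hu'⟩, h1, h2⟩
        exact ⟨⟨u, hu, h1⟩, u', hu', h2⟩
    · rintro l _ ⟨w, hw, rfl⟩
      exact hM _ (habs _ (hRb l w hw).1 _ (hb l).1) (habs _ (hRb l w hw).2 _ (hb l).2)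
    · intro l z
      rcases (weightedSumSq_nonneg a z).eq_or_lt with hz | hz
      · refine (radBound_of_weightedSumSq_eq_zero hz.symm _).mono subset_rfl ?_
        have := Real.rpow_nonneg (sumSq_nonneg a) (1 / 4 : ℝ)
        have := Real.rpow_nonneg (weightedSumSq_nonneg a z) (1 / 4 : ℝ)
        positivity
      · set s : ℝ := sumSq a ^ (1 / 4 : ℝ) with hs
        set t : ℝ := weightedSumSq a z ^ (1 / 4 : ℝ) with ht
        have hspos : 0 < s := Real.rpow_pos_of_pos hpos _
        have htpos : 0 < t := Real.rpow_pos_of_pos hz _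
        have hs4 : s ^ 4 = sumSq a := rpow_quarter_pow_four hpos.le
        have ht4 : t ^ 4 = weightedSumSq a z := rpow_quarter_pow_four hz.le
        have h24 : Real.sqrt 2 ^ 4 = 4 := by
          rw [show Real.sqrt 2 ^ 4 = (Real.sqrt 2 ^ 2) ^ 2 by ring, Real.sq_sqrt (by norm_num)]
          norm_num
        have hs2 : 0 < Real.sqrt 2 := Real.sqrt_pos.2 (by norm_num)
        -- The doubled array multiplies both quartic quantities by 4, hence the factors √2 on h and
        -- W; their product 2 cancels against √(4p) = 2√p.
        have key := radBound_tens (a := liftArray a) (p := p) (r := 4 * p) (h := Real.sqrt 2 * s)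
          (W := Real.sqrt 2 * t) (z := z) hp (by linarith) (by positivity)
          (by rw [totalSq_liftArray, mul_pow, h24, hs4]) (by positivity)
          (by rw [sum_sliceSq_liftArray, mul_pow, h24, ht4]) (hrows l) (hdiam l)
        refine key.mono ?_ (le_of_eq ?_)
        · rintro _ ⟨_, ⟨w, hw, rfl⟩, rfl⟩
          refine ⟨_, ⟨w, hw, rfl⟩, ?_⟩
          simp only [tens_liftArray, Prod.fst_sub, Prod.snd_sub]
        · have e1 : Real.sqrt (4 * p) = 2 * Real.sqrt p := by
            rw [Real.sqrt_mul (by norm_num), show (4 : ℝ) = 2 ^ 2 by norm_num,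
              Real.sqrt_sq (by norm_num)]
          have e2 : Real.sqrt 2 * Real.sqrt 2 = 2 := Real.mul_self_sqrt (by norm_num)
          rw [e1]
          field_simp
          linear_combination e2

end Lift

/-! ### Support functions and symmetrization. -/

section Symmetrization

variable {n : ℕ}

/-- The support function of a set of vectors. -/
noncomputable def supForm (S : Set (Fin n → ℝ)) (z : Fin n → ℝ) : ℝ :=
  ⨆ t : S, ∑ k, (t : Fin n → ℝ) k * z k

/-- All entries of the vectors in `S` are bounded by `M`. -/
def EntryBounded (S : Set (Fin n → ℝ)) (M : ℝ) : Prop := ∀ t ∈ S, ∀ k, |t k| ≤ M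

variable {S : Set (Fin n → ℝ)} {M : ℝ}

lemma EntryBounded.abs_sum_le (hS : EntryBounded S M) {t : Fin n → ℝ} (ht : t ∈ S)
    (z : Fin n → ℝ) : |∑ k, t k * z k| ≤ M * ∑ k, |z k| := by
  rw [Finset.mul_sum]
  refine (Finset.abs_sum_le_sum_abs _ _).trans (Finset.sum_le_sum fun k _ => ?_)
  rw [abs_mul]
  exact mul_le_mul_of_nonneg_right (hS t ht k) (abs_nonneg _)

lemma EntryBounded.bddAbove (hS : EntryBounded S M) (z : Fin n → ℝ) :
    BddAbove (Set.range fun t : S => ∑ k, (t : Fin n → ℝ) k * z k) := by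
  refine ⟨M * ∑ k, |z k|, ?_⟩
  rintro _ ⟨t, rfl⟩
  exact (le_abs_self _).trans (hS.abs_sum_le t.2 z)

lemma EntryBounded.le_supForm (hS : EntryBounded S M) {t : Fin n → ℝ} (ht : t ∈ S)
    (z : Fin n → ℝ) : ∑ k, t k * z k ≤ supForm S z :=
  le_ciSup (hS.bddAbove z) ⟨t, ht⟩

lemma supForm_le (hne : S.Nonempty) {z : Fin n → ℝ} {c : ℝ}
    (h : ∀ t ∈ S, ∑ k, t k * z k ≤ c) : supForm S z ≤ c := by
  have := hne.to_subtype
  exact ciSup_le fun t => h t t.2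

lemma EntryBounded.supForm_add_le (hS : EntryBounded S M) (hne : S.Nonempty)
    (z z' : Fin n → ℝ) : supForm S (z + z') ≤ supForm S z + supForm S z' := by
  refine supForm_le hne fun t ht => ?_
  have e : ∑ k, t k * (z + z') k = ∑ k, t k * z k + ∑ k, t k * z' k := by
    simp [mul_add, Finset.sum_add_distrib]
  rw [e]
  exact add_le_add (hS.le_supForm ht z) (hS.le_supForm ht z')

lemma EntryBounded.abs_supForm_le (hS : EntryBounded S M) (hne : S.Nonempty)
    (z : Fin n → ℝ) : |supForm S z| ≤ M * ∑ k, |z k| := by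
  obtain ⟨t, ht⟩ := hne
  exact abs_le.2 ⟨(abs_le.1 (hS.abs_sum_le ht z)).1.trans (hS.le_supForm ht z),
    supForm_le ⟨t, ht⟩ fun t ht => (abs_le.1 (hS.abs_sum_le ht z)).2⟩

/-- Subadditivity and the linear growth bound make the support function Lipschitz; continuity
settles all measurability questions. -/
lemma EntryBounded.continuous_supForm (hS : EntryBounded S M) (hne : S.Nonempty) :
    Continuous (supForm S) := by
  have h1 : ∀ z z' : Fin n → ℝ, supForm S z - supForm S z' ≤ M * ∑ k, |z k - z' k| := by
    intro z z'
    have h := hS.supForm_add_le hne (z - z') z'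
    rw [sub_add_cancel] at h
    have h2 := (le_abs_self _).trans (hS.abs_supForm_le hne (z - z'))
    simp only [Pi.sub_apply] at h2
    linarith
  refine continuous_iff_continuousAt.2 fun z₀ => ?_
  refine tendsto_iff_dist_tendsto_zero.2 ?_
  have hc : Continuous fun z : Fin n → ℝ => M * ∑ k, |z k - z₀ k| := by fun_prop
  have h0 := hc.tendsto z₀
  simp only [sub_self, abs_zero, Finset.sum_const_zero, mul_zero] at h0
  refine squeeze_zero (fun _ => dist_nonneg) (fun z => ?_) h0
  rw [Real.dist_eq, abs_le]
  have h2 := h1 z₀ z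
  simp only [abs_sub_comm (z₀ _)] at h2
  exact ⟨by linarith, h1 z z₀⟩

/-- Composition of the support function with an integrable random vector. -/
lemma EntryBounded.integrable_supForm {Ω : Type*} [MeasurableSpace Ω] {μ : Measure Ω}
    (hS : EntryBounded S M) (hne : S.Nonempty) {X : Ω → Fin n → ℝ}
    (hX : ∀ k, Integrable (fun ω => X ω k) μ) : Integrable (fun ω => supForm S (X ω)) μ := by
  have hb : Integrable (fun ω => M * ∑ k, |X ω k|) μ :=
    (integrable_finsetSum _ fun k _ => (hX k).abs).const_mul M
  refine hb.mono' ?_ (Filter.Eventually.of_forall fun ω => hS.abs_supForm_le hne _)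
  exact (hS.continuous_supForm hne).comp_aestronglyMeasurable
    (aemeasurable_pi_lambda _ fun k => (hX k).aemeasurable).aestronglyMeasurable

lemma signAvg_comp_not (f : (Fin n → Bool) → ℝ) :
    signAvg (fun ε => f fun k => !ε k) = signAvg f := by
  unfold signAvg
  congr 1
  exact Fintype.sum_equiv (Equiv.piCongrRight fun _ => Equiv.boolNot) _ _ fun ε => rfl

/-- A Rademacher bound controls the averages of the support function. -/
lemma signAvg_supForm_le (hne : S.Nonempty) {z : Fin n → ℝ} {c : ℝ}
    (h : RadBound ((fun t => z * t) '' S) c) :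
    signAvg (fun ε => supForm S (signVec ε * z)) ≤ c := by
  obtain ⟨g, hg, hc⟩ := h
  refine (signAvg_mono fun ε => supForm_le hne fun t ht => ?_).trans hc
  refine le_trans (le_of_eq ?_) (hg ε _ ⟨t, ht, rfl⟩)
  simp only [signForm, signVec, Pi.mul_apply]
  exact Finset.sum_congr rfl fun k _ => by ring

/-- Exchanging the two copies of a product measure in a set of coordinates. -/
lemma measurePreserving_swapCoords (ν : Fin n → Measure ℝ) [∀ k, IsProbabilityMeasure (ν k)]
    (ε : Fin n → Bool) :
    MeasurePreserving (fun q : (Fin n → ℝ) × (Fin n → ℝ) =>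
      ((fun k => if ε k then q.1 k else q.2 k), fun k => if ε k then q.2 k else q.1 k))
      ((Measure.pi ν).prod (Measure.pi ν)) ((Measure.pi ν).prod (Measure.pi ν)) := by
  have he := measurePreserving_arrowProdEquivProdArrow ℝ ℝ (Fin n) ν ν
  have hm := measurePreserving_pi (fun k => (ν k).prod (ν k)) (fun k => (ν k).prod (ν k))
    (f := fun k => if ε k then id else Prod.swap) fun k => by
      by_cases h : ε k
      · simpa [h] using MeasurePreserving.id _
      · simpa [h] using Measure.measurePreserving_swap
  convert he.comp (hm.comp (he.symm _)) using 1
  funext q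
  refine Prod.ext (funext fun k => ?_) (funext fun k => ?_) <;> cases h : ε k <;>
    simp [MeasurableEquiv.arrowProdEquivProdArrow, Equiv.arrowProdEquivProdArrow, h]

/-- Symmetrization for the support function of a bounded set. -/
theorem integral_supForm_le (ν : Fin n → Measure ℝ) [∀ k, IsProbabilityMeasure (ν k)]
    (hint : ∀ k, Integrable (fun z : Fin n → ℝ => z k) (Measure.pi ν))
    (hmean : ∀ k, ∫ z, z k ∂(Measure.pi ν) = 0) (hS : EntryBounded S M) (hne : S.Nonempty)
    {f : (Fin n → ℝ) → ℝ} (hf : Integrable f (Measure.pi ν))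
    (hRad : ∀ z, RadBound ((fun t => z * t) '' S) (f z)) :
    ∫ z, supForm S z ∂(Measure.pi ν) ≤ 2 * ∫ z, f z ∂(Measure.pi ν) := by
  set P := Measure.pi ν with hP
  have hX : ∀ (ε : Fin n → Bool) (k : Fin n), Integrable
      (fun q : (Fin n → ℝ) × (Fin n → ℝ) => (signVec ε * (q.1 - q.2)) k) (P.prod P) := by
    intro ε k
    have h1 := ((hint k).comp_fst P).sub ((hint k).comp_snd P)
    exact h1.const_mul (signVal (ε k))
  have hX1 : ∀ k, Integrable (fun q : (Fin n → ℝ) × (Fin n → ℝ) => (q.1 - q.2) k)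
      (P.prod P) := fun k => ((hint k).comp_fst P).sub ((hint k).comp_snd P)
  have hX2 : ∀ (z : Fin n → ℝ) k, Integrable (fun z' : Fin n → ℝ => (z - z') k) P :=
    fun z k => (integrable_const (z k)).sub (hint k)
  -- Jensen: the independent copy z' has mean zero, so each form at z is the mean of the form at z -
  -- z'.
  have h1 : ∀ z, supForm S z ≤ ∫ z', supForm S (z - z') ∂P := by
    intro z
    refine supForm_le hne fun t ht => ?_
    have e : ∫ z', ∑ k, t k * (z - z') k ∂P = ∑ k, t k * z k := by
      rw [integral_finsetSum _ fun k _ => (hX2 z k).const_mul _]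
      refine Finset.sum_congr rfl fun k _ => ?_
      rw [integral_const_mul]
      simp only [Pi.sub_apply]
      rw [integral_sub (integrable_const _) (hint k), hmean, integral_const]
      simp
    rw [← e]
    exact integral_mono (integrable_finsetSum _ fun k _ => (hX2 z k).const_mul _)
      (hS.integrable_supForm hne (hX2 z)) fun z' => hS.le_supForm ht _
  have hI := hS.integrable_supForm hne hX1
  have h2 : ∫ z, supForm S z ∂P ≤ ∫ q, supForm S (q.1 - q.2) ∂(P.prod P) := by
    rw [integral_prod _ hI]
    exact integral_mono (hS.integrable_supForm hne hint) hI.integral_prod_left h1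
  -- Exchanging the two copies in the coordinates with sign -1 preserves the product law and
  -- multiplies z - z' by the sign vector.
  have h3 : ∀ ε : Fin n → Bool, ∫ q, supForm S (signVec ε * (q.1 - q.2)) ∂(P.prod P) =
      ∫ q, supForm S (q.1 - q.2) ∂(P.prod P) := by
    intro ε
    have hmp := measurePreserving_swapCoords ν ε
    have hae : AEStronglyMeasurable (fun q : (Fin n → ℝ) × (Fin n → ℝ) => supForm S (q.1 - q.2))
        (Measure.map (fun q : (Fin n → ℝ) × (Fin n → ℝ) =>
          ((fun k => if ε k then q.1 k else q.2 k), fun k => if ε k then q.2 k else q.1 k))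
          (P.prod P)) := by
      rw [hmp.map_eq]; exact hI.aestronglyMeasurable
    have h := integral_map hmp.measurable.aemeasurable hae
    rw [hmp.map_eq] at h
    rw [h]
    refine integral_congr_ae (Filter.Eventually.of_forall fun q => ?_)
    dsimp only
    congr 1
    funext k
    cases hk : ε k <;> simp [signVec, signVal, hk]
  -- Subadditivity separates the copies; the second carries the reversed signs, which have the same
  -- average. Two copies give the factor 2.
  have h4 : ∀ q : (Fin n → ℝ) × (Fin n → ℝ),
      signAvg (fun ε => supForm S (signVec ε * (q.1 - q.2))) ≤ f q.1 + f q.2 := by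
    intro q
    have e : ∀ ε : Fin n → Bool, signVec ε * (q.1 - q.2) =
        signVec ε * q.1 + signVec (fun k => !ε k) * q.2 := by
      intro ε
      funext k
      simp only [signVec, Pi.mul_apply, Pi.sub_apply, Pi.add_apply, signVal_not]
      ring
    have h5 := signAvg_mono fun ε => (le_of_eq (congrArg (supForm S) (e ε))).trans
      (hS.supForm_add_le hne (signVec ε * q.1) (signVec (fun k => !ε k) * q.2))
    rw [signAvg_add, signAvg_comp_not fun ε => supForm S (signVec ε * q.2)] at h5
    exact h5.trans (add_le_add (signAvg_supForm_le hne (hRad _))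
      (signAvg_supForm_le hne (hRad _)))
  have h5 : ∫ q, supForm S (q.1 - q.2) ∂(P.prod P) =
      ∫ q, signAvg (fun ε => supForm S (signVec ε * (q.1 - q.2))) ∂(P.prod P) := by
    unfold signAvg
    rw [integral_div, integral_finsetSum _ fun ε _ => hS.integrable_supForm hne (hX ε)]
    simp only [h3]
    have := signAvg_const (n := n) (∫ q, supForm S (q.1 - q.2) ∂(P.prod P))
    rw [signAvg] at this
    exact this.symm
  have hf1 := hf.comp_fst P
  have hf2 := hf.comp_snd P
  have h6 : ∫ q, signAvg (fun ε => supForm S (signVec ε * (q.1 - q.2))) ∂(P.prod P) ≤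
      ∫ q, (f q.1 + f q.2) ∂(P.prod P) := by
    refine integral_mono ?_ (hf1.add hf2) h4
    unfold signAvg
    exact (integrable_finsetSum _ fun ε _ => hS.integrable_supForm hne (hX ε)).div_const _
  rw [integral_add hf1 hf2, integral_fun_fst, integral_fun_snd] at h6
  simp only [probReal_univ, one_smul] at h6
  linarith

end Symmetrization

/-! ### Moments of the weighted sum of squares. -/

section Moments

variable {n : ℕ} {Ω : Type*} [MeasurableSpace Ω] {μ : Measure Ω}

lemma sum_pow_four_le {ι : Type*} (s : Finset ι) {f : ι → ℝ} (hf : ∀ i, 0 ≤ f i) :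
    ∑ i ∈ s, f i ^ 4 ≤ (∑ i ∈ s, f i) ^ 4 := by
  classical
  induction s using Finset.induction_on with
  | empty => simp
  | insert i s hi ih =>
    rw [Finset.sum_insert hi, Finset.sum_insert hi]
    exact (add_le_add_right ih _).trans
      (pow_add_pow_le (hf i) (Finset.sum_nonneg fun j _ => hf j) four_ne_zero)

/-- The ℓ_4 norm is at most the ℓ_1 norm. Hence first moments of the Z_k suffice for the middle
expectation to be finite, even when fourth moments are infinite. -/
lemma weightedSumSq_rpow_le (a : Fin n → Fin n → Fin n → ℝ) (z : Fin n → ℝ) :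
    weightedSumSq a z ^ (1 / 4 : ℝ) ≤ ∑ i, ∑ j, ∑ k, Real.sqrt |a i j k| * |z k| := by
  set b : Fin n → Fin n → Fin n → ℝ := fun i j k => Real.sqrt |a i j k| * |z k| with hb
  have hb0 : ∀ i j k, 0 ≤ b i j k := fun i j k => by positivity
  have hb4 : ∀ i j k, a i j k ^ 2 * z k ^ 4 = b i j k ^ 4 := by
    intro i j k
    rw [hb]
    dsimp only
    rw [mul_pow, show Real.sqrt |a i j k| ^ 4 = (Real.sqrt |a i j k| ^ 2) ^ 2 by ring,
      Real.sq_sqrt (abs_nonneg _), sq_abs, show |z k| ^ 4 = (|z k| ^ 2) ^ 2 by ring, sq_abs]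
    ring
  have hle : weightedSumSq a z ≤ (∑ i, ∑ j, ∑ k, b i j k) ^ 4 := by
    simp only [weightedSumSq, hb4]
    refine (Finset.sum_le_sum fun i _ => (Finset.sum_le_sum fun j _ =>
      sum_pow_four_le _ (hb0 i j)).trans
      (sum_pow_four_le _ fun j => Finset.sum_nonneg fun k _ => hb0 i j k)).trans ?_
    exact sum_pow_four_le _ fun i => Finset.sum_nonneg fun j _ =>
      Finset.sum_nonneg fun k _ => hb0 i j k
  have h0 : 0 ≤ ∑ i, ∑ j, ∑ k, b i j k :=
    Finset.sum_nonneg fun i _ => Finset.sum_nonneg fun j _ => Finset.sum_nonneg fun k _ =>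
      hb0 i j k
  refine (Real.rpow_le_rpow (weightedSumSq_nonneg a z) hle (by norm_num)).trans (le_of_eq ?_)
  rw [← Real.rpow_natCast, ← Real.rpow_mul h0, show ((4 : ℕ) : ℝ) * (1 / 4) = 1 by norm_num,
    Real.rpow_one]

lemma continuous_weightedSumSq_rpow (a : Fin n → Fin n → Fin n → ℝ) :
    Continuous fun z => weightedSumSq a z ^ (1 / 4 : ℝ) := by
  have h : Continuous (weightedSumSq a) := by
    unfold weightedSumSq
    fun_prop
  exact h.rpow_const fun _ => Or.inr (by norm_num)

lemma integrable_weightedSumSq_rpow (a : Fin n → Fin n → Fin n → ℝ) {X : Ω → Fin n → ℝ}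
    (hX : ∀ k, Integrable (fun ω => X ω k) μ) :
    Integrable (fun ω => weightedSumSq a (X ω) ^ (1 / 4 : ℝ)) μ := by
  have hb : Integrable (fun ω => ∑ i, ∑ j, ∑ k, Real.sqrt |a i j k| * |X ω k|) μ :=
    integrable_finsetSum _ fun i _ => integrable_finsetSum _ fun j _ =>
      integrable_finsetSum _ fun k _ => (hX k).abs.const_mul _
  refine hb.mono' ?_ (Filter.Eventually.of_forall fun ω => ?_)
  · exact (continuous_weightedSumSq_rpow a).comp_aestronglyMeasurable
      (aemeasurable_pi_lambda _ fun k => (hX k).aemeasurable).aestronglyMeasurable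
  · rw [Real.norm_of_nonneg (Real.rpow_nonneg (weightedSumSq_nonneg a _) _)]
    exact weightedSumSq_rpow_le a _

lemma eLpNorm_four_pow (f : Ω → ℝ) : eLpNorm f 4 μ ^ 4 = ∫⁻ ω, ENNReal.ofReal (f ω ^ 4) ∂μ := by
  rw [eLpNorm_eq_lintegral_rpow_enorm_toReal (by norm_num) (by norm_num), ← ENNReal.rpow_natCast,
    ← ENNReal.rpow_mul]
  norm_num
  refine lintegral_congr fun ω => ?_
  rw [← ofReal_norm, ← ENNReal.ofReal_pow (norm_nonneg _), Real.norm_eq_abs,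
    show |f ω| ^ 4 = (|f ω| ^ 2) ^ 2 by ring, sq_abs]
  congr 1
  ring

/-- The expectation of the weighted sum is controlled by the largest fourth moment. -/
lemma ofReal_integral_weightedSumSq_rpow_le [IsProbabilityMeasure μ]
    (a : Fin n → Fin n → Fin n → ℝ) {Z : Fin n → Ω → ℝ} (hZ : ∀ k, Integrable (Z k) μ) :
    ENNReal.ofReal (∫ ω, weightedSumSq a (fun k => Z k ω) ^ (1 / 4 : ℝ) ∂μ) ≤
      ENNReal.ofReal (sumSq a ^ (1 / 4 : ℝ)) * ⨆ k, eLpNorm (Z k) 4 μ := by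
  set W : Ω → ℝ := fun ω => weightedSumSq a (fun k => Z k ω) ^ (1 / 4 : ℝ) with hW
  have hW0 : ∀ ω, 0 ≤ W ω := fun ω => Real.rpow_nonneg (weightedSumSq_nonneg a _) _
  have hWi : Integrable W μ := integrable_weightedSumSq_rpow a hZ
  have h1 : ENNReal.ofReal (∫ ω, W ω ∂μ) = eLpNorm W 1 μ := by
    rw [ofReal_integral_eq_lintegral_ofReal hWi (Filter.Eventually.of_forall hW0),
      eLpNorm_one_eq_lintegral_enorm]
    exact lintegral_congr fun ω => by rw [Real.enorm_of_nonneg (hW0 ω)]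
  rw [h1]
  -- On a probability space the L¹ norm is at most the L⁴ norm, whose fourth power is a linear
  -- combination of the fourth moments; computing in [0,∞] covers infinite ones.
  refine (eLpNorm_le_eLpNorm_of_exponent_le (q := 4) (by norm_num)
    hWi.aestronglyMeasurable).trans ?_
  refine (ENNReal.pow_le_pow_left_iff four_ne_zero).1 ?_
  rw [eLpNorm_four_pow, mul_pow,
    ← ENNReal.ofReal_pow (Real.rpow_nonneg (sumSq_nonneg a) _),
    rpow_quarter_pow_four (sumSq_nonneg a)]
  have hm : ∀ k, AEMeasurable (fun ω => ENNReal.ofReal (Z k ω ^ 4)) μ := fun k =>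
    ((hZ k).aemeasurable.pow_const 4).ennreal_ofReal
  have e1 : ∀ ω, ENNReal.ofReal (W ω ^ 4) =
      ∑ i, ∑ j, ∑ k, ENNReal.ofReal (a i j k ^ 2) * ENNReal.ofReal (Z k ω ^ 4) := by
    intro ω
    rw [hW]
    dsimp only
    rw [rpow_quarter_pow_four (weightedSumSq_nonneg a _), weightedSumSq,
      ENNReal.ofReal_sum_of_nonneg fun i _ => Finset.sum_nonneg fun j _ =>
        Finset.sum_nonneg fun k _ => by positivity]
    refine Finset.sum_congr rfl fun i _ => ?_
    rw [ENNReal.ofReal_sum_of_nonneg fun j _ => Finset.sum_nonneg fun k _ => by positivity]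
    refine Finset.sum_congr rfl fun j _ => ?_
    rw [ENNReal.ofReal_sum_of_nonneg fun k _ => by positivity]
    exact Finset.sum_congr rfl fun k _ => ENNReal.ofReal_mul (sq_nonneg _)
  have e2 : ENNReal.ofReal (sumSq a) = ∑ i, ∑ j, ∑ k, ENNReal.ofReal (a i j k ^ 2) := by
    rw [sumSq, ENNReal.ofReal_sum_of_nonneg fun i _ => Finset.sum_nonneg fun j _ =>
        Finset.sum_nonneg fun k _ => by positivity]
    refine Finset.sum_congr rfl fun i _ => ?_
    rw [ENNReal.ofReal_sum_of_nonneg fun j _ => Finset.sum_nonneg fun k _ => by positivity]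
    refine Finset.sum_congr rfl fun j _ => ?_
    rw [ENNReal.ofReal_sum_of_nonneg fun k _ => by positivity]
  simp only [e1, e2, Finset.sum_mul]
  rw [lintegral_finsetSum' _ fun i _ => Finset.aemeasurable_fun_sum _ fun j _ =>
    Finset.aemeasurable_fun_sum _ fun k _ => (hm k).const_mul _]
  refine Finset.sum_le_sum fun i _ => ?_
  rw [lintegral_finsetSum' _ fun j _ => Finset.aemeasurable_fun_sum _ fun k _ =>
    (hm k).const_mul _]
  refine Finset.sum_le_sum fun j _ => ?_
  rw [lintegral_finsetSum' _ fun k _ => (hm k).const_mul _]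
  refine Finset.sum_le_sum fun k _ => ?_
  rw [lintegral_const_mul'' _ (hm k), ← eLpNorm_four_pow]
  gcongr
  exact le_iSup (fun k => eLpNorm (Z k) 4 μ) k

end Moments

/-! ### Assembly. -/

theorem mainTheorem8 :
    ∃ L : ℝ, 0 < L ∧
      ∀ (n : ℕ) (a : Fin n → Fin n → Fin n → ℝ)
        (Ω : Type*) [MeasurableSpace Ω] (μ : Measure Ω) [IsProbabilityMeasure μ]
        (Z : Fin n → Ω → ℝ),
        iIndepFun Z μ → (∀ k, Integrable (Z k) μ) → (∀ k, ∫ ω, Z k ω ∂μ = 0) →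
        ∀ p : ℝ, 1 ≤ p →
        ∃ (N : ℕ) (v : Fin N → (Fin n → ℝ) × (Fin n → ℝ))
          (T : Fin N → Set ((Fin n → ℝ) × (Fin n → ℝ))),
          (N : ℝ) ≤ Real.exp (L * p) ∧
          (∀ l, v l ∈ mixedBall p n ×ˢ mixedBall p n) ∧
          mixedBall p n ×ˢ mixedBall p n = ⋃ l, (fun w => v l + w) '' T l ∧
          -- the expectation in the middle of the chain of inequalities is finite
          Integrable (fun ω => weightedSumSq a (fun k => Z k ω) ^ (1 / 4 : ℝ)) μ ∧
          ∀ l,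
            -- the supremum is finite and its expectation exists
            (∀ z : Fin n → ℝ, BddAbove (Set.range fun w : T l => trilinForm a w.1.1 w.1.2 z)) ∧
            Integrable (fun ω => ⨆ w : T l, trilinForm a w.1.1 w.1.2 (fun k => Z k ω)) μ ∧
            ∫ ω, (⨆ w : T l, trilinForm a w.1.1 w.1.2 (fun k => Z k ω)) ∂μ
              ≤ L / Real.sqrt p * sumSq a ^ (1 / 4 : ℝ)
                  * ∫ ω, weightedSumSq a (fun k => Z k ω) ^ (1 / 4 : ℝ) ∂μ ∧
            -- in `[0, ∞]`, since the fourth moments may be infinite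
            ENNReal.ofReal (L / Real.sqrt p * sumSq a ^ (1 / 4 : ℝ)
                * ∫ ω, weightedSumSq a (fun k => Z k ω) ^ (1 / 4 : ℝ) ∂μ)
              ≤ ENNReal.ofReal (L / Real.sqrt p * hsNorm a) * ⨆ k, eLpNorm (Z k) 4 μ := by
  have hcov := coverConst_pos
  have hchain := chainConst_pos
  -- The first term bounds the entropy; 6 is the 3 of the conditional estimate times the 2 of
  -- symmetrization.
  obtain ⟨L, hL⟩ : ∃ L, L = coverConst + 6 * chainConst := ⟨_, rfl⟩
  have hL0 : 0 < L := by rw [hL]; positivity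
  refine ⟨L, hL0, ?_⟩
  intro n a Ω _ μ _ Z hind hint hmean p hp
  have hp0 : 0 < p := by linarith
  have hsp := Real.sqrt_pos.2 hp0
  obtain ⟨N, v, T, M, hN, hv, hT, hM, hRad⟩ := exists_mixedBall_partition a hp
  have hs0 := Real.rpow_nonneg (sumSq_nonneg a) (1 / 4 : ℝ)
  have hW := integrable_weightedSumSq_rpow (μ := μ) a (X := fun ω k => Z k ω) hint
  have hW0 : 0 ≤ ∫ ω, weightedSumSq a (fun k => Z k ω) ^ (1 / 4 : ℝ) ∂μ :=
    integral_nonneg fun ω => Real.rpow_nonneg (weightedSumSq_nonneg a _) _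
  have hsup : ∀ l z, (⨆ w : T l, trilinForm a w.1.1 w.1.2 z) =
      supForm (coeffVec a '' T l) z := by
    intro l z
    simp only [trilinForm_eq, supForm, iSup]
    congr 1
    ext x
    simp
  have hS : ∀ l, EntryBounded (coeffVec a '' T l) M := by
    rintro l _ ⟨w, hw, rfl⟩ k
    exact hM l w hw k
  refine ⟨N, v, T, hN.trans (Real.exp_le_exp.2 ?_), hv, hT, hW, fun l => ⟨?_, ?_, ?_, ?_⟩⟩
  · exact mul_le_mul_of_nonneg_right (by linarith) hp0.le
  · intro z
    refine ⟨M * ∑ k, |z k|, ?_⟩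
    rintro _ ⟨w, rfl⟩
    dsimp only
    rw [trilinForm_eq]
    exact (le_abs_self _).trans ((hS l).abs_sum_le ⟨_, w.2, rfl⟩ z)
  -- The real supremum over an empty type is 0, in agreement with the stated convention.
  · rcases (T l).eq_empty_or_nonempty with he | hne
    · have : IsEmpty (T l) := Set.isEmpty_coe_sort.2 he
      simp only [Real.iSup_of_isEmpty]
      exact integrable_zero _ _ _
    · simp only [hsup]
      exact (hS l).integrable_supForm (hne.image _) hint
  · rcases (T l).eq_empty_or_nonempty with he | hne
    · have : IsEmpty (T l) := Set.isEmpty_coe_sort.2 he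
      simp only [Real.iSup_of_isEmpty, integral_zero]
      exact mul_nonneg (mul_nonneg (div_nonneg hL0.le hsp.le) hs0) hW0
    · simp only [hsup]
      have hmZ : ∀ k, AEMeasurable (Z k) μ := fun k => (hint k).aemeasurable
      have hmV : AEMeasurable (fun ω k => Z k ω) μ := aemeasurable_pi_lambda _ hmZ
      -- Independence is used here only: the joint law of Z is a product, so symmetrization takes
      -- place on ℝⁿ and is transported back along continuous functions.
      have hmap := (iIndepFun_iff_map_fun_eq_pi_map hmZ).1 hind
      have hprob : ∀ k, IsProbabilityMeasure (μ.map (Z k)) := fun k =>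
        Measure.isProbabilityMeasure_map (hmZ k)
      have tr : ∀ g : (Fin n → ℝ) → ℝ, Continuous g →
          ∫ z, g z ∂(Measure.pi fun k => μ.map (Z k)) = ∫ ω, g (fun k => Z k ω) ∂μ := by
        intro g hg
        rw [← hmap, integral_map hmV hg.aestronglyMeasurable]
      have tri : ∀ g : (Fin n → ℝ) → ℝ, Continuous g → Integrable (fun ω => g fun k => Z k ω) μ →
          Integrable g (Measure.pi fun k => μ.map (Z k)) := by
        intro g hg hi
        rw [← hmap]
        exact (integrable_map_measure hg.aestronglyMeasurable hmV).2 hi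
      have key := integral_supForm_le (fun k => μ.map (Z k)) (S := coeffVec a '' T l)
        (f := fun z => 3 * chainConst / Real.sqrt p * sumSq a ^ (1 / 4 : ℝ) *
          weightedSumSq a z ^ (1 / 4 : ℝ))
        (fun k => tri _ (continuous_apply k) (hint k))
        (fun k => (tr _ (continuous_apply k)).trans (hmean k)) (hS l) (hne.image _)
        ((tri _ (continuous_weightedSumSq_rpow a) hW).const_mul _)
        (fun z => by rw [Set.image_image]; exact hRad l z)
      rw [tr _ ((hS l).continuous_supForm (hne.image _)), integral_const_mul,
        tr _ (continuous_weightedSumSq_rpow a)] at key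
      refine key.trans ?_
      rw [← mul_assoc]
      refine mul_le_mul_of_nonneg_right ?_ hW0
      rw [← mul_assoc, ← mul_div_assoc]
      refine mul_le_mul_of_nonneg_right (div_le_div_of_nonneg_right ?_ hsp.le) hs0
      linarith
  · have hs2 : sumSq a ^ (1 / 4 : ℝ) * sumSq a ^ (1 / 4 : ℝ) = hsNorm a := by
      rw [hsNorm, Real.sqrt_eq_rpow, ← Real.rpow_add_of_nonneg (sumSq_nonneg a) (by norm_num)
        (by norm_num)]
      norm_num
    have hLp : 0 ≤ L / Real.sqrt p := div_nonneg hL0.le hsp.le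
    have hLs := mul_nonneg hLp hs0
    rw [ENNReal.ofReal_mul hLs, ← hs2, ← mul_assoc, ENNReal.ofReal_mul hLs, mul_assoc]
    refine mul_le_mul_right ?_ _
    exact ofReal_integral_weightedSumSq_rpow_le a hint
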